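/- Notation. For an integer $k\ge 0$ and a $C^k$ function $f:[-\pi,\pi]\to\mathbb R$ put $\|f\|_{C^k}=\sum_{j=0}^{k}\sup_{x\in[-\pi,\pi]}|f^{(j)}(x)|$, with one-sided derivatives at $\pm\pi$. Given $a_0\in C^3([-\pi,\pi])$, a global $C^3$ solution with initial datum $a_0$ is a function $a\in C^3([0,\infty)\times[-\pi,\pi])$ with $a(0,x)=a_0(x)$ for all $x\in[-\pi,\pi]$ that satisfies the Proudman–Johnson equation $$\partial_t a(t,x)+\Big(\int_{-\pi}^x a(t,y)\,dy\Big)\,\partial_x a(t,x)-a(t,x)^2+\frac1\pi\int_{-\pi}^{\pi}a(t,y)^2\,dy=0\qquad\text{for all }(t,x)\in[0,\infty)\times[-\pi,\pi].$$ No periodicity in $x$ is assumed. Theorem. There are universal constants $\delta>0$ and $C>0$ such that the following holds for every $\mu>0$. Let $a_0\in C^3([-\pi,\pi])$ satisfy $\int_{-\pi}^{\pi}a_0(x)\,dx=0$ and $$\|a_0-\mu\cos\|_{C^3}=\sigma\le\delta\mu .$$ Then there is a unique global $C^3$ solution $a$ with initial datum $a_0$, and $\int_{-\pi}^{\pi}a(t,x)\,dx=0$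 for all $t\ge0$. Moreover, $a_0$ attains its maximum over $[-\pi,\pi]$ at exactly one point $x_0^*$, and with $\mu_*=-\partial_x^2a_0(x_0^*)$ one has $$|\mu_*-\mu|\le C\sigma\qquad\text{and}\qquad \|a(t,\cdot)-\mu_*\cos\|_{C^1}\le C\,\sigma\,e^{-\mu t/2}\quad\text{for all }t\ge0 .$$ -/

import Mathlib

/-- The `C^k` norm on `[-π, π]`:
`‖f‖_{C^k([-π,π])} = ∑_{j ≤ k} sup_{x ∈ [-π,π]} |f^{(j)}(x)|`
(one-sided derivatives at the endpoints). It is applied only to functions that are `C^k` on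
the compact interval, so that the suprema are those of bounded functions. -/
noncomputable def cNorm (k : ℕ) (f : ℝ → ℝ) : ℝ :=
  ∑ j ∈ Finset.range (k + 1), ⨆ x : Set.Icc (-Real.pi) Real.pi,
    |iteratedDerivWithin j f (Set.Icc (-Real.pi) Real.pi) x|

/-- `a` (as a function of `t` and `x`) is a global-in-time `C³` solution on
`[0, ∞) × [-π, π]` of the Proudman–Johnson equation
`∂ₜ a + (∫_{-π}^x a(t, y) dy) ∂ₓ a - a² + (1/π) ∫_{-π}^π a(t, y)² dy = 0`
with initial datum `a₀`. Derivatives at the boundary of the domain are one-sided, and the values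
of `a` and `a₀` outside the domain are irrelevant. No periodicity is required. -/
structure IsGlobalC3Solution (a₀ : ℝ → ℝ) (a : ℝ → ℝ → ℝ) : Prop where
  contDiffOn : ContDiffOn ℝ 3 (fun p : ℝ × ℝ => a p.1 p.2)
    (Set.Ici (0 : ℝ) ×ˢ Set.Icc (-Real.pi) Real.pi)
  initial : ∀ x ∈ Set.Icc (-Real.pi) Real.pi, a 0 x = a₀ x
  equation : ∀ t ∈ Set.Ici (0 : ℝ), ∀ x ∈ Set.Icc (-Real.pi) Real.pi,
    derivWithin (fun s => a s x) (Set.Ici 0) t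
      + (∫ y in (-Real.pi)..x, a t y) * derivWithin (a t) (Set.Icc (-Real.pi) Real.pi) x
      - a t x ^ 2
      + 1 / Real.pi * ∫ y in (-Real.pi)..Real.pi, a t y ^ 2 = 0

/-! The amplitude scaling `μ * a (μ * t) x` reduces everything to `μ = 1`, and the datum extends to
a `C³` function `f` on the line.

The equation is solvable along characteristics. Put `K n` for the mean of `f ^ n / (1 - η f) ^ (n +
1)` and use a new time `η` with `dt = K 0 ^ 2 dη`. The flow has Jacobian `1 / ((1 - η f) K 0)` and
carries the value `f / ((1 - η f) K 0 ^ 2) - K 1 / K 0 ^ 3` (`isGlobalC3Solution_sol`). The formula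
lives as long as the gap `ε = 1 - η * max f` is positive. Since the maximum at `x₀` is
nondegenerate, `K 0 ^ 2` grows like `1 / ε`, so physical time runs to infinity before the gap
closes: the solution is global. Uniqueness is an `L²` energy estimate.

For convergence, the second Eulerian space derivative along the flow is `f'' + η f' ^ 2 / (1 - η
f)`. At `x₀` it equals `f'' x₀` for all times, which is why `-f'' x₀` is the limit amplitude. The
cosine satisfies `cos'' = -1 + (1 - cos)` and `sin ^ 2 = 2 (1 - cos) - (1 - cos) ^ 2`. With the
analogous relations for `f`, this second derivative becomes affine in the solution plus a defect:
the solution obeys `a'' = α - lam ^ 2 * a + E` at each time, with `lam` near `1`. The defect is at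
most a multiple of `σ |x - x₀|` (`abs_defect_le`), while the Jacobian concentrates at `x₀`, so the
integral of `E` is `O(σ √ε log (1 / ε))` (`moment_le_log`). Since `ε` is bounded by a multiple of
`exp (-3t/2)` (`gap_le_exp`), this beats `exp (-t/2)`.

Finally `oscillator_stability` turns a small integrated defect, zero mean, small slopes at `±π` and
the known curvature at `x₀` into closeness of the slope to that of `-f'' x₀ * cos`. Zero mean then
upgrades slope control to `C¹` control. -/

open Set

/-! ### Extension to the line and calculus on the half-strip -/

/-- A `C^n` function on a compact interval extends to a `C^n` function on the line. -/
theorem exists_contDiff_extension {a b : ℝ} (hab : a < b) (n : ℕ) :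
    ∀ f : ℝ → ℝ, ContDiffOn ℝ n f (Icc a b) →
      ∃ g : ℝ → ℝ, ContDiff ℝ n g ∧ EqOn f g (Icc a b) := by
  induction n with
  | zero =>
    intro f hf
    have hc : ContinuousOn f (Icc a b) := hf.continuousOn
    refine ⟨IccExtend hab.le ((Icc a b).domRestrict f), ?_, ?_⟩
    · exact contDiff_zero.2 (hc.domRestrict.Icc_extend')
    · intro x hx
      rw [IccExtend_of_mem _ _ hx]; rfl
  | succ n ih =>
    intro f hf
    have hu : UniqueDiffOn ℝ (Icc a b) := uniqueDiffOn_Icc hab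
    have hf' := hf
    push_cast at hf'
    rw [contDiffOn_succ_iff_derivWithin hu] at hf'
    obtain ⟨hd, -, hd'⟩ := hf'
    -- The derivative is extended by induction; its primitive, normalised at `a`, extends `f`.
    obtain ⟨g', hg', hfg'⟩ := ih _ hd'
    have hder : ∀ x, HasDerivAt (fun x => f a + ∫ y in a..x, g' y) (g' x) x := fun x =>
      (intervalIntegral.integral_hasDerivAt_right (hg'.continuous.intervalIntegrable _ _)
        (hg'.continuous.stronglyMeasurableAtFilter _ _) hg'.continuous.continuousAt).const_add _
    refine ⟨fun x => f a + ∫ y in a..x, g' y, ?_, ?_⟩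
    · push_cast
      rw [contDiff_succ_iff_deriv]
      refine ⟨fun x => (hder x).differentiableAt, by simp, ?_⟩
      have : deriv (fun x => f a + ∫ y in a..x, g' y) = g' := funext fun x => (hder x).deriv
      rwa [this]
    · intro x hx
      have := intervalIntegral.integral_eq_sub_of_hasDerivAt_of_le (f := f) (f' := g') hx.1
        (hf.continuousOn.mono (Icc_subset_Icc_right hx.2))
        (fun y hy => ?_) (hg'.continuous.intervalIntegrable _ _)
      · simp only [this]; ring
      · have hy' : y ∈ Ioo a b := ⟨hy.1, hy.2.trans_le hx.2⟩
        have h1 := (hd y (Ioo_subset_Icc_self hy')).hasDerivWithinAt.hasDerivAt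
          (Icc_mem_nhds hy'.1 hy'.2)
        rwa [hfg' (Ioo_subset_Icc_self hy')] at h1

/-- The space-time domain `[0, ∞) × [-π, π]`. -/
abbrev slab : Set (ℝ × ℝ) := Ici (0 : ℝ) ×ˢ Icc (-Real.pi) Real.pi

theorem neg_pi_lt_pi : -Real.pi < Real.pi := by linarith [Real.pi_pos]

theorem uniqueDiffOn_slab : UniqueDiffOn ℝ slab :=
  (uniqueDiffOn_Ici 0).prod (uniqueDiffOn_Icc neg_pi_lt_pi)

theorem continuousOn_slice {F : ℝ → ℝ → ℝ} (h : ContinuousOn (fun p : ℝ × ℝ => F p.1 p.2) slab)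
    {t : ℝ} (ht : 0 ≤ t) : ContinuousOn (F t) (Icc (-Real.pi) Real.pi) :=
  h.comp (f := fun x : ℝ => (t, x)) (by fun_prop) fun _ hx => ⟨ht, hx⟩

theorem intervalIntegrable_of_Icc {f : ℝ → ℝ} (h : ContinuousOn f (Icc (-Real.pi) Real.pi)) :
    IntervalIntegrable f MeasureTheory.volume (-Real.pi) Real.pi :=
  ContinuousOn.intervalIntegrable (by rwa [uIcc_of_le neg_pi_lt_pi.le])

theorem exists_bound_slab {F : ℝ → ℝ → ℝ} (h : ContinuousOn (fun p : ℝ × ℝ => F p.1 p.2) slab)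
    (T : ℝ) : ∃ B, 0 ≤ B ∧ ∀ t ∈ Icc 0 T, ∀ x ∈ Icc (-Real.pi) Real.pi, |F t x| ≤ B := by
  obtain ⟨B, hB⟩ := ((isCompact_Icc (a := (0 : ℝ)) (b := T)).prod
    (isCompact_Icc (a := -Real.pi) (b := Real.pi))).exists_bound_of_continuousOn
    (h.mono (prod_mono Icc_subset_Ici_self le_rfl))
  exact ⟨max B 0, le_max_right _ _, fun t ht x hx =>
    (hB (t, x) ⟨ht, hx⟩).trans (le_max_left _ _)⟩

/-- Differentiation of a space integral, in the quadratic time variable `t = s ^ 2`, which makes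
the one-sided derivative at `t = 0` two-sided. -/
theorem hasDerivAt_integral_sq {φ φt : ℝ → ℝ → ℝ}
    (hφ : ContinuousOn (fun p : ℝ × ℝ => φ p.1 p.2) slab)
    (hφt : ContinuousOn (fun p : ℝ × ℝ => φt p.1 p.2) slab)
    (hd : ∀ t, 0 ≤ t → ∀ x ∈ Icc (-Real.pi) Real.pi,
      HasDerivWithinAt (fun s => φ s x) (φt t x) (Ici 0) t) (s : ℝ) :
    HasDerivAt (fun s => ∫ x in (-Real.pi)..Real.pi, φ (s ^ 2) x)
      (2 * s * ∫ x in (-Real.pi)..Real.pi, φt (s ^ 2) x) s := by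
  have hsub : uIoc (-Real.pi) Real.pi ⊆ Icc (-Real.pi) Real.pi := by
    rw [uIoc_of_le neg_pi_lt_pi.le]; exact Ioc_subset_Icc_self
  have hmeas : ∀ {f : ℝ → ℝ}, ContinuousOn f (Icc (-Real.pi) Real.pi) →
      MeasureTheory.AEStronglyMeasurable f
        (MeasureTheory.volume.restrict (uIoc (-Real.pi) Real.pi)) := fun h =>
    (h.mono hsub).aestronglyMeasurable measurableSet_uIoc
  obtain ⟨B, hB0, hB⟩ := exists_bound_slab hφt ((|s| + 1) ^ 2)
  have key := intervalIntegral.hasDerivAt_integral_of_dominated_loc_of_deriv_le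
    (F := fun s x => φ (s ^ 2) x) (F' := fun s x => 2 * s * φt (s ^ 2) x) (x₀ := s)
    (a := -Real.pi) (b := Real.pi) (μ := MeasureTheory.volume)
    (bound := fun _ => 2 * (|s| + 1) * B) (s := Metric.ball s 1) (Metric.ball_mem_nhds _ one_pos)
    (Filter.Eventually.of_forall fun r => hmeas (continuousOn_slice hφ (sq_nonneg r)))
    (intervalIntegrable_of_Icc (continuousOn_slice hφ (sq_nonneg s)))
    (hmeas ((continuousOn_slice hφt (sq_nonneg s)).const_mul _))
    (Filter.Eventually.of_forall fun x hx r hr => ?_)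
    (by simp) (Filter.Eventually.of_forall fun x hx r hr => ?_)
  · have := key.2
    simpa only [intervalIntegral.integral_const_mul] using this
  · have hr' : |r| ≤ |s| + 1 := by
      have := abs_sub_abs_le_abs_sub r s
      rw [Metric.mem_ball, Real.dist_eq] at hr
      linarith
    have h2 : r ^ 2 ∈ Icc 0 ((|s| + 1) ^ 2) :=
      ⟨sq_nonneg r, by rw [← sq_abs r]; gcongr⟩
    rw [Real.norm_eq_abs, abs_mul, abs_mul, abs_two]
    have := hB _ h2 x (hsub hx)
    gcongr
  · have h1 := hd (r ^ 2) (sq_nonneg r) x (hsub hx)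
    have h2 : HasDerivWithinAt (fun r : ℝ => r ^ 2) (2 * r) univ r := by
      simpa using hasDerivAt_pow 2 r
    have := HasDerivWithinAt.comp (h₂ := fun s => φ s x) (h := fun r : ℝ => r ^ 2) r h1 h2
      (fun r _ => sq_nonneg r)
    rw [hasDerivWithinAt_univ] at this
    rw [mul_comm]
    exact this

/-- Grönwall's inequality for a space integral. -/
theorem integral_eq_zero_of_abs_deriv_le {φ φt : ℝ → ℝ → ℝ}
    (hφ : ContinuousOn (fun p : ℝ × ℝ => φ p.1 p.2) slab)
    (hφt : ContinuousOn (fun p : ℝ × ℝ => φt p.1 p.2) slab)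
    (hd : ∀ t, 0 ≤ t → ∀ x ∈ Icc (-Real.pi) Real.pi,
      HasDerivWithinAt (fun s => φ s x) (φt t x) (Ici 0) t)
    (h0 : ∫ x in (-Real.pi)..Real.pi, φ 0 x = 0) {T C : ℝ} (hT : 0 ≤ T)
    (hle : ∀ t ∈ Icc 0 T, |∫ x in (-Real.pi)..Real.pi, φt t x|
      ≤ C * |∫ x in (-Real.pi)..Real.pi, φ t x|) :
    ∫ x in (-Real.pi)..Real.pi, φ T x = 0 := by
  have hD := hasDerivAt_integral_sq hφ hφt hd
  -- Grönwall in `s` on `[0, √T]`: the chain-rule factor `2 * s` is at most `2 * √T`, which enters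
  -- the constant.
  have key := norm_le_gronwallBound_of_norm_deriv_right_le
    (f := fun s => ∫ x in (-Real.pi)..Real.pi, φ (s ^ 2) x)
    (f' := fun s => 2 * s * ∫ x in (-Real.pi)..Real.pi, φt (s ^ 2) x)
    (δ := 0) (K := 2 * √T * C) (ε := 0) (a := 0) (b := √T)
    (fun s _ => (hD s).continuousAt.continuousWithinAt)
    (fun s _ => (hD s).hasDerivWithinAt) (by simp [h0]) (fun s hs => ?_) (√T)
    ⟨Real.sqrt_nonneg _, le_rfl⟩
  · rw [gronwallBound_ε0_δ0, Real.sq_sqrt hT] at key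
    exact norm_le_zero_iff.1 key
  · have hs2 : s ^ 2 ∈ Icc 0 T := by
      refine ⟨sq_nonneg s, ?_⟩
      rw [← Real.sq_sqrt hT]
      exact pow_le_pow_left₀ hs.1 hs.2.le 2
    simp only [Real.norm_eq_abs, add_zero, abs_mul, abs_two, abs_of_nonneg hs.1]
    calc 2 * s * |∫ x in (-Real.pi)..Real.pi, φt (s ^ 2) x|
        ≤ 2 * √T * (C * |∫ x in (-Real.pi)..Real.pi, φ (s ^ 2) x|) := by
          gcongr
          · exact hs.2.le
          · exact hle _ hs2
      _ = _ := by ring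

/-! ### Conservation of the mean and uniqueness -/

/-- Solutions of the equation, presented with their partial derivatives. -/
theorem IsGlobalC3Solution.exists_partials {a₀ : ℝ → ℝ} {a : ℝ → ℝ → ℝ}
    (h : IsGlobalC3Solution a₀ a) :
    ∃ at' ax : ℝ → ℝ → ℝ,
      ContinuousOn (fun p : ℝ × ℝ => at' p.1 p.2) slab ∧
      ContinuousOn (fun p : ℝ × ℝ => ax p.1 p.2) slab ∧
      (∀ t, 0 ≤ t → ∀ x ∈ Icc (-Real.pi) Real.pi,
        HasDerivWithinAt (fun s => a s x) (at' t x) (Ici 0) t) ∧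
      (∀ t, 0 ≤ t → ∀ x ∈ Icc (-Real.pi) Real.pi,
        HasDerivWithinAt (a t) (ax t x) (Icc (-Real.pi) Real.pi) x) ∧
      ∀ t, 0 ≤ t → ∀ x ∈ Icc (-Real.pi) Real.pi,
        at' t x = a t x ^ 2 - (∫ y in (-Real.pi)..x, a t y) * ax t x
          - 1 / Real.pi * ∫ y in (-Real.pi)..Real.pi, a t y ^ 2 := by
  set F : ℝ × ℝ → ℝ := fun p => a p.1 p.2 with hF
  have hc : ContinuousOn (fderivWithin ℝ F slab) slab :=
    h.contDiffOn.continuousOn_fderivWithin uniqueDiffOn_slab (by norm_num)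
  have hfd : ∀ p ∈ slab, HasFDerivWithinAt F (fderivWithin ℝ F slab p) slab p := fun p hp =>
    (h.contDiffOn.differentiableOn (by norm_num) p hp).hasFDerivWithinAt
  have h1 : ∀ t, 0 ≤ t → ∀ x ∈ Icc (-Real.pi) Real.pi,
      HasDerivWithinAt (fun s => a s x) (fderivWithin ℝ F slab (t, x) (1, 0)) (Ici 0) t := by
    intro t ht x hx
    have hg : HasDerivWithinAt (fun s : ℝ => (s, x)) ((1 : ℝ), (0 : ℝ)) (Ici 0) t :=
      ((hasDerivAt_id t).prodMk (hasDerivAt_const t x)).hasDerivWithinAt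
    exact (hfd (t, x) ⟨ht, hx⟩).comp_hasDerivWithinAt t hg
      (show MapsTo (fun s : ℝ => (s, x)) (Ici 0) slab from fun s hs => ⟨hs, hx⟩)
  have h2 : ∀ t, 0 ≤ t → ∀ x ∈ Icc (-Real.pi) Real.pi,
      HasDerivWithinAt (a t) (fderivWithin ℝ F slab (t, x) (0, 1)) (Icc (-Real.pi) Real.pi) x := by
    intro t ht x hx
    have hg : HasDerivWithinAt (fun y : ℝ => (t, y)) ((0 : ℝ), (1 : ℝ)) (Icc (-Real.pi) Real.pi) x :=
      ((hasDerivAt_const x t).prodMk (hasDerivAt_id x)).hasDerivWithinAt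
    exact (hfd (t, x) ⟨ht, hx⟩).comp_hasDerivWithinAt x hg
      (show MapsTo (fun y : ℝ => (t, y)) (Icc (-Real.pi) Real.pi) slab from fun s hs => ⟨ht, hs⟩)
  refine ⟨fun t x => fderivWithin ℝ F slab (t, x) (1, 0),
    fun t x => fderivWithin ℝ F slab (t, x) (0, 1), ?_, ?_, h1, h2, ?_⟩
  · exact hc.clm_apply continuousOn_const
  · exact hc.clm_apply continuousOn_const
  · intro t ht x hx
    have he := h.equation t ht x hx
    rw [(h1 t ht x hx).derivWithin (uniqueDiffOn_Ici 0 t ht),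
      (h2 t ht x hx).derivWithin (uniqueDiffOn_Icc neg_pi_lt_pi x hx)] at he
    linarith

theorem hasDerivWithinAt_primitive {f : ℝ → ℝ} (hf : ContinuousOn f (Icc (-Real.pi) Real.pi))
    {x : ℝ} (hx : x ∈ Icc (-Real.pi) Real.pi) :
    HasDerivWithinAt (fun x => ∫ y in (-Real.pi)..x, f y) (f x) (Icc (-Real.pi) Real.pi) x := by
  have : Fact (x ∈ Icc (-Real.pi) Real.pi) := ⟨hx⟩
  refine intervalIntegral.integral_hasDerivWithinAt_right (s := Icc (-Real.pi) Real.pi)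
    (t := Icc (-Real.pi) Real.pi) ?_ ?_ (hf x hx)
  · refine ContinuousOn.intervalIntegrable ?_
    rw [uIcc_of_le hx.1]
    exact hf.mono (Icc_subset_Icc_right hx.2)
  · exact hf.stronglyMeasurableAtFilter_nhdsWithin measurableSet_Icc x

/-- Fundamental theorem of calculus on `[-π, π]` with one-sided derivatives. -/
theorem integral_eq_sub_of_hasDerivWithinAt {f f' : ℝ → ℝ}
    (hd : ∀ x ∈ Icc (-Real.pi) Real.pi, HasDerivWithinAt f (f' x) (Icc (-Real.pi) Real.pi) x)
    (hc : ContinuousOn f' (Icc (-Real.pi) Real.pi)) :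
    ∫ x in (-Real.pi)..Real.pi, f' x = f Real.pi - f (-Real.pi) :=
  intervalIntegral.integral_eq_sub_of_hasDerivAt_of_le neg_pi_lt_pi.le
    (fun x hx => (hd x hx).continuousWithinAt)
    (fun x hx => (hd x (Ioo_subset_Icc_self hx)).hasDerivAt (Icc_mem_nhds hx.1 hx.2))
    (intervalIntegrable_of_Icc hc)

theorem integral_mono_Icc {f g : ℝ → ℝ} (hf : ContinuousOn f (Icc (-Real.pi) Real.pi))
    (hg : ContinuousOn g (Icc (-Real.pi) Real.pi))
    (hle : ∀ x ∈ Icc (-Real.pi) Real.pi, f x ≤ g x) :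
    ∫ x in (-Real.pi)..Real.pi, f x ≤ ∫ x in (-Real.pi)..Real.pi, g x :=
  intervalIntegral.integral_mono_on neg_pi_lt_pi.le (intervalIntegrable_of_Icc hf)
    (intervalIntegrable_of_Icc hg) hle

theorem abs_integral_le_Icc {f g : ℝ → ℝ} (hf : ContinuousOn f (Icc (-Real.pi) Real.pi))
    (hg : ContinuousOn g (Icc (-Real.pi) Real.pi))
    (hle : ∀ x ∈ Icc (-Real.pi) Real.pi, |f x| ≤ g x) :
    |∫ x in (-Real.pi)..Real.pi, f x| ≤ ∫ x in (-Real.pi)..Real.pi, g x :=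
  (intervalIntegral.abs_integral_le_integral_abs neg_pi_lt_pi.le).trans
    (integral_mono_Icc hf.abs hg hle)

/-- The mean of a solution vanishes for all times if it vanishes initially. -/
theorem IsGlobalC3Solution.integral_eq_zero {a₀ : ℝ → ℝ} {a : ℝ → ℝ → ℝ}
    (h : IsGlobalC3Solution a₀ a) (h0 : ∫ x in (-Real.pi)..Real.pi, a₀ x = 0) {T : ℝ}
    (hT : 0 ≤ T) : ∫ x in (-Real.pi)..Real.pi, a T x = 0 := by
  obtain ⟨at', ax, hat, hax, hdt, hdx, heq⟩ := h.exists_partials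
  have hac := h.contDiffOn.continuousOn
  obtain ⟨B, hB0, hB⟩ := exists_bound_slab hac T
  have hpi : Real.pi ∈ Icc (-Real.pi) Real.pi := ⟨neg_pi_lt_pi.le, le_rfl⟩
  refine integral_eq_zero_of_abs_deriv_le (C := B) hac hat hdt ?_ hT ?_
  · refine (intervalIntegral.integral_congr fun x hx => ?_).trans h0
    rw [uIcc_of_le neg_pi_lt_pi.le] at hx
    exact h.initial x hx
  · intro t ht
    have hat' := continuousOn_slice hac ht.1
    have haxt := continuousOn_slice hax ht.1
    set A : ℝ → ℝ := fun x => ∫ y in (-Real.pi)..x, a t y with hA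
    have hAd : ∀ x ∈ Icc (-Real.pi) Real.pi,
        HasDerivWithinAt A (a t x) (Icc (-Real.pi) Real.pi) x := fun x hx =>
      hasDerivWithinAt_primitive hat' hx
    have hAc : ContinuousOn A (Icc (-Real.pi) Real.pi) := fun x hx =>
      (hAd x hx).continuousWithinAt
    have hparts := integral_eq_sub_of_hasDerivWithinAt (f := fun x => A x * a t x)
      (f' := fun x => a t x * a t x + A x * ax t x)
      (fun x hx => (hAd x hx).mul (hdx t ht.1 x hx)) ((hat'.mul hat').add (hAc.mul haxt))
    rw [intervalIntegral.integral_add (f := fun x => a t x * a t x) (g := fun x => A x * ax t x)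
      (intervalIntegrable_of_Icc (hat'.mul hat'))
      (intervalIntegrable_of_Icc (hAc.mul haxt))] at hparts
    have hA0 : A (-Real.pi) = 0 := intervalIntegral.integral_same
    -- Integrating `A * a` by parts turns the transport term into a boundary value minus `∫ a²`. The
    -- constant `1/π` times the length `2π` contributes exactly `-2 ∫ a²`, so all squares cancel and
    -- the mean solves a linear homogeneous equation.
    have : ∫ x in (-Real.pi)..Real.pi, at' t x = -(a t Real.pi * A Real.pi) := by
      have h1 : ∫ x in (-Real.pi)..Real.pi, at' t x = ∫ x in (-Real.pi)..Real.pi,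
          (a t x * a t x - A x * ax t x - 1 / Real.pi * ∫ y in (-Real.pi)..Real.pi, a t y ^ 2) := by
        refine intervalIntegral.integral_congr fun x hx => ?_
        rw [uIcc_of_le neg_pi_lt_pi.le] at hx
        simp only [heq t ht.1 x hx]; ring
      rw [h1, intervalIntegral.integral_sub (f := fun x => a t x * a t x - A x * ax t x)
        (intervalIntegrable_of_Icc ((hat'.mul hat').sub (hAc.mul haxt))) (by simp),
        intervalIntegral.integral_sub (f := fun x => a t x * a t x) (g := fun x => A x * ax t x)
        (intervalIntegrable_of_Icc (hat'.mul hat'))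
        (intervalIntegrable_of_Icc (hAc.mul haxt)), intervalIntegral.integral_const]
      have h2 : ∫ y in (-Real.pi)..Real.pi, a t y ^ 2 = ∫ y in (-Real.pi)..Real.pi, a t y * a t y :=
        by simp only [sq]
      rw [h2, smul_eq_mul]
      have := Real.pi_pos
      simp only [hA0] at hparts
      field_simp
      linarith
    rw [this, abs_neg, abs_mul]
    exact mul_le_mul_of_nonneg_right (hB t ht _ hpi) (abs_nonneg _)

/-- Two mean-free solutions with the same initial datum agree. -/
theorem IsGlobalC3Solution.unique {a₀ : ℝ → ℝ} {a b : ℝ → ℝ → ℝ}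
    (ha : IsGlobalC3Solution a₀ a) (hb : IsGlobalC3Solution a₀ b)
    (h0 : ∫ x in (-Real.pi)..Real.pi, a₀ x = 0) {T : ℝ} (hT : 0 ≤ T) {x : ℝ}
    (hx : x ∈ Icc (-Real.pi) Real.pi) : b T x = a T x := by
  obtain ⟨at', ax, hat, hax, hadt, hadx, haeq⟩ := ha.exists_partials
  obtain ⟨bt', bx, hbt, hbx, hbdt, hbdx, hbeq⟩ := hb.exists_partials
  have hac := ha.contDiffOn.continuousOn
  have hbc := hb.contDiffOn.continuousOn
  obtain ⟨A, hA0, hA⟩ := exists_bound_slab hac T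
  obtain ⟨B, hB0, hB⟩ := exists_bound_slab hbc T
  obtain ⟨D, hD0, hD⟩ := exists_bound_slab hbx T
  have hle := neg_pi_lt_pi.le
  have key : ∫ x in (-Real.pi)..Real.pi, (a T x - b T x) ^ 2 = 0 := by
    refine integral_eq_zero_of_abs_deriv_le (φ := fun t x => (a t x - b t x) ^ 2)
      (φt := fun t x => 2 * (a t x - b t x) * (at' t x - bt' t x))
      (C := A + 2 * D * (2 * Real.pi) + 2 * (A + B))
      ((hac.sub hbc).pow 2) ((continuousOn_const.mul (hac.sub hbc)).mul (hat.sub hbt))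
      (fun t ht x hx => ?_) ?_ hT (fun t ht => ?_)
    · simpa using ((hadt t ht x hx).fun_sub (hbdt t ht x hx)).fun_pow 2
    · rw [intervalIntegral.integral_congr (g := fun _ => 0), intervalIntegral.integral_zero]
      intro x hx
      rw [uIcc_of_le hle] at hx
      simp [ha.initial x hx, hb.initial x hx]
    · have hat' := continuousOn_slice hac ht.1
      have haxt := continuousOn_slice hax ht.1
      have hbt' := continuousOn_slice hbc ht.1
      have hbxt := continuousOn_slice hbx ht.1
      set d : ℝ → ℝ := fun x => a t x - b t x with hd
      have hdc : ContinuousOn d (Icc (-Real.pi) Real.pi) := hat'.sub hbt'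
      set U : ℝ → ℝ := fun x => ∫ y in (-Real.pi)..x, a t y with hU
      set V : ℝ → ℝ := fun x => ∫ y in (-Real.pi)..x, b t y with hV
      have hUd : ∀ x ∈ Icc (-Real.pi) Real.pi,
          HasDerivWithinAt U (a t x) (Icc (-Real.pi) Real.pi) x := fun x hx =>
        hasDerivWithinAt_primitive hat' hx
      have hVd : ∀ x ∈ Icc (-Real.pi) Real.pi,
          HasDerivWithinAt V (b t x) (Icc (-Real.pi) Real.pi) x := fun x hx =>
        hasDerivWithinAt_primitive hbt' hx
      have hUc : ContinuousOn U (Icc (-Real.pi) Real.pi) := fun x hx =>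
        (hUd x hx).continuousWithinAt
      have hVc : ContinuousOn V (Icc (-Real.pi) Real.pi) := fun x hx =>
        (hVd x hx).continuousWithinAt
      have hU0 : U (-Real.pi) = 0 := intervalIntegral.integral_same
      have hU1 : U Real.pi = 0 := ha.integral_eq_zero h0 ht.1
      have hV1 : V Real.pi = 0 := hb.integral_eq_zero h0 ht.1
      set ca := 1 / Real.pi * ∫ y in (-Real.pi)..Real.pi, a t y ^ 2 with hca
      set cb := 1 / Real.pi * ∫ y in (-Real.pi)..Real.pi, b t y ^ 2 with hcb
      set E := ∫ x in (-Real.pi)..Real.pi, d x ^ 2 with hE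
      have hE0 : 0 ≤ E := intervalIntegral.integral_nonneg hle fun x _ => sq_nonneg _
      have hdint : ∫ x in (-Real.pi)..Real.pi, d x = 0 := by
        rw [hd, intervalIntegral.integral_sub (intervalIntegrable_of_Icc hat')
          (intervalIntegrable_of_Icc hbt')]
        simp only [hU, hV] at hU1 hV1
        rw [hU1, hV1, sub_zero]
      -- The transport of `d` by its own velocity is an exact derivative up to `a * d²`. The
      -- boundary terms vanish because `U` vanishes at both ends, by the zero mean; periodicity is
      -- not needed.
      have hparts := integral_eq_sub_of_hasDerivWithinAt (f := fun x => U x * d x ^ 2)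
        (f' := fun x => a t x * d x ^ 2 + U x * (2 * d x * (ax t x - bx t x)))
        (fun x hx => by
          simpa using (hUd x hx).fun_mul (((hadx t ht.1 x hx).fun_sub (hbdx t ht.1 x hx)).fun_pow 2))
        (by fun_prop)
      simp only [hU0, hU1, zero_mul, sub_zero] at hparts
      have hUV : ∀ x ∈ Icc (-Real.pi) Real.pi, |U x - V x| * |d x| ≤ E / 2 + Real.pi * d x ^ 2 := by
        intro x hx
        have hsub : U x - V x = ∫ y in (-Real.pi)..x, d y := by
          rw [hd, intervalIntegral.integral_sub]
          · exact (intervalIntegrable_of_Icc hat').mono_set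
              (by rw [uIcc_of_le hx.1, uIcc_of_le hle]; exact Icc_subset_Icc_right hx.2)
          · exact (intervalIntegrable_of_Icc hbt').mono_set
              (by rw [uIcc_of_le hx.1, uIcc_of_le hle]; exact Icc_subset_Icc_right hx.2)
        have h1 : |U x - V x| ≤ ∫ y in (-Real.pi)..Real.pi, |d y| := by
          rw [hsub]
          refine (intervalIntegral.abs_integral_le_integral_abs hx.1).trans ?_
          exact intervalIntegral.integral_mono_interval le_rfl hx.1 hx.2
            (Filter.Eventually.of_forall fun _ => abs_nonneg _) (intervalIntegrable_of_Icc hdc.abs)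
        calc |U x - V x| * |d x| ≤ (∫ y in (-Real.pi)..Real.pi, |d y|) * |d x| := by gcongr
          _ = ∫ y in (-Real.pi)..Real.pi, |d y| * |d x| := by
            rw [intervalIntegral.integral_mul_const]
          _ ≤ ∫ y in (-Real.pi)..Real.pi, (1 / 2 * d y ^ 2 + 1 / 2 * d x ^ 2) := by
            refine integral_mono_Icc (by fun_prop) (by fun_prop) fun y _ => ?_
            rw [← sq_abs (d y), ← sq_abs (d x)]
            nlinarith [sq_nonneg (|d y| - |d x|)]
          _ = E / 2 + Real.pi * d x ^ 2 := by
            rw [intervalIntegral.integral_add (intervalIntegrable_of_Icc (by fun_prop)) (by simp),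
              intervalIntegral.integral_const_mul, intervalIntegral.integral_const, smul_eq_mul]
            ring
      have hsplit : ∫ x in (-Real.pi)..Real.pi, 2 * (a t x - b t x) * (at' t x - bt' t x)
          = ∫ x in (-Real.pi)..Real.pi, (a t x * d x ^ 2 - 2 * ((U x - V x) * d x) * bx t x
            + 2 * (a t x + b t x) * d x ^ 2) := by
        -- The last two terms integrate to zero: the exact derivative from `hparts`, and the
        -- difference of the nonlocal constants paired with the mean-free `d`. Only terms bounded by
        -- the energy remain.
        have h1 : ∫ x in (-Real.pi)..Real.pi, 2 * (a t x - b t x) * (at' t x - bt' t x)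
            = ∫ x in (-Real.pi)..Real.pi, ((a t x * d x ^ 2 - 2 * ((U x - V x) * d x) * bx t x
              + 2 * (a t x + b t x) * d x ^ 2)
              - (a t x * d x ^ 2 + U x * (2 * d x * (ax t x - bx t x)))
              - 2 * (ca - cb) * d x) := by
          refine intervalIntegral.integral_congr fun x hx => ?_
          rw [uIcc_of_le hle] at hx
          simp only [haeq t ht.1 x hx, hbeq t ht.1 x hx, hd]
          ring
        rw [h1, intervalIntegral.integral_sub (intervalIntegrable_of_Icc (by fun_prop))
          (intervalIntegrable_of_Icc (by fun_prop)), intervalIntegral.integral_sub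
          (intervalIntegrable_of_Icc (by fun_prop)) (intervalIntegrable_of_Icc (by fun_prop)),
          hparts, intervalIntegral.integral_const_mul, hdint]
        ring
      rw [hsplit, abs_of_nonneg hE0]
      calc |∫ x in (-Real.pi)..Real.pi, (a t x * d x ^ 2 - 2 * ((U x - V x) * d x) * bx t x
            + 2 * (a t x + b t x) * d x ^ 2)|
          ≤ ∫ x in (-Real.pi)..Real.pi, ((A + 2 * D * Real.pi + 2 * (A + B)) * d x ^ 2
              + D * E) := by
            refine abs_integral_le_Icc (by fun_prop) (by fun_prop) fun x hx => ?_
            have e1 := hA t ht x hx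
            have e2 := hB t ht x hx
            have e3 := hD t ht x hx
            have e4 := hUV x hx
            have e5 : |a t x + b t x| ≤ A + B := (abs_add_le _ _).trans (add_le_add e1 e2)
            calc |a t x * d x ^ 2 - 2 * ((U x - V x) * d x) * bx t x
                + 2 * (a t x + b t x) * d x ^ 2|
                ≤ |a t x| * d x ^ 2 + 2 * (|U x - V x| * |d x|) * |bx t x|
                  + 2 * |a t x + b t x| * d x ^ 2 := by
                  refine (abs_add_le _ _).trans (add_le_add ((abs_sub _ _).trans ?_) ?_)
                  · simp [abs_mul]
                  · simp [abs_mul]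
              _ ≤ A * d x ^ 2 + 2 * (E / 2 + Real.pi * d x ^ 2) * D
                  + 2 * (A + B) * d x ^ 2 := by gcongr
              _ = _ := by ring
        _ = (A + 2 * D * (2 * Real.pi) + 2 * (A + B)) * E := by
            rw [intervalIntegral.integral_add (intervalIntegrable_of_Icc (by fun_prop)) (by simp),
              intervalIntegral.integral_const_mul, intervalIntegral.integral_const, smul_eq_mul]
            ring
  by_contra hne
  have hc : ContinuousOn (fun x => (a T x - b T x) ^ 2) (Icc (-Real.pi) Real.pi) :=
    ((continuousOn_slice hac hT).sub (continuousOn_slice hbc hT)).pow 2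
  have := intervalIntegral.integral_pos neg_pi_lt_pi hc (fun x _ => sq_nonneg _)
    ⟨x, hx, by
      have : a T x - b T x ≠ 0 := sub_ne_zero.2 (Ne.symm hne)
      positivity⟩
  exact this.ne' key

/-! ### Regularity of primitives depending on a parameter -/

section ParametricPrimitive

variable {I X : Set ℝ} {g g' : ℝ → ℝ → ℝ} {c : ℝ}

/-- Near a given point only a compact box inside `I ×ˢ X` matters. Clamping both variables to this
box makes the integrand globally continuous without changing the integral nearby. -/
theorem continuousOn_parametric_primitive (hI : IsOpen I) (hX : IsOpen X) (hoX : X.OrdConnected)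
    (hc : c ∈ X) (hg : ContinuousOn (fun p : ℝ × ℝ => g p.1 p.2) (I ×ˢ X)) :
    ContinuousOn (fun p : ℝ × ℝ => ∫ y in c..p.2, g p.1 y) (I ×ˢ X) := by
  rintro ⟨η, x⟩ ⟨hη, hx⟩
  refine ContinuousAt.continuousWithinAt ?_
  obtain ⟨r, hr, hrI⟩ := Metric.isOpen_iff.1 hI η hη
  obtain ⟨s, hs, hsX⟩ := Metric.isOpen_iff.1 hX x hx
  have hη1 : η - r / 2 ≤ η + r / 2 := by linarith
  have hx1 : min c (x - s / 2) ≤ max c (x + s / 2) := (min_le_left _ _).trans (le_max_left _ _)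
  have hsubI : Icc (η - r / 2) (η + r / 2) ⊆ I := fun z hz => hrI (by
    rw [Metric.mem_ball, Real.dist_eq, abs_lt]; constructor <;> linarith [hz.1, hz.2])
  have hxm : x - s / 2 ∈ X := hsX (by
    rw [Metric.mem_ball, Real.dist_eq, abs_lt]; constructor <;> linarith)
  have hxp : x + s / 2 ∈ X := hsX (by
    rw [Metric.mem_ball, Real.dist_eq, abs_lt]; constructor <;> linarith)
  have hsubX : Icc (min c (x - s / 2)) (max c (x + s / 2)) ⊆ X :=
    hoX.out (by rcases min_choice c (x - s / 2) with h | h <;> rw [h] <;> assumption)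
      (by rcases max_choice c (x + s / 2) with h | h <;> rw [h] <;> assumption)
  set G : ℝ → ℝ → ℝ := fun η y => g (projIcc _ _ hη1 η) (projIcc _ _ hx1 y) with hG
  have hGc : Continuous (Function.uncurry G) := by
    have h1 : Continuous fun p : ℝ × ℝ =>
        (((projIcc _ _ hη1 p.1 : ℝ), (projIcc _ _ hx1 p.2 : ℝ)) : ℝ × ℝ) := by
      have e1 : Continuous (projIcc _ _ hη1) := continuous_projIcc
      have e2 : Continuous (projIcc _ _ hx1) := continuous_projIcc
      fun_prop
    exact hg.comp_continuous h1 fun p => ⟨hsubI (Subtype.prop _), hsubX (Subtype.prop _)⟩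
  have hint := intervalIntegral.continuous_parametric_intervalIntegral_of_continuous
    (μ := MeasureTheory.volume) (a₀ := c) (f := fun (p : ℝ × ℝ) y => G p.1 y)
    (s := fun p : ℝ × ℝ => p.2)
    (hGc.comp (by fun_prop : Continuous fun q : (ℝ × ℝ) × ℝ => (q.1.1, q.2))) continuous_snd
  refine (hint.continuousAt (x := (η, x))).congr ?_
  have hnhds : Icc (η - r / 2) (η + r / 2) ×ˢ Icc (x - s / 2) (x + s / 2) ∈ nhds (η, x) :=
    prod_mem_nhds (Icc_mem_nhds (by linarith) (by linarith))
      (Icc_mem_nhds (by linarith) (by linarith))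
  filter_upwards [hnhds] with p hp
  refine intervalIntegral.integral_congr fun y hy => ?_
  have hy' : y ∈ Icc (min c (x - s / 2)) (max c (x + s / 2)) :=
    ⟨(le_min (min_le_left _ _) ((min_le_right _ _).trans hp.2.1)).trans hy.1,
      hy.2.trans (max_le (le_max_left _ _) (hp.2.2.trans (le_max_right _ _)))⟩
  simp only [hG, projIcc_of_mem _ hp.1, projIcc_of_mem _ hy']

theorem hasDerivAt_parametric_primitive (hI : IsOpen I) (hoX : X.OrdConnected)
    (hc : c ∈ X) (hg : ContinuousOn (fun p : ℝ × ℝ => g p.1 p.2) (I ×ˢ X))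
    (hg' : ContinuousOn (fun p : ℝ × ℝ => g' p.1 p.2) (I ×ˢ X))
    (hd : ∀ η ∈ I, ∀ y ∈ X, HasDerivAt (fun η => g η y) (g' η y) η) {η x : ℝ}
    (hη : η ∈ I) (hx : x ∈ X) :
    HasDerivAt (fun η => ∫ y in c..x, g η y) (∫ y in c..x, g' η y) η := by
  obtain ⟨r, hr, hrI⟩ := Metric.isOpen_iff.1 hI η hη
  have hsubI : Metric.closedBall η (r / 2) ⊆ I :=
    (Metric.closedBall_subset_ball (by linarith)).trans hrI
  have hsubX : uIcc c x ⊆ X := hoX.uIcc_subset hc hx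
  obtain ⟨B, hB⟩ := ((isCompact_closedBall η (r / 2)).prod
    (isCompact_uIcc (a := c) (b := x))).exists_bound_of_continuousOn
    (hg'.mono (prod_mono hsubI hsubX))
  have hslice : ∀ {h : ℝ → ℝ → ℝ}, ContinuousOn (fun p : ℝ × ℝ => h p.1 p.2) (I ×ˢ X) →
      ∀ z ∈ I, ContinuousOn (h z) (uIcc c x) := fun hh z hz =>
    hh.comp (f := fun y : ℝ => (z, y)) (by fun_prop) fun y hy => ⟨hz, hsubX hy⟩
  have hmeas : ∀ {f : ℝ → ℝ}, ContinuousOn f (uIcc c x) →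
      MeasureTheory.AEStronglyMeasurable f (MeasureTheory.volume.restrict (uIoc c x)) := fun h =>
    (h.mono uIoc_subset_uIcc).aestronglyMeasurable measurableSet_uIoc
  refine (intervalIntegral.hasDerivAt_integral_of_dominated_loc_of_deriv_le
    (s := Metric.ball η (r / 2)) (bound := fun _ => B) (F := g) (F' := g')
    (Metric.ball_mem_nhds _ (half_pos hr)) ?_ (hslice hg η hη).intervalIntegrable
    (hmeas (hslice hg' η hη)) ?_ (by simp) ?_).2
  · filter_upwards [hI.mem_nhds hη] with z hz using hmeas (hslice hg z hz)
  · exact Filter.Eventually.of_forall fun y hy z hz =>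
      hB (z, y) ⟨Metric.ball_subset_closedBall hz, uIoc_subset_uIcc hy⟩
  · exact Filter.Eventually.of_forall fun y hy z hz =>
      hd z (hsubI (Metric.ball_subset_closedBall hz)) y (hsubX (uIoc_subset_uIcc hy))

end ParametricPrimitive

/-! ### The explicit solution in Lagrangian variables -/

/-- The weight `f ^ n / (1 - η f) ^ (n + 1)`. -/
noncomputable def weight (f : ℝ → ℝ) (n : ℕ) (η x : ℝ) : ℝ := f x ^ n / (1 - η * f x) ^ (n + 1)

/-- The primitive of `weight f n η` vanishing at `-π`. -/
noncomputable def weightPrim (f : ℝ → ℝ) (n : ℕ) (η x : ℝ) : ℝ :=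
  ∫ y in (-Real.pi)..x, weight f n η y

/-- The mean over `[-π, π]` of `weight f n η`. -/
noncomputable def weightMean (f : ℝ → ℝ) (n : ℕ) (η : ℝ) : ℝ :=
  weightPrim f n η Real.pi / (2 * Real.pi)

/-- The Lagrangian flow map, in the time variable `η`. -/
noncomputable def flow (f : ℝ → ℝ) (η x : ℝ) : ℝ :=
  -Real.pi + weightPrim f 0 η x / weightMean f 0 η

/-- The solution along the flow. -/
noncomputable def lagr (f : ℝ → ℝ) (η x : ℝ) : ℝ :=
  f x / (1 - η * f x) / weightMean f 0 η ^ 2 - weightMean f 1 η / weightMean f 0 η ^ 3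

/-- The physical time as a function of `η`. -/
noncomputable def clock (f : ℝ → ℝ) (η : ℝ) : ℝ := ∫ s in (0 : ℝ)..η, weightMean f 0 s ^ 2

/-- `I` and `X` are open intervals on which `1 - η f` is positive. -/
structure Admissible (f : ℝ → ℝ) (I X : Set ℝ) : Prop where
  contDiff : ContDiff ℝ 3 f
  isOpen_left : IsOpen I
  isOpen_right : IsOpen X
  ordConnected_left : I.OrdConnected
  ordConnected_right : X.OrdConnected
  zero_mem : 0 ∈ I
  neg_pi_mem : -Real.pi ∈ X
  pi_mem : Real.pi ∈ X
  pos : ∀ η ∈ I, ∀ x ∈ X, 0 < 1 - η * f x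

namespace Admissible

variable {f : ℝ → ℝ} {I X : Set ℝ}

theorem Icc_subset (h : Admissible f I X) : Icc (-Real.pi) Real.pi ⊆ X :=
  h.ordConnected_right.out h.neg_pi_mem h.pi_mem

theorem isOpen_prod (h : Admissible f I X) : IsOpen (I ×ˢ X) :=
  h.isOpen_left.prod h.isOpen_right

theorem contDiffOn_weight (h : Admissible f I X) (n : ℕ) :
    ContDiffOn ℝ 3 (fun p : ℝ × ℝ => weight f n p.1 p.2) (I ×ˢ X) := by
  have hf : ContDiff ℝ 3 fun p : ℝ × ℝ => f p.2 := h.contDiff.comp contDiff_snd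
  refine ContDiffOn.div (hf.pow n).contDiffOn ?_ ?_
  · exact ((contDiff_const.sub (contDiff_fst.mul hf)).pow (n + 1)).contDiffOn
  · intro p hp
    exact pow_ne_zero _ (h.pos _ hp.1 _ hp.2).ne'

theorem continuousOn_weight (h : Admissible f I X) (n : ℕ) {η : ℝ} (hη : η ∈ I) :
    ContinuousOn (weight f n η) X :=
  (h.contDiffOn_weight n).continuousOn.comp (f := fun y : ℝ => (η, y)) (by fun_prop)
    fun _ hy => ⟨hη, hy⟩

/-- The exponents are chosen so that the family of weights is closed under differentiation in `η`;
this drives both the regularity bootstrap and the algebra of the equation. -/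
theorem hasDerivAt_weight (h : Admissible f I X) (n : ℕ) {η x : ℝ} (hη : η ∈ I) (hx : x ∈ X) :
    HasDerivAt (fun η => weight f n η x) ((n + 1) * weight f (n + 1) η x) η := by
  have hp := (h.pos η hη x hx).ne'
  have h1 : HasDerivAt (fun η : ℝ => 1 - η * f x) (-f x) η := by
    simpa using ((hasDerivAt_id η).mul_const (f x)).const_sub 1
  have h2 := (h1.fun_pow (n + 1)).inv (pow_ne_zero (n + 1) hp)
  have h3 := h2.const_mul (f x ^ n)
  refine h3.congr_deriv ?_
  simp only [weight, Nat.add_sub_cancel]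
  push_cast
  field_simp
  ring

theorem hasDerivAt_weightPrim_left (h : Admissible f I X) (n : ℕ) {η x : ℝ} (hη : η ∈ I)
    (hx : x ∈ X) :
    HasDerivAt (fun η => weightPrim f n η x) ((n + 1) * weightPrim f (n + 1) η x) η := by
  have := hasDerivAt_parametric_primitive (g := weight f n)
    (g' := fun η x => (n + 1) * weight f (n + 1) η x) h.isOpen_left h.ordConnected_right
    h.neg_pi_mem (h.contDiffOn_weight n).continuousOn
    (continuousOn_const.mul (h.contDiffOn_weight (n + 1)).continuousOn)
    (fun η hη x hx => h.hasDerivAt_weight n hη hx) hη hx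
  simpa only [weightPrim, intervalIntegral.integral_const_mul] using this

theorem hasDerivAt_weightPrim_right (h : Admissible f I X) (n : ℕ) {η x : ℝ} (hη : η ∈ I)
    (hx : x ∈ X) : HasDerivAt (weightPrim f n η) (weight f n η x) x := by
  have hc := h.continuousOn_weight n hη
  exact intervalIntegral.integral_hasDerivAt_right
    (hc.mono (h.ordConnected_right.uIcc_subset h.neg_pi_mem hx)).intervalIntegrable
    (hc.stronglyMeasurableAtFilter h.isOpen_right x hx)
    (hc.continuousAt (h.isOpen_right.mem_nhds hx))

theorem continuousOn_weightPrim (h : Admissible f I X) (n : ℕ) :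
    ContinuousOn (fun p : ℝ × ℝ => weightPrim f n p.1 p.2) (I ×ˢ X) :=
  continuousOn_parametric_primitive h.isOpen_left h.isOpen_right h.ordConnected_right
    h.neg_pi_mem (h.contDiffOn_weight n).continuousOn

theorem hasFDerivAt_weightPrim (h : Admissible f I X) (n : ℕ) {p : ℝ × ℝ} (hp : p ∈ I ×ˢ X) :
    HasFDerivAt (fun p : ℝ × ℝ => weightPrim f n p.1 p.2)
      (((n + 1) * weightPrim f (n + 1) p.1 p.2) • ContinuousLinearMap.fst ℝ ℝ ℝ
        + weight f n p.1 p.2 • ContinuousLinearMap.snd ℝ ℝ ℝ) p := by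
  have hmem : ∀ᶠ v in nhds p, v ∈ I ×ˢ X := h.isOpen_prod.mem_nhds hp
  have key := hasStrictFDerivAt_uncurry_coprod (𝕜 := ℝ) (u := p) (f := weightPrim f n)
    (f₁ := fun η x => ContinuousLinearMap.toSpanSingleton ℝ ((n + 1) * weightPrim f (n + 1) η x))
    (f₂ := fun η x => ContinuousLinearMap.toSpanSingleton ℝ (weight f n η x))
    (hmem.mono fun v hv => (h.hasDerivAt_weightPrim_left n hv.1 hv.2).hasFDerivAt)
    (hmem.mono fun v hv => (h.hasDerivAt_weightPrim_right n hv.1 hv.2).hasFDerivAt) ?_ ?_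
  · refine key.hasFDerivAt.congr_fderiv ?_
    ext <;> simp [Function.HasUncurry.uncurry]
  · have h1 : ContinuousAt (fun p : ℝ × ℝ => (n + 1) * weightPrim f (n + 1) p.1 p.2) p :=
      continuousAt_const.mul ((h.continuousOn_weightPrim (n + 1)).continuousAt
        (h.isOpen_prod.mem_nhds hp))
    exact (ContinuousLinearMap.toSpanSingletonCLE (𝕜 := ℝ) (E := ℝ)).continuous.continuousAt.comp h1
  · have h1 : ContinuousAt (fun p : ℝ × ℝ => weight f n p.1 p.2) p :=
      (h.contDiffOn_weight n).continuousOn.continuousAt (h.isOpen_prod.mem_nhds hp)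
    exact (ContinuousLinearMap.toSpanSingletonCLE (𝕜 := ℝ) (E := ℝ)).continuous.continuousAt.comp h1

/-- The partial derivatives of a primitive are a multiple of the next primitive and a weight, so the
induction on smoothness has to run over all `n` at once. -/
theorem contDiffOn_weightPrim_aux (h : Admissible f I X) (m : ℕ) (hm : m ≤ 3) :
    ∀ n, ContDiffOn ℝ m (fun p : ℝ × ℝ => weightPrim f n p.1 p.2) (I ×ˢ X) := by
  induction m with
  | zero => exact fun n => contDiffOn_zero.2 (h.continuousOn_weightPrim n)
  | succ m ih =>
    intro n
    have ih' := ih (by omega)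
    push_cast
    rw [contDiffOn_succ_iff_fderiv_of_isOpen h.isOpen_prod]
    refine ⟨fun p hp => (h.hasFDerivAt_weightPrim n hp).differentiableAt.differentiableWithinAt,
      by simp, ?_⟩
    refine ContDiffOn.congr ?_ fun p hp => (h.hasFDerivAt_weightPrim n hp).fderiv
    refine ((contDiffOn_const.mul (ih' (n + 1))).smul contDiffOn_const).add
      (((h.contDiffOn_weight n).of_le ?_).smul contDiffOn_const)
    exact_mod_cast (by omega : m ≤ 3)

theorem contDiffOn_weightPrim (h : Admissible f I X) (n : ℕ) :
    ContDiffOn ℝ 3 (fun p : ℝ × ℝ => weightPrim f n p.1 p.2) (I ×ˢ X) := by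
  exact_mod_cast h.contDiffOn_weightPrim_aux 3 le_rfl n

theorem contDiffOn_weightMean (h : Admissible f I X) (n : ℕ) :
    ContDiffOn ℝ 3 (weightMean f n) I :=
  ((h.contDiffOn_weightPrim n).comp (f := fun η : ℝ => (η, Real.pi))
    (contDiff_id.prodMk contDiff_const).contDiffOn fun _ hη => ⟨hη, h.pi_mem⟩).div_const _

theorem hasDerivAt_weightMean (h : Admissible f I X) (n : ℕ) {η : ℝ} (hη : η ∈ I) :
    HasDerivAt (weightMean f n) ((n + 1) * weightMean f (n + 1) η) η := by
  refine ((h.hasDerivAt_weightPrim_left n hη h.pi_mem).div_const _).congr_deriv ?_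
  simp only [weightMean]; ring

theorem weightMean_pos (h : Admissible f I X) {η : ℝ} (hη : η ∈ I) : 0 < weightMean f 0 η := by
  refine div_pos ?_ (by positivity)
  refine intervalIntegral.intervalIntegral_pos_of_pos_on (intervalIntegrable_of_Icc
    ((h.continuousOn_weight 0 hη).mono h.Icc_subset)) (fun x hx => ?_) neg_pi_lt_pi
  have := h.pos η hη x (h.Icc_subset (Ioo_subset_Icc_self hx))
  simp only [weight]; positivity

theorem hasDerivAt_clock (h : Admissible f I X) {η : ℝ} (hη : η ∈ I) :
    HasDerivAt (clock f) (weightMean f 0 η ^ 2) η := by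
  have hc : ContinuousOn (fun s => weightMean f 0 s ^ 2) I :=
    (h.contDiffOn_weightMean 0).continuousOn.pow 2
  exact intervalIntegral.integral_hasDerivAt_right
    (hc.mono (h.ordConnected_left.uIcc_subset h.zero_mem hη)).intervalIntegrable
    (hc.stronglyMeasurableAtFilter h.isOpen_left η hη)
    (hc.continuousAt (h.isOpen_left.mem_nhds hη))

theorem contDiffOn_clock (h : Admissible f I X) : ContDiffOn ℝ 3 (clock f) I := by
  have : ContDiffOn ℝ (2 + 1) (clock f) I := by
    rw [contDiffOn_succ_iff_deriv_of_isOpen h.isOpen_left]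
    refine ⟨fun η hη => (h.hasDerivAt_clock hη).differentiableAt.differentiableWithinAt,
      by simp, ?_⟩
    refine ContDiffOn.congr ?_ fun η hη => (h.hasDerivAt_clock hη).deriv
    exact ((h.contDiffOn_weightMean 0).of_le (by norm_num)).pow 2
  exact this.of_le (by norm_num)

theorem strictMonoOn_clock (h : Admissible f I X) : StrictMonoOn (clock f) I := by
  refine strictMonoOn_of_deriv_pos (h.ordConnected_left.convex)
    h.contDiffOn_clock.continuousOn fun η hη => ?_
  rw [h.isOpen_left.interior_eq] at hη
  rw [(h.hasDerivAt_clock hη).deriv]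
  have := h.weightMean_pos hη
  positivity

theorem contDiffOn_flow (h : Admissible f I X) :
    ContDiffOn ℝ 3 (fun p : ℝ × ℝ => flow f p.1 p.2) (I ×ˢ X) := by
  refine contDiffOn_const.add ((h.contDiffOn_weightPrim 0).div
    ((h.contDiffOn_weightMean 0).comp contDiff_fst.contDiffOn fun p hp => hp.1)
    fun p hp => (h.weightMean_pos hp.1).ne')

theorem contDiffOn_lagr (h : Admissible f I X) :
    ContDiffOn ℝ 3 (fun p : ℝ × ℝ => lagr f p.1 p.2) (I ×ˢ X) := by
  have hf : ContDiff ℝ 3 fun p : ℝ × ℝ => f p.2 := h.contDiff.comp contDiff_snd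
  have hK : ∀ n, ContDiffOn ℝ 3 (fun p : ℝ × ℝ => weightMean f n p.1) (I ×ˢ X) := fun n =>
    (h.contDiffOn_weightMean n).comp contDiff_fst.contDiffOn fun p hp => hp.1
  have hne : ∀ p ∈ I ×ˢ X, weightMean f 0 p.1 ≠ 0 := fun p hp => (h.weightMean_pos hp.1).ne'
  refine ((hf.contDiffOn.div (contDiff_const.sub (contDiff_fst.mul hf)).contDiffOn
    fun p hp => (h.pos _ hp.1 _ hp.2).ne').div ((hK 0).pow 2) fun p hp =>
      pow_ne_zero _ (hne p hp)).sub ((hK 1).div ((hK 0).pow 3) fun p hp => pow_ne_zero _ (hne p hp))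

theorem hasDerivAt_flow_right (h : Admissible f I X) {η x : ℝ} (hη : η ∈ I) (hx : x ∈ X) :
    HasDerivAt (flow f η) (1 / (1 - η * f x) / weightMean f 0 η) x := by
  refine (((h.hasDerivAt_weightPrim_right 0 hη hx).div_const _).const_add _).congr_deriv ?_
  simp [weight]

theorem hasDerivAt_flow_left (h : Admissible f I X) {η x : ℝ} (hη : η ∈ I) (hx : x ∈ X) :
    HasDerivAt (fun η => flow f η x) (weightPrim f 1 η x / weightMean f 0 η
      - weightPrim f 0 η x * weightMean f 1 η / weightMean f 0 η ^ 2) η := by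
  have hK := (h.weightMean_pos hη).ne'
  refine (((h.hasDerivAt_weightPrim_left 0 hη hx).fun_div (h.hasDerivAt_weightMean 0 hη)
    hK).const_add _).congr_deriv ?_
  simp only [Nat.cast_zero, zero_add, one_mul]
  field_simp

theorem strictMonoOn_flow (h : Admissible f I X) {η : ℝ} (hη : η ∈ I) :
    StrictMonoOn (flow f η) X := by
  refine strictMonoOn_of_deriv_pos h.ordConnected_right.convex
    (fun x hx => (h.hasDerivAt_flow_right hη hx).continuousAt.continuousWithinAt) fun x hx => ?_
  rw [h.isOpen_right.interior_eq] at hx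
  rw [(h.hasDerivAt_flow_right hη hx).deriv]
  have := h.weightMean_pos hη
  have := h.pos η hη x hx
  positivity

theorem flow_neg_pi (f : ℝ → ℝ) (η : ℝ) : flow f η (-Real.pi) = -Real.pi := by
  simp [flow, weightPrim]

theorem flow_pi (h : Admissible f I X) {η : ℝ} (hη : η ∈ I) : flow f η Real.pi = Real.pi := by
  have hK := (h.weightMean_pos hη).ne'
  have : weightPrim f 0 η Real.pi = 2 * Real.pi * weightMean f 0 η := by
    rw [weightMean]; field_simp
  rw [flow, this]; field_simp; ring

theorem flow_mem (h : Admissible f I X) {η x : ℝ} (hη : η ∈ I)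
    (hx : x ∈ Icc (-Real.pi) Real.pi) : flow f η x ∈ Icc (-Real.pi) Real.pi := by
  have hm := (h.strictMonoOn_flow hη).monotoneOn
  constructor
  · rw [← flow_neg_pi f η]; exact hm h.neg_pi_mem (h.Icc_subset hx) hx.1
  · rw [← h.flow_pi hη]; exact hm (h.Icc_subset hx) h.pi_mem hx.2

theorem exists_flow_eq (h : Admissible f I X) {η y : ℝ} (hη : η ∈ I)
    (hy : y ∈ Icc (-Real.pi) Real.pi) : ∃ x ∈ Icc (-Real.pi) Real.pi, flow f η x = y := by
  have hc : ContinuousOn (flow f η) (Icc (-Real.pi) Real.pi) := fun x hx =>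
    (h.hasDerivAt_flow_right hη (h.Icc_subset hx)).continuousAt.continuousWithinAt
  have := intermediate_value_Icc neg_pi_lt_pi.le hc
  rw [flow_neg_pi, h.flow_pi hη] at this
  exact this hy

theorem hasDerivAt_lagr_right (h : Admissible f I X) {η x : ℝ} (hη : η ∈ I) (hx : x ∈ X) :
    HasDerivAt (lagr f η) (deriv f x / (1 - η * f x) ^ 2 / weightMean f 0 η ^ 2) x := by
  have hf : HasDerivAt f (deriv f x) x :=
    (h.contDiff.differentiable (by norm_num) x).hasDerivAt
  have hp := (h.pos η hη x hx).ne'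
  refine (((hf.fun_div ((hf.const_mul η).const_sub 1) hp).div_const _).sub_const _).congr_deriv ?_
  congr 2; ring

theorem hasDerivAt_lagr_left (h : Admissible f I X) {η x : ℝ} (hη : η ∈ I) (hx : x ∈ X) :
    HasDerivAt (fun η => lagr f η x) (f x ^ 2 / (1 - η * f x) ^ 2 / weightMean f 0 η ^ 2
      - 2 * (f x / (1 - η * f x)) * weightMean f 1 η / weightMean f 0 η ^ 3
      - 2 * weightMean f 2 η / weightMean f 0 η ^ 3
      + 3 * weightMean f 1 η ^ 2 / weightMean f 0 η ^ 4) η := by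
  have hp := (h.pos η hη x hx).ne'
  have hK := (h.weightMean_pos hη).ne'
  have h0 := h.hasDerivAt_weightMean 0 hη
  have h1 := h.hasDerivAt_weightMean 1 hη
  have h2 : HasDerivAt (fun η : ℝ => 1 - η * f x) (-f x) η := by
    simpa using ((hasDerivAt_id η).mul_const (f x)).const_sub 1
  refine ((((hasDerivAt_const η (f x)).fun_div h2 hp).fun_div (h0.fun_pow 2)
    (pow_ne_zero 2 hK)).fun_sub (h1.fun_div (h0.fun_pow 3) (pow_ne_zero 3 hK))).congr_deriv ?_
  push_cast
  norm_num
  field_simp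
  ring

end Admissible

/-! ### Passage to Eulerian variables -/

/-- The space-time Lagrangian change of variables `(η, x) ↦ (t, y)`. -/
noncomputable def flowMap (f : ℝ → ℝ) (p : ℝ × ℝ) : ℝ × ℝ := (clock f p.1, flow f p.1 p.2)

/-- The inverse of `flowMap` on `I ×ˢ X`. -/
noncomputable def flowInv (f : ℝ → ℝ) (I X : Set ℝ) : ℝ × ℝ → ℝ × ℝ :=
  Function.invFunOn (flowMap f) (I ×ˢ X)

/-- The solution in Eulerian variables. -/
noncomputable def sol (f : ℝ → ℝ) (I X : Set ℝ) (t y : ℝ) : ℝ :=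
  lagr f (flowInv f I X (t, y)).1 (flowInv f I X (t, y)).2

namespace Admissible

variable {f : ℝ → ℝ} {I X : Set ℝ}

theorem contDiffOn_flowMap (h : Admissible f I X) : ContDiffOn ℝ 3 (flowMap f) (I ×ˢ X) :=
  (h.contDiffOn_clock.comp contDiff_fst.contDiffOn fun _ hp => hp.1).prodMk h.contDiffOn_flow

theorem injOn_flowMap (h : Admissible f I X) : InjOn (flowMap f) (I ×ˢ X) := by
  rintro ⟨η, x⟩ hp ⟨η', x'⟩ hp' he
  simp only [flowMap, Prod.mk.injEq] at he
  obtain rfl : η = η' := h.strictMonoOn_clock.injOn hp.1 hp'.1 he.1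
  obtain rfl : x = x' := (h.strictMonoOn_flow hp.1).injOn hp.2 hp'.2 he.2
  rfl

theorem flowInv_flowMap (h : Admissible f I X) {p : ℝ × ℝ} (hp : p ∈ I ×ˢ X) :
    flowInv f I X (flowMap f p) = p :=
  h.injOn_flowMap.leftInvOn_invFunOn hp

theorem sol_flow (h : Admissible f I X) {η x : ℝ} (hη : η ∈ I) (hx : x ∈ X) :
    sol f I X (clock f η) (flow f η x) = lagr f η x := by
  have := h.flowInv_flowMap (p := (η, x)) ⟨hη, hx⟩
  simp only [flowMap] at this
  simp only [sol, this]

/-- The Jacobian is triangular, since the clock does not depend on `x`, and its diagonal entries are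
positive. The inverse function theorem gives a smooth local inverse, which global injectivity
identifies with `flowInv`. -/
theorem contDiffAt_flowInv (h : Admissible f I X) {p : ℝ × ℝ} (hp : p ∈ I ×ˢ X) :
    ContDiffAt ℝ 3 (flowInv f I X) (flowMap f p) := by
  obtain ⟨η, x⟩ := p
  have hK := h.weightMean_pos hp.1
  have hq := h.pos η hp.1 x hp.2
  have hcd : ContDiffAt ℝ 3 (flowMap f) (η, x) :=
    h.contDiffOn_flowMap.contDiffAt (h.isOpen_prod.mem_nhds hp)
  set α := weightMean f 0 η ^ 2 with hα
  set δ := 1 / (1 - η * f x) / weightMean f 0 η with hδ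
  have hα0 : α ≠ 0 := by positivity
  have hδ0 : δ ≠ 0 := by positivity
  have hfd := (hcd.differentiableAt (by norm_num)).hasFDerivAt
  set L := fderiv ℝ (flowMap f) (η, x) with hL
  have hline1 : HasDerivAt (fun s : ℝ => (s, x)) ((1 : ℝ), (0 : ℝ)) η :=
    (hasDerivAt_id η).prodMk (hasDerivAt_const η x)
  have hline2 : HasDerivAt (fun s : ℝ => (η, s)) ((0 : ℝ), (1 : ℝ)) x :=
    (hasDerivAt_const x η).prodMk (hasDerivAt_id x)
  have hL1 : L (1, 0) = (α, (L (1, 0)).2) := by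
    refine Prod.ext ?_ rfl
    have e1 := (hasFDerivAt_fst.comp (η, x) hfd).comp_hasDerivAt η hline1
    exact e1.unique (h.hasDerivAt_clock hp.1)
  have hL2 : L (0, 1) = (0, δ) := by
    have e1 := hfd.comp_hasDerivAt x hline2
    exact e1.unique ((hasDerivAt_const x (clock f η)).prodMk
      (h.hasDerivAt_flow_right hp.1 hp.2))
  let e : (ℝ × ℝ) ≃L[ℝ] (ℝ × ℝ) :=
    (ContinuousLinearEquiv.unitsEquivAut ℝ (Units.mk0 α hα0)).skewProd
      (ContinuousLinearEquiv.unitsEquivAut ℝ (Units.mk0 δ hδ0))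
      (ContinuousLinearMap.toSpanSingleton ℝ (L (1, 0)).2)
  have he : L = (e : (ℝ × ℝ) →L[ℝ] (ℝ × ℝ)) := by
    refine ContinuousLinearMap.prod_ext ?_ ?_
    · ext1
      simp only [ContinuousLinearMap.comp_apply, ContinuousLinearMap.inl_apply]
      rw [hL1]
      simp [e]
    · ext1
      simp only [ContinuousLinearMap.comp_apply, ContinuousLinearMap.inr_apply]
      rw [hL2]
      simp [e]
  rw [he] at hfd
  have hinv := hcd.to_localInverse hfd (by norm_num)
  refine hinv.congr_of_eventuallyEq ?_
  have hstrict := hcd.hasStrictFDerivAt' hfd (by norm_num)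
  have h1 := hstrict.eventually_right_inverse
  have h2 := hinv.continuousAt
  have h3 : ∀ᶠ q in nhds (flowMap f (η, x)),
      hcd.localInverse hfd (by norm_num) q ∈ I ×ˢ X := by
    refine h2.eventually ?_
    rw [hcd.localInverse_apply_image hfd]
    exact h.isOpen_prod.mem_nhds hp
  filter_upwards [h1, h3] with q hq1 hq3
  have := h.flowInv_flowMap hq3
  rw [← this]
  exact congrArg _ hq1.symm

theorem contDiffAt_sol (h : Admissible f I X) {η x : ℝ} (hη : η ∈ I) (hx : x ∈ X) :
    ContDiffAt ℝ 3 (fun p : ℝ × ℝ => sol f I X p.1 p.2) (clock f η, flow f η x) := by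
  have h1 := h.contDiffAt_flowInv (p := (η, x)) ⟨hη, hx⟩
  refine ContDiffAt.comp (g := fun p : ℝ × ℝ => lagr f p.1 p.2) (f := flowInv f I X)
    (clock f η, flow f η x) ?_ h1
  have : flowInv f I X (clock f η, flow f η x) = (η, x) :=
    h.flowInv_flowMap (p := (η, x)) ⟨hη, hx⟩
  rw [this]
  exact h.contDiffOn_lagr.contDiffAt (h.isOpen_prod.mem_nhds ⟨hη, hx⟩)

/-- The partial derivatives of the solution at a point of the flow. -/
theorem hasDerivAt_sol (h : Admissible f I X) {η x : ℝ} (hη : η ∈ I) (hx : x ∈ X) :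
    ∃ st sx : ℝ, HasDerivAt (fun t => sol f I X t (flow f η x)) st (clock f η) ∧
      HasDerivAt (sol f I X (clock f η)) sx (flow f η x) ∧
      HasDerivAt (lagr f η) (sx * (1 / (1 - η * f x) / weightMean f 0 η)) x ∧
      HasDerivAt (fun η => lagr f η x) (st * weightMean f 0 η ^ 2
        + sx * (weightPrim f 1 η x / weightMean f 0 η
          - weightPrim f 0 η x * weightMean f 1 η / weightMean f 0 η ^ 2)) η := by
  have hfd := ((h.contDiffAt_sol hη hx).differentiableAt (by norm_num)).hasFDerivAt
  set L := fderiv ℝ (fun p : ℝ × ℝ => sol f I X p.1 p.2) (clock f η, flow f η x) with hL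
  have hLuv : ∀ u v : ℝ, L (u, v) = L (1, 0) * u + L (0, 1) * v := by
    intro u v
    have : ((u, v) : ℝ × ℝ) = u • (1, 0) + v • (0, 1) := by simp
    rw [this, map_add, map_smul, map_smul, smul_eq_mul, smul_eq_mul]; ring
  refine ⟨L (1, 0), L (0, 1), ?_, ?_, ?_, ?_⟩
  · exact hfd.comp_hasDerivAt (f := fun t : ℝ => (t, flow f η x)) (clock f η)
      ((hasDerivAt_id _).prodMk (hasDerivAt_const _ _))
  · exact hfd.comp_hasDerivAt (f := fun y : ℝ => (clock f η, y)) (flow f η x)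
      ((hasDerivAt_const _ _).prodMk (hasDerivAt_id _))
  · have := hfd.comp_hasDerivAt x ((hasDerivAt_const x (clock f η)).prodMk
      (h.hasDerivAt_flow_right hη hx))
    rw [hLuv, mul_zero, zero_add] at this
    refine this.congr_of_eventuallyEq ?_
    filter_upwards [h.isOpen_right.mem_nhds hx] with z hz using (h.sol_flow hη hz).symm
  · have := HasFDerivAt.comp_hasDerivAt (f := fun η => (clock f η, flow f η x)) η hfd
      ((h.hasDerivAt_clock hη).prodMk (h.hasDerivAt_flow_left hη hx))
    rw [hLuv] at this
    refine this.congr_of_eventuallyEq ?_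
    filter_upwards [h.isOpen_left.mem_nhds hη] with z hz using (h.sol_flow hz hx).symm

theorem hasDerivAt_sol_right (h : Admissible f I X) {η x : ℝ} (hη : η ∈ I) (hx : x ∈ X) :
    HasDerivAt (sol f I X (clock f η)) (deriv f x / (1 - η * f x) / weightMean f 0 η)
      (flow f η x) := by
  obtain ⟨st, sx, -, h2, h3, -⟩ := h.hasDerivAt_sol hη hx
  have hK := (h.weightMean_pos hη).ne'
  have hp := (h.pos η hη x hx).ne'
  have := h3.unique (h.hasDerivAt_lagr_right hη hx)
  refine h2.congr_deriv ?_
  field_simp at this ⊢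
  linarith

theorem integral_comp_sol (h : Admissible f I X) {η x : ℝ} (hη : η ∈ I)
    (hx : x ∈ Icc (-Real.pi) Real.pi) {G : ℝ → ℝ} (hG : Continuous G) :
    ∫ y in (-Real.pi)..(flow f η x), G (sol f I X (clock f η) y)
      = ∫ z in (-Real.pi)..x, G (lagr f η z) * (1 / (1 - η * f z) / weightMean f 0 η) := by
  have hsub : uIcc (-Real.pi) x ⊆ X := h.ordConnected_right.uIcc_subset h.neg_pi_mem (h.Icc_subset hx)
  have hf : Continuous f := h.contDiff.continuous
  have := intervalIntegral.integral_comp_mul_deriv''' (a := -Real.pi) (b := x) (f := flow f η)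
    (f' := fun z => 1 / (1 - η * f z) / weightMean f 0 η)
    (g := fun y => G (sol f I X (clock f η) y)) ?_ ?_ ?_ ?_ ?_
  · rw [flow_neg_pi] at this
    rw [← this]
    refine intervalIntegral.integral_congr fun z hz => ?_
    simp only [Function.comp, h.sol_flow hη (hsub hz)]
  · exact fun z hz => (h.hasDerivAt_flow_right hη (hsub hz)).continuousAt.continuousWithinAt
  · exact fun z hz => (h.hasDerivAt_flow_right hη
      (hsub (Ioo_subset_Icc_self hz))).hasDerivWithinAt
  · rintro _ ⟨z, hz, rfl⟩
    exact (hG.continuousAt.comp (h.hasDerivAt_sol_right hη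
      (hsub (Ioo_subset_Icc_self hz))).continuousAt).continuousWithinAt
  · have : ContinuousOn (fun y => G (sol f I X (clock f η) y)) (flow f η '' uIcc (-Real.pi) x) := by
      rintro _ ⟨z, hz, rfl⟩
      exact (hG.continuousAt.comp (h.hasDerivAt_sol_right hη
        (hsub hz)).continuousAt).continuousWithinAt
    refine this.integrableOn_compact (isCompact_uIcc.image_of_continuousOn fun z hz =>
      (h.hasDerivAt_flow_right hη (hsub hz)).continuousAt.continuousWithinAt)
  · rw [← intervalIntegrable_iff']
    refine ContinuousOn.intervalIntegrable ?_
    have hl : ContinuousOn (lagr f η) (uIcc (-Real.pi) x) := fun z hz =>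
      (h.hasDerivAt_lagr_right hη (hsub hz)).continuousAt.continuousWithinAt
    have : ContinuousOn (fun z => G (lagr f η z) * (1 / (1 - η * f z) / weightMean f 0 η))
        (uIcc (-Real.pi) x) := by
      refine (hG.comp_continuousOn hl).mul (ContinuousOn.div_const (ContinuousOn.div
        continuousOn_const (by fun_prop) fun z hz => (h.pos η hη z (hsub hz)).ne') _)
    refine this.congr fun z hz => ?_
    simp only [Function.comp, h.sol_flow hη (hsub hz)]

/-- The right side is the `η`-derivative of the flow divided by `weightMean f 0 η ^ 2`, the
derivative of the clock: `flow` really is the characteristic flow of the velocity in physical time.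
-/
theorem integral_sol (h : Admissible f I X) {η x : ℝ} (hη : η ∈ I)
    (hx : x ∈ Icc (-Real.pi) Real.pi) :
    ∫ y in (-Real.pi)..(flow f η x), sol f I X (clock f η) y
      = weightPrim f 1 η x / weightMean f 0 η ^ 3
        - weightPrim f 0 η x * weightMean f 1 η / weightMean f 0 η ^ 4 := by
  have hsub : uIcc (-Real.pi) x ⊆ X :=
    h.ordConnected_right.uIcc_subset h.neg_pi_mem (h.Icc_subset hx)
  have hint : ∀ n, IntervalIntegrable (weight f n η) MeasureTheory.volume (-Real.pi) x := fun n =>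
    ((h.continuousOn_weight n hη).mono hsub).intervalIntegrable
  have hK := (h.weightMean_pos hη).ne'
  have h1 := h.integral_comp_sol hη hx (G := id) continuous_id
  simp only [id] at h1
  rw [h1]
  have : ∫ z in (-Real.pi)..x, lagr f η z * (1 / (1 - η * f z) / weightMean f 0 η)
      = ∫ z in (-Real.pi)..x, (weight f 1 η z * (1 / weightMean f 0 η ^ 3)
        - weight f 0 η z * (weightMean f 1 η / weightMean f 0 η ^ 4)) := by
    refine intervalIntegral.integral_congr fun z hz => ?_
    have := (h.pos η hη z (hsub hz)).ne'
    simp only [lagr, weight]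
    generalize 1 - η * f z = D at *
    field_simp
    ring
  rw [this, intervalIntegral.integral_sub ((hint 1).mul_const _) ((hint 0).mul_const _),
    intervalIntegral.integral_mul_const, intervalIntegral.integral_mul_const]
  simp only [weightPrim]
  ring

theorem integral_sol_sq (h : Admissible f I X) {η : ℝ} (hη : η ∈ I) :
    ∫ y in (-Real.pi)..Real.pi, sol f I X (clock f η) y ^ 2
      = 2 * Real.pi * (weightMean f 2 η / weightMean f 0 η ^ 5
        - weightMean f 1 η ^ 2 / weightMean f 0 η ^ 6) := by
  have hpi : Real.pi ∈ Icc (-Real.pi) Real.pi := ⟨neg_pi_lt_pi.le, le_rfl⟩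
  have hsub : uIcc (-Real.pi) Real.pi ⊆ X :=
    h.ordConnected_right.uIcc_subset h.neg_pi_mem h.pi_mem
  have hint : ∀ n, IntervalIntegrable (weight f n η) MeasureTheory.volume (-Real.pi) Real.pi :=
    fun n => ((h.continuousOn_weight n hη).mono hsub).intervalIntegrable
  have hK := (h.weightMean_pos hη).ne'
  have h1 := h.integral_comp_sol hη hpi (G := fun u => u ^ 2) (continuous_pow 2)
  rw [h.flow_pi hη] at h1
  rw [h1]
  have : ∫ z in (-Real.pi)..Real.pi, lagr f η z ^ 2 * (1 / (1 - η * f z) / weightMean f 0 η)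
      = ∫ z in (-Real.pi)..Real.pi, (weight f 2 η z * (1 / weightMean f 0 η ^ 5)
        - weight f 1 η z * (2 * weightMean f 1 η / weightMean f 0 η ^ 6)
        + weight f 0 η z * (weightMean f 1 η ^ 2 / weightMean f 0 η ^ 7)) := by
    refine intervalIntegral.integral_congr fun z hz => ?_
    have := (h.pos η hη z (hsub hz)).ne'
    simp only [lagr, weight]
    generalize 1 - η * f z = D at *
    field_simp
    ring
  rw [this, intervalIntegral.integral_add (((hint 2).mul_const _).sub ((hint 1).mul_const _))
    ((hint 0).mul_const _), intervalIntegral.integral_sub ((hint 2).mul_const _)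
    ((hint 1).mul_const _), intervalIntegral.integral_mul_const,
    intervalIntegral.integral_mul_const, intervalIntegral.integral_mul_const]
  have e : ∀ n, ∫ z in (-Real.pi)..Real.pi, weight f n η z = 2 * Real.pi * weightMean f n η := by
    intro n
    simp only [weightMean, weightPrim]
    field_simp
  rw [e, e, e]
  field_simp
  ring

/-- In physical time the Lagrangian value has derivative equal to its square minus `2 * (K 2 / K 0 ^
5 - K 1 ^ 2 / K 0 ^ 6)`, and by `integral_sol_sq` the latter is the nonlocal term. The zero mean of
`f` makes `weightMean f 1 0` vanish, so that the datum at `η = 0` is `f`. -/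
theorem isGlobalC3Solution_sol (h : Admissible f I X)
    (hmean : ∫ x in (-Real.pi)..Real.pi, f x = 0)
    (hsurj : ∀ t, 0 ≤ t → ∃ η ∈ I, clock f η = t) : IsGlobalC3Solution f (sol f I X) where
  contDiffOn := by
    rintro ⟨t, y⟩ ⟨ht, hy⟩
    obtain ⟨η, hη, rfl⟩ := hsurj t ht
    obtain ⟨x, hx, rfl⟩ := h.exists_flow_eq hη hy
    exact (h.contDiffAt_sol hη (h.Icc_subset hx)).contDiffWithinAt
  initial := by
    intro x hx
    have h0 : clock f 0 = 0 := intervalIntegral.integral_same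
    have hK : weightMean f 0 0 = 1 := by
      simp only [weightMean, weightPrim, weight]
      simp
      field_simp
      ring
    have hK1 : weightMean f 1 0 = 0 := by
      simp [weightMean, weightPrim, weight, hmean]
    have hfl : flow f 0 x = x := by
      simp only [flow, hK, weightPrim, weight]
      simp
    have := h.sol_flow h.zero_mem (h.Icc_subset hx)
    rw [h0, hfl] at this
    rw [this, lagr, hK, hK1]
    simp
  equation := by
    rintro t ht y hy
    obtain ⟨η, hη, rfl⟩ := hsurj t ht
    obtain ⟨x, hx, rfl⟩ := h.exists_flow_eq hη hy
    have hxX := h.Icc_subset hx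
    obtain ⟨st, sx, h1, h2, h3, h4⟩ := h.hasDerivAt_sol hη hxX
    have hK := (h.weightMean_pos hη).ne'
    have hp := (h.pos η hη x hxX).ne'
    -- Two computations of one `η`-derivative: the chain rule through the flow yields the material
    -- derivative, the explicit formula its value.
    have e4 := h4.unique (h.hasDerivAt_lagr_left hη hxX)
    rw [h1.hasDerivWithinAt.derivWithin (uniqueDiffOn_Ici 0 _ ht),
      h2.hasDerivWithinAt.derivWithin (uniqueDiffOn_Icc neg_pi_lt_pi _ hy),
      h.integral_sol hη hx, h.integral_sol_sq hη, h.sol_flow hη hxX, lagr]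
    have hpi := Real.pi_pos.ne'
    have e5 : st + sx * (weightPrim f 1 η x / weightMean f 0 η ^ 3
          - weightPrim f 0 η x * weightMean f 1 η / weightMean f 0 η ^ 4)
        = (f x ^ 2 / (1 - η * f x) ^ 2 / weightMean f 0 η ^ 2
      - 2 * (f x / (1 - η * f x)) * weightMean f 1 η / weightMean f 0 η ^ 3
      - 2 * weightMean f 2 η / weightMean f 0 η ^ 3
      + 3 * weightMean f 1 η ^ 2 / weightMean f 0 η ^ 4) / weightMean f 0 η ^ 2 := by
      rw [← e4]
      field_simp
    have e6 : (weightPrim f 1 η x / weightMean f 0 η ^ 3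
          - weightPrim f 0 η x * weightMean f 1 η / weightMean f 0 η ^ 4) * sx
        = sx * (weightPrim f 1 η x / weightMean f 0 η ^ 3
          - weightPrim f 0 η x * weightMean f 1 η / weightMean f 0 η ^ 4) := mul_comm _ _
    rw [e6, e5]
    generalize 1 - η * f x = D at *
    field_simp
    ring

end Admissible

/-! ### Data close to the cosine -/

/-- Integration of a bound by a power of the distance to a zero. -/
theorem abs_le_of_abs_deriv_le_pow {g g' : ℝ → ℝ} {a b x₀ C : ℝ} {n : ℕ} (hC : 0 ≤ C)
    (hx₀ : x₀ ∈ Icc a b) (hd : ∀ y ∈ Icc a b, HasDerivAt g (g' y) y) (h0 : g x₀ = 0)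
    (hb : ∀ y ∈ Icc a b, |g' y| ≤ C * |y - x₀| ^ n) {x : ℝ} (hx : x ∈ Icc a b) :
    |g x| ≤ C * |x - x₀| ^ (n + 1) := by
  have hsub : uIcc x₀ x ⊆ Icc a b := ordConnected_Icc.uIcc_subset hx₀ hx
  have := (convex_uIcc x₀ x).norm_image_sub_le_of_norm_hasDerivWithin_le (f := g) (f' := g')
    (C := C * |x - x₀| ^ n) (fun y hy => (hd y (hsub hy)).hasDerivWithinAt) (fun y hy => ?_)
    left_mem_uIcc right_mem_uIcc
  · rw [h0, sub_zero, Real.norm_eq_abs, Real.norm_eq_abs] at this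
    rw [pow_succ, ← mul_assoc]; exact this
  · refine (hb y (hsub hy)).trans ?_
    have := abs_sub_left_of_mem_uIcc hy
    gcongr

/-- `f` is `C³`-close to `cos` on `[-π, π]`, is mean-free, and has a maximum point `x₀`. -/
structure NearCos (f : ℝ → ℝ) (σ x₀ : ℝ) : Prop where
  contDiff : ContDiff ℝ 3 f
  mean : ∫ x in (-Real.pi)..Real.pi, f x = 0
  small : σ ≤ 1 / 100000
  bound₀ : ∀ x ∈ Icc (-Real.pi) Real.pi, |f x - Real.cos x| ≤ σ
  bound₁ : ∀ x ∈ Icc (-Real.pi) Real.pi, |deriv f x + Real.sin x| ≤ σ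
  bound₂ : ∀ x ∈ Icc (-Real.pi) Real.pi, |deriv (deriv f) x + Real.cos x| ≤ σ
  bound₃ : ∀ x ∈ Icc (-Real.pi) Real.pi, |deriv (deriv (deriv f)) x - Real.sin x| ≤ σ
  mem : x₀ ∈ Icc (-Real.pi) Real.pi
  le_max : ∀ x ∈ Icc (-Real.pi) Real.pi, f x ≤ f x₀

namespace NearCos

variable {f : ℝ → ℝ} {σ x₀ : ℝ}

theorem nonneg (h : NearCos f σ x₀) : 0 ≤ σ := (abs_nonneg _).trans (h.bound₀ x₀ h.mem)

theorem hasDerivAt₀ (h : NearCos f σ x₀) (x : ℝ) : HasDerivAt f (deriv f x) x :=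
  (h.contDiff.differentiable (by norm_num) x).hasDerivAt

theorem contDiff_deriv (h : NearCos f σ x₀) : ContDiff ℝ 2 (deriv f) := by
  have : ContDiff ℝ (2 + 1) f := h.contDiff.of_le (by norm_num)
  exact (contDiff_succ_iff_deriv.1 this).2.2

theorem contDiff_deriv₂ (h : NearCos f σ x₀) : ContDiff ℝ 1 (deriv (deriv f)) := by
  have : ContDiff ℝ (1 + 1) (deriv f) := h.contDiff_deriv.of_le (by norm_num)
  exact (contDiff_succ_iff_deriv.1 this).2.2

theorem hasDerivAt₁ (h : NearCos f σ x₀) (x : ℝ) :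
    HasDerivAt (deriv f) (deriv (deriv f) x) x :=
  (h.contDiff_deriv.differentiable (by norm_num) x).hasDerivAt

theorem hasDerivAt₂ (h : NearCos f σ x₀) (x : ℝ) :
    HasDerivAt (deriv (deriv f)) (deriv (deriv (deriv f)) x) x :=
  (h.contDiff_deriv₂.differentiable (by norm_num) x).hasDerivAt

theorem zero_mem (_h : NearCos f σ x₀) : (0 : ℝ) ∈ Icc (-Real.pi) Real.pi :=
  ⟨by linarith [Real.pi_pos], Real.pi_pos.le⟩

/-- Comparing values at `x₀` and `0` with a quadratic upper bound for `cos` locates `x₀` only up to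
order `√σ`, but this puts it in the interior and away from `±π`. -/
theorem abs_max_le_aux (h : NearCos f σ x₀) : |x₀| ≤ 1 / 50 := by
  have h1 := abs_le.1 (h.bound₀ x₀ h.mem)
  have h2 := abs_le.1 (h.bound₀ 0 h.zero_mem)
  have h3 := h.le_max 0 h.zero_mem
  have h4 := Real.cos_le_one_sub_mul_cos_sq (abs_le.2 ⟨h.mem.1, h.mem.2⟩)
  rw [Real.cos_zero] at h2
  have h5 : 2 / Real.pi ^ 2 * x₀ ^ 2 ≤ 2 * (1 / 100000) := by
    have := h.small
    linarith [h1.2, h2.1]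
  have hpi : Real.pi ^ 2 ≤ 10 := by
    have := Real.pi_lt_d2
    nlinarith [Real.pi_pos]
  have h6 : x₀ ^ 2 ≤ 1 / 10000 := by
    have : x₀ ^ 2 = (2 / Real.pi ^ 2 * x₀ ^ 2) * (Real.pi ^ 2 / 2) := by
      have := Real.pi_pos
      field_simp
    rw [this]
    calc (2 / Real.pi ^ 2 * x₀ ^ 2) * (Real.pi ^ 2 / 2) ≤ 2 * (1 / 100000) * (10 / 2) := by gcongr
      _ ≤ _ := by norm_num
  exact abs_le_of_sq_le_sq (by linarith [sq_nonneg x₀, (by norm_num : (1 / 10000 : ℝ) ≤ (1 / 50) ^ 2)])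
    (by norm_num)

theorem deriv_max (h : NearCos f σ x₀) : deriv f x₀ = 0 := by
  have h1 := abs_le.1 h.abs_max_le_aux
  have hpi := Real.pi_gt_three
  refine IsLocalMax.deriv_eq_zero ?_
  filter_upwards [Icc_mem_nhds (by linarith : -Real.pi < x₀) (by linarith : x₀ < Real.pi)]
    with x hx using h.le_max x hx

/-- Since `x₀` is now an interior critical point, `|sin x₀| ≤ σ`, which improves the location to
order `σ`. -/
theorem abs_max_le (h : NearCos f σ x₀) : |x₀| ≤ 2 * σ := by
  have h1 := h.abs_max_le_aux
  have hpi := Real.pi_gt_three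
  have hpi' := Real.pi_lt_d2
  have h2 := h.bound₁ x₀ h.mem
  rw [h.deriv_max, zero_add] at h2
  have h3 := Real.mul_abs_le_abs_sin (x := x₀) (by linarith)
  have h4 : 1 / 2 * |x₀| ≤ 2 / Real.pi * |x₀| := by
    refine mul_le_mul_of_nonneg_right ?_ (abs_nonneg _)
    rw [div_le_div_iff₀ (by norm_num) (by linarith)]
    linarith
  linarith

theorem abs_curvature_sub_one_le (h : NearCos f σ x₀) : |-deriv (deriv f) x₀ - 1| ≤ 2 * σ := by
  have h1 := abs_le.1 (h.bound₂ x₀ h.mem)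
  have h2 := h.abs_max_le
  have h3 := Real.one_sub_sq_div_two_le_cos (x := x₀)
  have h4 := Real.cos_le_one x₀
  have h5 := h.small
  have h6 : x₀ ^ 2 ≤ (2 * σ) ^ 2 := by rw [← sq_abs]; gcongr
  have := h.nonneg
  rw [abs_le]
  constructor <;> nlinarith

theorem abs_max_sub_one_le (h : NearCos f σ x₀) : |f x₀ - 1| ≤ 2 * σ := by
  have h1 := abs_le.1 (h.bound₀ x₀ h.mem)
  have h2 := h.abs_max_le
  have h3 := Real.one_sub_sq_div_two_le_cos (x := x₀)
  have h4 := Real.cos_le_one x₀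
  have h5 := h.small
  have h6 : x₀ ^ 2 ≤ (2 * σ) ^ 2 := by rw [← sq_abs]; gcongr
  have := h.nonneg
  rw [abs_le]
  constructor <;> nlinarith

theorem abs_deriv_le (h : NearCos f σ x₀) {x : ℝ} (hx : x ∈ Icc (-Real.pi) Real.pi) :
    |deriv f x| ≤ 2 * |x - x₀| := by
  have := abs_le_of_abs_deriv_le_pow (n := 0) (C := 2) (by norm_num) h.mem
    (fun y _ => h.hasDerivAt₁ y) h.deriv_max (fun y hy => ?_) hx
  · simpa using this
  · have h1 := abs_le.1 (h.bound₂ y hy)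
    have h2 := abs_le.1 (Real.abs_cos_le_one y)
    have := h.small
    simp only [pow_zero, mul_one, abs_le]
    constructor <;> linarith

/-- The defect of the relation `cos'' = -1 + (1 - cos)` for `f`. -/
theorem abs_linear_defect_le (h : NearCos f σ x₀) {x : ℝ} (hx : x ∈ Icc (-Real.pi) Real.pi) :
    |deriv (deriv f) x - deriv (deriv f) x₀ - (f x₀ - f x)| ≤ 2 * σ * |x - x₀| := by
  have := abs_le_of_abs_deriv_le_pow (n := 0) (C := 2 * σ) (by linarith [h.nonneg]) h.mem
    (g := fun x => deriv (deriv f) x - deriv (deriv f) x₀ - (f x₀ - f x))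
    (g' := fun x => deriv (deriv (deriv f)) x + deriv f x)
    (fun y _ => by
      simpa using ((h.hasDerivAt₂ y).sub_const _).fun_sub ((h.hasDerivAt₀ y).const_sub (f x₀)))
    (by simp) (fun y hy => ?_) hx
  · simpa using this
  · have h1 := abs_le.1 (h.bound₁ y hy)
    have h2 := abs_le.1 (h.bound₃ y hy)
    simp only [pow_zero, mul_one, abs_le]
    constructor <;> linarith

/-- The defect of the relation `sin² = 2 (1 - cos) - (1 - cos)²` for `f`. -/
theorem abs_quadratic_defect_le (h : NearCos f σ x₀) {x : ℝ}
    (hx : x ∈ Icc (-Real.pi) Real.pi) :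
    |deriv f x ^ 2 + 2 * deriv (deriv f) x₀ * (f x₀ - f x) + (f x₀ - f x) ^ 2|
      ≤ 8 * σ * |x - x₀| ^ 3 := by
  -- The derivative of this expression is `2 * deriv f` times the linear defect; both factors vanish
  -- to first order at `x₀`.
  refine abs_le_of_abs_deriv_le_pow (n := 2) (C := 8 * σ) (by linarith [h.nonneg]) h.mem
    (g := fun x => deriv f x ^ 2 + 2 * deriv (deriv f) x₀ * (f x₀ - f x) + (f x₀ - f x) ^ 2)
    (g' := fun x => 2 * deriv f x *
      (deriv (deriv f) x - deriv (deriv f) x₀ - (f x₀ - f x)))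
    (fun y _ => ?_) (by simp [h.deriv_max]) (fun y hy => ?_) hx
  · have e1 := (h.hasDerivAt₀ y).const_sub (f x₀)
    refine ((((h.hasDerivAt₁ y).fun_pow 2).fun_add
      (e1.const_mul (2 * deriv (deriv f) x₀))).fun_add (e1.fun_pow 2)).congr_deriv ?_
    push_cast
    ring
  · have h1 := h.abs_deriv_le hy
    have h2 := h.abs_linear_defect_le hy
    rw [abs_mul, abs_mul, abs_two]
    calc 2 * |deriv f y| * |deriv (deriv f) y - deriv (deriv f) x₀ - (f x₀ - f y)|
        ≤ 2 * (2 * |y - x₀|) * (2 * σ * |y - x₀|) := by gcongr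
      _ = _ := by ring

/-- Value and slope of the difference vanish at `x₀`, so two integrations suffice. In second
derivatives, `σ` comes from the datum and `2 * σ` from the shift of the maximum. -/
theorem abs_sub_one_sub_cos_le (h : NearCos f σ x₀) {x : ℝ}
    (hx : x ∈ Icc (-Real.pi) Real.pi) :
    |f x₀ - f x - (1 - Real.cos (x - x₀))| ≤ 3 * σ * |x - x₀| ^ 2 := by
  have h0 := h.nonneg
  have hs : ∀ y, HasDerivAt (fun y => y - x₀) 1 y := fun y => (hasDerivAt_id y).sub_const x₀
  refine abs_le_of_abs_deriv_le_pow (n := 1) (C := 3 * σ) (by linarith) h.mem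
    (g := fun x => f x₀ - f x - (1 - Real.cos (x - x₀)))
    (g' := fun x => -deriv f x - Real.sin (x - x₀)) (fun y _ => ?_) (by simp) (fun y hy => ?_) hx
  · refine (((h.hasDerivAt₀ y).const_sub (f x₀)).fun_sub (((hs y).cos).const_sub 1)).congr_deriv ?_
    ring
  · refine abs_le_of_abs_deriv_le_pow (n := 0) (C := 3 * σ) (by linarith) h.mem
      (g := fun x => -deriv f x - Real.sin (x - x₀))
      (g' := fun x => -deriv (deriv f) x - Real.cos (x - x₀)) (fun z _ => ?_)
      (by simp [h.deriv_max]) (fun z hz => ?_) hy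
    · refine ((h.hasDerivAt₁ z).fun_neg.fun_sub ((hs z).sin)).congr_deriv ?_
      ring
    · have h1 := abs_le.1 (h.bound₂ z hz)
      have h2 : |Real.cos z - Real.cos (z - x₀)| ≤ |z - (z - x₀)| := by
        simpa using Real.abs_cos_sub_cos_le z (z - x₀)
      rw [sub_sub_cancel] at h2
      have h3 := abs_le.1 (h2.trans h.abs_max_le)
      simp only [pow_zero, mul_one, abs_le]
      constructor <;> linarith

/-- The range exceeds `π` slightly because `x - x₀` is not centred at zero. Up to `π` the chord
bound suffices, as `π ^ 2 ≤ 12`; beyond it `cos` is still close to `-1`. -/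
theorem sq_div_six_le_one_sub_cos {r : ℝ} (hr : |r| ≤ Real.pi + 1 / 50) :
    r ^ 2 / 6 ≤ 1 - Real.cos r := by
  rw [← Real.cos_abs, ← sq_abs]
  have h0 := abs_nonneg r
  generalize |r| = s at *
  have hpi := Real.pi_gt_three
  have hpi' := Real.pi_lt_d2
  rcases le_or_gt s Real.pi with hs | hs
  · have h1 := Real.cos_le_one_sub_mul_cos_sq (x := s) (by rwa [abs_of_nonneg h0])
    have h2 : s ^ 2 / 6 ≤ 2 / Real.pi ^ 2 * s ^ 2 := by
      rw [div_eq_inv_mul]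
      gcongr
      rw [inv_eq_one_div, div_le_div_iff₀ (by norm_num) (by positivity)]
      nlinarith
    linarith
  · have h1 := Real.one_sub_sq_div_two_le_cos (x := s - Real.pi)
    rw [Real.cos_sub_pi] at h1
    nlinarith

theorem abs_sub_max_le (h : NearCos f σ x₀) {x : ℝ} (hx : x ∈ Icc (-Real.pi) Real.pi) :
    |x - x₀| ≤ Real.pi + 1 / 50 := by
  have := abs_sub x x₀
  have h2 := abs_le.2 hx
  linarith [h.abs_max_le_aux]

/-- The quadratic error `3 * σ * |x - x₀| ^ 2` is absorbed by `1 - cos` at the price of a factor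
`6`. This multiplicative form allows comparison with explicit integrals. -/
theorem gap_mem (h : NearCos f σ x₀) {x : ℝ} (hx : x ∈ Icc (-Real.pi) Real.pi) :
    (1 - 18 * σ) * (1 - Real.cos (x - x₀)) ≤ f x₀ - f x ∧
      f x₀ - f x ≤ (1 + 18 * σ) * (1 - Real.cos (x - x₀)) := by
  have h1 := abs_le.1 (h.abs_sub_one_sub_cos_le hx)
  have h2 := sq_div_six_le_one_sub_cos (h.abs_sub_max_le hx)
  have h0 := h.nonneg
  rw [sq_abs] at h1
  constructor <;> nlinarith

theorem sq_le_gap (h : NearCos f σ x₀) {x : ℝ} (hx : x ∈ Icc (-Real.pi) Real.pi) :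
    (x - x₀) ^ 2 / 7 ≤ f x₀ - f x := by
  have h1 := (h.gap_mem hx).1
  have h2 := sq_div_six_le_one_sub_cos (h.abs_sub_max_le hx)
  have h0 := h.nonneg
  have h3 := h.small
  nlinarith [sq_nonneg (x - x₀)]

theorem max_unique (h : NearCos f σ x₀) {y : ℝ} (hy : y ∈ Icc (-Real.pi) Real.pi)
    (hmax : f x₀ ≤ f y) : y = x₀ := by
  have := h.sq_le_gap hy
  have : (y - x₀) ^ 2 = 0 := le_antisymm (by linarith) (sq_nonneg _)
  exact sub_eq_zero.1 (pow_eq_zero_iff (two_ne_zero)|>.1 this)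

end NearCos

/-! ### Explicit comparison integrals -/

/-- The classical integral of `1 / (a - b cos)` over a period. -/
theorem integral_one_div_sub_mul_cos {a b : ℝ} (hb : 0 ≤ b) (hab : b < a) :
    ∫ x in (-Real.pi)..Real.pi, 1 / (a - b * Real.cos x) = 2 * Real.pi / √(a ^ 2 - b ^ 2) := by
  set s := √(a ^ 2 - b ^ 2) with hs
  have hpos : 0 < a ^ 2 - b ^ 2 := by nlinarith
  have hs0 : 0 < s := Real.sqrt_pos.2 hpos
  have hs2 : s ^ 2 = a ^ 2 - b ^ 2 := Real.sq_sqrt hpos.le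
  have hden : ∀ x, 0 < a - b * Real.cos x := fun x => by
    nlinarith [Real.cos_le_one x]
  have hden' : ∀ x, 0 < a + s - b * Real.cos x := fun x => by linarith [hden x]
  -- This form of the half-angle antiderivative is smooth across `±π`, and its arctangent term
  -- vanishes there with `sin`, so the linear term alone gives the value.
  have hder : ∀ x, HasDerivAt
      (fun x => x / s + 2 / s * Real.arctan (b * Real.sin x / (a + s - b * Real.cos x)))
      (1 / (a - b * Real.cos x)) x := by
    intro x
    have e1 : HasDerivAt (fun x => a + s - b * Real.cos x) (b * Real.sin x) x := by
      simpa using ((Real.hasDerivAt_cos x).const_mul b).const_sub (a + s)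
    have e2 := ((Real.hasDerivAt_sin x).const_mul b).fun_div e1 (hden' x).ne'
    have e3 := ((hasDerivAt_id x).div_const s).fun_add ((e2.arctan).const_mul (2 / s))
    refine e3.congr_deriv ?_
    have hd := (hden x).ne'
    have hd' := (hden' x).ne'
    have hsc := Real.sin_sq_add_cos_sq x
    generalize Real.sin x = S at *
    generalize Real.cos x = c at *
    have hS : S ^ 2 = 1 - c ^ 2 := by linarith
    have hq : 1 + (b * S / (a + s - b * c)) ^ 2
        = 2 * (a + s) * (a - b * c) / (a + s - b * c) ^ 2 := by
      field_simp
      rw [hS]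
      linear_combination hs2
    have has : a + s ≠ 0 := by linarith [hs0] |> fun h : 0 < a + s => h.ne'
    rw [hq]
    field_simp
    rw [hS]
    linear_combination (-1 : ℝ) * hs2
  rw [intervalIntegral.integral_eq_sub_of_hasDerivAt (fun x _ => hder x)]
  · simp
    ring
  · refine Continuous.intervalIntegrable ?_ _ _
    exact continuous_const.div (by fun_prop) fun x => (hden x).ne'

theorem integral_one_div_add_mul_one_sub_cos {e k : ℝ} (he : 0 < e) (hk : 0 ≤ k) (x₀ : ℝ) :
    ∫ x in (-Real.pi)..Real.pi, 1 / (e + k * (1 - Real.cos (x - x₀)))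
      = 2 * Real.pi / √(e * (e + 2 * k)) := by
  have h1 : ∫ x in (-Real.pi)..Real.pi, 1 / (e + k * (1 - Real.cos (x - x₀)))
      = ∫ x in (-Real.pi - x₀)..(Real.pi - x₀), 1 / ((e + k) - k * Real.cos x) := by
    rw [← intervalIntegral.integral_comp_sub_right
      (fun x => 1 / ((e + k) - k * Real.cos x)) x₀]
    congr 1; ext x; congr 1; ring
  have hper : Function.Periodic (fun x => 1 / ((e + k) - k * Real.cos x)) (2 * Real.pi) := by
    intro x; simp
  have h2 := hper.intervalIntegral_add_eq (-Real.pi - x₀) (-Real.pi)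
  rw [h1]
  have e1 : -Real.pi - x₀ + 2 * Real.pi = Real.pi - x₀ := by ring
  have e2 : -Real.pi + 2 * Real.pi = Real.pi := by ring
  rw [e1, e2] at h2
  rw [h2, integral_one_div_sub_mul_cos hk (by linarith)]
  congr 2; ring

theorem abs_integral_le_of_Icc {g e : ℝ → ℝ} (hg : ContinuousOn g (Icc (-Real.pi) Real.pi))
    (he : ContinuousOn e (Icc (-Real.pi) Real.pi))
    (hle : ∀ x ∈ Icc (-Real.pi) Real.pi, |g x| ≤ e x) {a b : ℝ}
    (ha : a ∈ Icc (-Real.pi) Real.pi) (hb : b ∈ Icc (-Real.pi) Real.pi) :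
    |∫ x in a..b, g x| ≤ ∫ x in (-Real.pi)..Real.pi, e x := by
  wlog hab : a ≤ b generalizing a b
  · rw [intervalIntegral.integral_symm, abs_neg]
    exact this hb ha (le_of_not_ge hab)
  have hsub : Icc a b ⊆ Icc (-Real.pi) Real.pi := Icc_subset_Icc ha.1 hb.2
  have hi : ∀ {u : ℝ → ℝ}, ContinuousOn u (Icc (-Real.pi) Real.pi) →
      IntervalIntegrable u MeasureTheory.volume a b := fun hu =>
    ContinuousOn.intervalIntegrable (by rw [uIcc_of_le hab]; exact hu.mono hsub)
  calc |∫ x in a..b, g x| ≤ ∫ x in a..b, |g x| :=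
        intervalIntegral.abs_integral_le_integral_abs hab
    _ ≤ ∫ x in a..b, e x := intervalIntegral.integral_mono_on hab (hi hg).abs (hi he)
        fun x hx => hle x (hsub hx)
    _ ≤ ∫ x in (-Real.pi)..Real.pi, e x := by
        refine intervalIntegral.integral_mono_interval ha.1 hab hb.2 ?_ (intervalIntegrable_of_Icc he)
        refine (MeasureTheory.ae_restrict_iff' measurableSet_Ioc).2
          (Filter.Eventually.of_forall fun x hx => ?_)
        exact (abs_nonneg _).trans (hle x (Ioc_subset_Icc_self hx))

/-! ### The perturbed harmonic oscillator -/

/-- The energy identity `hsq` determines `lam * v` only up to sign. The lower bound on `v` excludes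
`-m`: it keeps `lam * v + m` away from zero, so one may divide by it. -/
theorem amplitude_stability {α lam m z u v : ℝ} (hz0 : 0 ≤ z) (hz : z ≤ 3 / 10000)
    (hm : |m - 1| ≤ 1 / 1000) (hlam : |lam - 1| ≤ 1 / 1000) (hα : |α| ≤ 10 * z)
    (hu : |u| ≤ 186 * z) (hv : -(122 * z) ≤ v)
    (hsq : (lam * v) ^ 2 - m ^ 2 = 2 * m * α + α ^ 2 - lam ^ 2 * u ^ 2) :
    |lam * v - m| ≤ 45 * z := by
  obtain ⟨hm1, hm2⟩ := abs_le.1 hm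
  obtain ⟨hl1, hl2⟩ := abs_le.1 hlam
  have hl3 : lam ^ 2 ≤ 101 / 100 := by nlinarith
  have hu2 : lam ^ 2 * u ^ 2 ≤ 12 * z := by
    have h2 : u ^ 2 ≤ (186 * z) ^ 2 := by rw [← sq_abs]; gcongr
    calc lam ^ 2 * u ^ 2 ≤ 101 / 100 * (186 * z) ^ 2 := by gcongr
      _ ≤ _ := by nlinarith
  have hu3 : 0 ≤ lam ^ 2 * u ^ 2 := by positivity
  have ha2 : α ^ 2 ≤ z := by
    have : α ^ 2 ≤ (10 * z) ^ 2 := by rw [← sq_abs]; gcongr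
    nlinarith
  have hma : |m * α| ≤ 1001 / 1000 * (10 * z) := by
    rw [abs_mul]
    exact mul_le_mul (abs_le.2 ⟨by linarith, by linarith⟩) hα (abs_nonneg _) (by norm_num)
  have hma' := abs_le.1 hma
  have hD : |(lam * v - m) * (lam * v + m)| ≤ 35 * z := by
    have : (lam * v - m) * (lam * v + m) = 2 * (m * α) + α ^ 2 - lam ^ 2 * u ^ 2 := by
      linear_combination hsq
    rw [this, abs_le]
    constructor <;> linarith [sq_nonneg α]
  have hlv : -(122 * z) * (1001 / 1000) ≤ lam * v := by
    rcases le_total 0 v with h | h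
    · exact le_trans (by linarith) (mul_nonneg (by linarith) h)
    · nlinarith
  have hs : 9 / 10 ≤ lam * v + m := by linarith
  rw [abs_mul, abs_of_pos (by linarith : 0 < lam * v + m)] at hD
  have h0 := mul_le_mul_of_nonneg_left hs (abs_nonneg (lam * v - m))
  linarith

theorem abs_mul_sub_le_of_osc {lam m z v w : ℝ} (hz0 : 0 ≤ z) (hlam : |lam - 1| ≤ 1 / 1000)
    (hvw : |w - v| ≤ 121 * z) (hv : |lam * v - m| ≤ 45 * z) : |lam * w - m| ≤ 170 * z := by
  obtain ⟨hl1, hl2⟩ := abs_le.1 hlam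
  have h1 : |lam * (w - v)| ≤ 1001 / 1000 * (121 * z) := by
    rw [abs_mul]
    exact mul_le_mul (abs_le.2 ⟨by linarith, by linarith⟩) hvw (abs_nonneg _) (by norm_num)
  rw [show lam * w - m = lam * (w - v) + (lam * v - m) by ring]
  have := (abs_add_le _ _).trans (add_le_add h1 hv)
  linarith

theorem mem_of_abs_mul_sub_le {lam m z v : ℝ} (hz : z ≤ 3 / 10000) (hm : |m - 1| ≤ 1 / 1000)
    (hlam : |lam - 1| ≤ 1 / 1000) (hv : |lam * v - m| ≤ 170 * z) :
    9 / 10 ≤ v ∧ v ≤ 11 / 10 := by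
  obtain ⟨hm1, hm2⟩ := abs_le.1 hm
  obtain ⟨hl1, hl2⟩ := abs_le.1 hlam
  obtain ⟨h1, h2⟩ := abs_le.1 hv
  constructor <;> by_contra! hcon <;> nlinarith

/-- A perturbed harmonic oscillator `A'' + lam² A = α + E` in the variable `γ`, `dγ = w dx`, that
is mean-free and has almost vanishing Neumann data: `A'` is close to `-m sin γ`. -/
theorem oscillator_stability {γ A B w E e : ℝ → ℝ} {α lam m z x₀ : ℝ}
    (hγ : ∀ x ∈ Icc (-Real.pi) Real.pi, HasDerivAt γ (w x) x)
    (hA : ∀ x ∈ Icc (-Real.pi) Real.pi, HasDerivAt A (B x * w x) x)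
    (hB : ∀ x ∈ Icc (-Real.pi) Real.pi, HasDerivAt B ((α - lam ^ 2 * A x + E x) * w x) x)
    (hw : ContinuousOn w (Icc (-Real.pi) Real.pi))
    (hE : ContinuousOn E (Icc (-Real.pi) Real.pi))
    (he : ContinuousOn e (Icc (-Real.pi) Real.pi))
    (hw0 : ∀ x ∈ Icc (-Real.pi) Real.pi, 0 ≤ w x)
    (hwint : ∫ x in (-Real.pi)..Real.pi, w x = 2 * Real.pi)
    (hEe : ∀ x ∈ Icc (-Real.pi) Real.pi, |E x| ≤ e x)
    (heint : ∫ x in (-Real.pi)..Real.pi, e x * w x ≤ 58 * z)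
    (hAint : ∫ x in (-Real.pi)..Real.pi, A x * w x = 0)
    (hγl : γ (-Real.pi) = -Real.pi) (hγr : γ Real.pi = Real.pi)
    (hγm : ∀ x ∈ Icc (-Real.pi) Real.pi, |γ x| ≤ Real.pi)
    (hBl : |B (-Real.pi)| ≤ z) (hBr : |B Real.pi| ≤ z)
    (hAlr : |A Real.pi - A (-Real.pi)| ≤ 3 * z) (hAl : A (-Real.pi) ≤ 0)
    (hx₀ : x₀ ∈ Icc (-Real.pi) Real.pi) (hBx₀ : B x₀ = 0) (hAx₀ : lam ^ 2 * A x₀ = m + α)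
    (hm : |m - 1| ≤ 1 / 1000) (hlam : |lam - 1| ≤ 1 / 1000) (hz : z ≤ 3 / 10000)
    {x : ℝ} (hx : x ∈ Icc (-Real.pi) Real.pi) :
    |B x + m * Real.sin (γ x)| ≤ 600 * z := by
  have hz0 : 0 ≤ z := (abs_nonneg _).trans hBl
  have hpi := Real.pi_gt_three
  have hpi' := Real.pi_lt_d2
  have hpil : -Real.pi ∈ Icc (-Real.pi) Real.pi := ⟨le_rfl, neg_pi_lt_pi.le⟩
  have hpir : Real.pi ∈ Icc (-Real.pi) Real.pi := ⟨neg_pi_lt_pi.le, le_rfl⟩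
  have hγc : ContinuousOn γ (Icc (-Real.pi) Real.pi) := fun x hx =>
    (hγ x hx).continuousAt.continuousWithinAt
  have hAc : ContinuousOn A (Icc (-Real.pi) Real.pi) := fun x hx =>
    (hA x hx).continuousAt.continuousWithinAt
  have hBc : ContinuousOn B (Icc (-Real.pi) Real.pi) := fun x hx =>
    (hB x hx).continuousAt.continuousWithinAt
  obtain ⟨hm1, hm2⟩ := abs_le.1 hm
  obtain ⟨hl1, hl2⟩ := abs_le.1 hlam
  have hEw : |∫ x in (-Real.pi)..Real.pi, E x * w x| ≤ 58 * z := by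
    refine (abs_integral_le_of_Icc (hE.mul hw) (he.mul hw) (fun x hx => ?_) hpil hpir).trans heint
    rw [Pi.mul_apply, Pi.mul_apply, abs_mul, abs_of_nonneg (hw0 x hx)]
    exact mul_le_mul_of_nonneg_right (hEe x hx) (hw0 x hx)
  -- Integrate the equation for `B`: the mean of `A` drops out and the ends contribute at most `2 *
  -- z`, so `2π |α| ≤ 60 * z`.
  have hα : |α| ≤ 10 * z := by
    have h1 := integral_eq_sub_of_hasDerivWithinAt (fun x hx => (hB x hx).hasDerivWithinAt)
      (by fun_prop)
    have h2 : ∫ x in (-Real.pi)..Real.pi, (α - lam ^ 2 * A x + E x) * w x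
        = α * (2 * Real.pi) + ∫ x in (-Real.pi)..Real.pi, E x * w x := by
      have : ∫ x in (-Real.pi)..Real.pi, (α - lam ^ 2 * A x + E x) * w x
          = ∫ x in (-Real.pi)..Real.pi, (α * w x - lam ^ 2 * (A x * w x) + E x * w x) := by
        congr 1; ext x; ring
      rw [this, intervalIntegral.integral_add (intervalIntegrable_of_Icc (by fun_prop))
        (intervalIntegrable_of_Icc (by fun_prop)), intervalIntegral.integral_sub
        (intervalIntegrable_of_Icc (by fun_prop)) (intervalIntegrable_of_Icc (by fun_prop)),
        intervalIntegral.integral_const_mul, intervalIntegral.integral_const_mul, hwint, hAint]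
      ring
    rw [h2] at h1
    have e1 := abs_le.1 hBl
    have e2 := abs_le.1 hBr
    have e3 := abs_le.1 hEw
    have e4 : |α * (2 * Real.pi)| ≤ 60 * z := by
      rw [abs_le]; constructor <;> linarith
    rw [abs_mul, abs_of_pos (by linarith : 0 < 2 * Real.pi)] at e4
    have e5 := mul_le_mul_of_nonneg_left (by linarith : 6 ≤ 2 * Real.pi) (abs_nonneg α)
    linarith
  have hw' : ∀ x ∈ Icc (-Real.pi) Real.pi, |α + E x| * w x ≤ (10 * z) * w x + e x * w x := by
    intro x hx
    rw [← add_mul]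
    exact mul_le_mul_of_nonneg_right ((abs_add_le _ _).trans (add_le_add hα (hEe x hx))) (hw0 x hx)
  have htot : ∫ x in (-Real.pi)..Real.pi, ((10 * z) * w x + e x * w x) ≤ 121 * z := by
    rw [intervalIntegral.integral_add (intervalIntegrable_of_Icc (by fun_prop))
      (intervalIntegrable_of_Icc (by fun_prop)), intervalIntegral.integral_const_mul, hwint]
    have := mul_le_mul_of_nonneg_left hpi'.le hz0
    linarith
  have hlg : ∀ x ∈ Icc (-Real.pi) Real.pi, HasDerivAt (fun x => lam * γ x) (lam * w x) x :=
    fun x hx => (hγ x hx).const_mul lam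
  have hsubI : ∀ {a b : ℝ}, a ∈ Icc (-Real.pi) Real.pi → b ∈ Icc (-Real.pi) Real.pi →
      uIcc a b ⊆ Icc (-Real.pi) Real.pi := fun ha hb => ordConnected_Icc.uIcc_subset ha hb
  -- Variation of parameters: `U` and `V` are `B` and `lam * A` in the frame rotating with phase
  -- `lam * γ`. Only `α + E` drives them, so each oscillates by at most the integral of the forcing.
  obtain ⟨U, hU⟩ : ∃ U : ℝ → ℝ, ∀ x, U x = lam * A x * Real.sin (lam * γ x)
    + B x * Real.cos (lam * γ x) := ⟨_, fun _ => rfl⟩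
  obtain ⟨V, hV⟩ : ∃ V : ℝ → ℝ, ∀ x, V x = lam * A x * Real.cos (lam * γ x)
    - B x * Real.sin (lam * γ x) := ⟨_, fun _ => rfl⟩
  have hUd : ∀ x ∈ Icc (-Real.pi) Real.pi,
      HasDerivAt U ((α + E x) * w x * Real.cos (lam * γ x)) x := by
    intro x hx
    have : U = fun x => lam * A x * Real.sin (lam * γ x) + B x * Real.cos (lam * γ x) := funext hU
    rw [this]
    refine ((((hA x hx).const_mul lam).fun_mul (hlg x hx).sin).fun_add
      ((hB x hx).fun_mul (hlg x hx).cos)).congr_deriv ?_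
    ring
  have hVd : ∀ x ∈ Icc (-Real.pi) Real.pi,
      HasDerivAt V (-((α + E x) * w x * Real.sin (lam * γ x))) x := by
    intro x hx
    have : V = fun x => lam * A x * Real.cos (lam * γ x) - B x * Real.sin (lam * γ x) := funext hV
    rw [this]
    refine ((((hA x hx).const_mul lam).fun_mul (hlg x hx).cos).fun_sub
      ((hB x hx).fun_mul (hlg x hx).sin)).congr_deriv ?_
    ring
  have hosc : ∀ {W W' : ℝ → ℝ}, (∀ x ∈ Icc (-Real.pi) Real.pi, HasDerivAt W (W' x) x) →
      ContinuousOn W' (Icc (-Real.pi) Real.pi) →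
      (∀ x ∈ Icc (-Real.pi) Real.pi, |W' x| ≤ |α + E x| * w x) →
      ∀ {a b : ℝ}, a ∈ Icc (-Real.pi) Real.pi → b ∈ Icc (-Real.pi) Real.pi →
      |W b - W a| ≤ 121 * z := by
    intro W W' hd hc hb a b ha hb'
    rw [← intervalIntegral.integral_eq_sub_of_hasDerivAt (fun x hx => hd x (hsubI ha hb' hx))
      (hc.mono (hsubI ha hb')).intervalIntegrable]
    exact (abs_integral_le_of_Icc hc (by fun_prop) (fun x hx => (hb x hx).trans (hw' x hx))
      ha hb').trans htot
  have hUosc : ∀ {a b : ℝ}, a ∈ Icc (-Real.pi) Real.pi → b ∈ Icc (-Real.pi) Real.pi →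
      |U b - U a| ≤ 121 * z := by
    refine hosc hUd (by fun_prop) fun x hx => ?_
    rw [abs_mul, abs_mul, abs_of_nonneg (hw0 x hx)]
    exact mul_le_of_le_one_right (mul_nonneg (abs_nonneg _) (hw0 x hx)) (Real.abs_cos_le_one _)
  have hVosc : ∀ {a b : ℝ}, a ∈ Icc (-Real.pi) Real.pi → b ∈ Icc (-Real.pi) Real.pi →
      |V b - V a| ≤ 121 * z := by
    refine hosc hVd (by fun_prop) fun x hx => ?_
    rw [abs_neg, abs_mul, abs_mul, abs_of_nonneg (hw0 x hx)]
    exact mul_le_of_le_one_right (mul_nonneg (abs_nonneg _) (hw0 x hx)) (Real.abs_sin_le_one _)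
  obtain ⟨s, hs⟩ : ∃ s, Real.sin (lam * Real.pi) = s := ⟨_, rfl⟩
  obtain ⟨c, hc⟩ : ∃ c, Real.cos (lam * Real.pi) = c := ⟨_, rfl⟩
  have hs1 : |s| ≤ 1 := hs ▸ Real.abs_sin_le_one _
  have hc1 : |c| ≤ 1 := hc ▸ Real.abs_cos_le_one _
  have hUl : U (-Real.pi) = -(lam * A (-Real.pi) * s) + B (-Real.pi) * c := by
    rw [hU, hγl, mul_neg lam, Real.sin_neg, Real.cos_neg, hs, hc]; ring
  have hUr : U Real.pi = lam * A Real.pi * s + B Real.pi * c := by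
    rw [hU, hγr, hs, hc]
  have hVl : V (-Real.pi) = lam * A (-Real.pi) * c + B (-Real.pi) * s := by
    rw [hV, hγl, mul_neg lam, Real.sin_neg, Real.cos_neg, hs, hc]; ring
  have hBlc : |B (-Real.pi) * c| ≤ z := by
    rw [abs_mul]; exact (mul_le_of_le_one_right (abs_nonneg _) hc1).trans hBl
  have hBls : |B (-Real.pi) * s| ≤ z := by
    rw [abs_mul]; exact (mul_le_of_le_one_right (abs_nonneg _) hs1).trans hBl
  have hBrc : |B Real.pi * c| ≤ z := by
    rw [abs_mul]; exact (mul_le_of_le_one_right (abs_nonneg _) hc1).trans hBr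
  have hdA : |lam * (A Real.pi - A (-Real.pi)) * s| ≤ 31 / 10 * z := by
    rw [abs_mul, abs_mul, abs_of_nonneg (by linarith : 0 ≤ lam)]
    refine (mul_le_of_le_one_right (mul_nonneg (by linarith) (abs_nonneg _)) hs1).trans ?_
    refine (mul_le_mul (by linarith : lam ≤ 1001 / 1000) hAlr (abs_nonneg _)
      (by norm_num)).trans ?_
    linarith
  -- `U π - U (-π)` contains `2 * lam * A (-π) * sin (lam π)`; every other contribution is of order
  -- `z`.
  have hAs : |lam * A (-Real.pi) * s| ≤ 64 * z := by
    have h1 := abs_le.1 (hUosc hpil hpir)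
    rw [hUl, hUr] at h1
    have h2 := abs_le.1 hBlc
    have h3 := abs_le.1 hBrc
    have h4 := abs_le.1 hdA
    rw [mul_sub, sub_mul] at h4
    rw [abs_le]
    constructor <;> linarith
  have hUx : ∀ y ∈ Icc (-Real.pi) Real.pi, |U y| ≤ 186 * z := by
    intro y hy
    have h1 := abs_le.1 (hUosc hpil hy)
    rw [hUl] at h1
    have h2 := abs_le.1 hBlc
    have h3 := abs_le.1 hAs
    rw [abs_le]
    constructor <;> linarith
  have hlp : |(lam - 1) * Real.pi| ≤ 1 / 100 := by
    rw [abs_mul, abs_of_pos Real.pi_pos]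
    refine (mul_le_mul hlam hpi'.le Real.pi_pos.le (by norm_num)).trans ?_
    norm_num
  have hcneg : c ≤ 0 := by
    have : c = -Real.cos ((lam - 1) * Real.pi) := by
      rw [← hc, ← Real.cos_sub_pi]
      rw [show (lam - 1) * Real.pi = lam * Real.pi - Real.pi by ring, Real.cos_sub_pi,
        Real.cos_sub_pi]
      simp
    rw [this]
    have h1 := Real.one_sub_sq_div_two_le_cos (x := (lam - 1) * Real.pi)
    have h2 : ((lam - 1) * Real.pi) ^ 2 ≤ (1 / 100) ^ 2 := by rw [← sq_abs]; gcongr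
    linarith
  -- This selects the sign of the amplitude: `A (-π)` and `cos (lam π)` are both nonpositive, so `V
  -- (-π)` cannot be very negative, and `V` hardly varies.
  have hVx₀low : -(122 * z) ≤ V x₀ := by
    have h1 := abs_le.1 (hVosc hpil hx₀)
    rw [hVl] at h1
    have h2 := abs_le.1 hBls
    have h3 : 0 ≤ lam * A (-Real.pi) * c := by
      rw [mul_assoc]
      exact mul_nonneg (by linarith) (mul_nonneg_of_nonpos_of_nonpos hAl hcneg)
    linarith
  -- Where `B` vanishes, `U² + V² = lam² A²`, and the value of `A` there is known. The phase `γ x₀`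
  -- is not needed.
  have hsq : (lam * V x₀) ^ 2 - m ^ 2 = 2 * m * α + α ^ 2 - lam ^ 2 * U x₀ ^ 2 := by
    have h1 : U x₀ = lam * A x₀ * Real.sin (lam * γ x₀) := by rw [hU, hBx₀]; ring
    have h2 : V x₀ = lam * A x₀ * Real.cos (lam * γ x₀) := by rw [hV, hBx₀]; ring
    have h3 := Real.sin_sq_add_cos_sq (lam * γ x₀)
    have h4 : (lam ^ 2 * A x₀) ^ 2 = (m + α) ^ 2 := by rw [hAx₀]
    rw [h1, h2]
    linear_combination h4 + lam ^ 4 * A x₀ ^ 2 * h3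
  have hVx₀ : |lam * V x₀ - m| ≤ 45 * z :=
    amplitude_stability hz0 hz hm hlam hα (hUx x₀ hx₀) hVx₀low hsq
  have hVy : ∀ y ∈ Icc (-Real.pi) Real.pi, |lam * V y - m| ≤ 170 * z := fun y hy =>
    abs_mul_sub_le_of_osc hz0 hlam (hVosc hx₀ hy) hVx₀
  have hVabs : ∀ y ∈ Icc (-Real.pi) Real.pi, 9 / 10 ≤ V y ∧ V y ≤ 11 / 10 := fun y hy =>
    mem_of_abs_mul_sub_le hz hm hlam (hVy y hy)
  have hs80 : |s| ≤ 80 * z := by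
    have h1 := (hVabs _ hpil).1
    rw [hVl] at h1
    have h2 := abs_le.1 hBls
    have h3 : 8 / 10 ≤ |lam * A (-Real.pi)| := by
      have : 8 / 10 ≤ |lam * A (-Real.pi) * c| := le_trans (by linarith) (le_abs_self _)
      rw [abs_mul] at this
      exact this.trans (mul_le_of_le_one_right (abs_nonneg _) hc1)
    rw [abs_mul] at hAs
    have h0 := mul_le_mul_of_nonneg_right h3 (abs_nonneg s)
    linarith
  -- The large amplitude at the left end forces `sin (lam π)` to be of order `z`, so the frequency
  -- inherits the decay of the defect, sharpening the fixed bound `1 / 1000`.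
  have hl40 : |lam - 1| ≤ 40 * z := by
    have h1 := Real.mul_abs_le_abs_sin (x := (lam - 1) * Real.pi) (by linarith)
    have h2 : |Real.sin ((lam - 1) * Real.pi)| = |s| := by
      rw [show (lam - 1) * Real.pi = lam * Real.pi - Real.pi by ring, Real.sin_sub_pi, abs_neg, hs]
    rw [h2, abs_mul, abs_of_pos Real.pi_pos] at h1
    have h3 : 2 / Real.pi * (|lam - 1| * Real.pi) = 2 * |lam - 1| := by field_simp
    linarith
  have hBeq : B x + m * Real.sin (γ x) = U x * Real.cos (lam * γ x)
      + (m - V x) * Real.sin (lam * γ x) + m * (Real.sin (γ x) - Real.sin (lam * γ x)) := by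
    have h3 := Real.sin_sq_add_cos_sq (lam * γ x)
    rw [hU, hV]
    linear_combination (-B x) * h3
  have t1 : |U x * Real.cos (lam * γ x)| ≤ 186 * z := by
    rw [abs_mul]
    exact (mul_le_of_le_one_right (abs_nonneg _) (Real.abs_cos_le_one _)).trans (hUx x hx)
  have t2 : |(m - V x) * Real.sin (lam * γ x)| ≤ 220 * z := by
    rw [abs_mul]
    refine (mul_le_of_le_one_right (abs_nonneg _) (Real.abs_sin_le_one _)).trans ?_
    rw [show m - V x = (lam - 1) * V x - (lam * V x - m) by ring]
    have e3 := hVabs x hx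
    have e4 : |(lam - 1) * V x| ≤ 40 * z * (11 / 10) := by
      rw [abs_mul]
      exact mul_le_mul hl40 (abs_le.2 ⟨by linarith, e3.2⟩) (abs_nonneg _) (by linarith)
    have := (abs_sub _ _).trans (add_le_add e4 (hVy x hx))
    linarith
  have t3 : |m * (Real.sin (γ x) - Real.sin (lam * γ x))| ≤ 130 * z := by
    have e1 : |Real.sin (γ x) - Real.sin (lam * γ x)| ≤ 40 * z * Real.pi := by
      refine (Real.abs_sin_sub_sin_le _ _).trans ?_
      rw [show γ x - lam * γ x = -((lam - 1) * γ x) by ring, abs_neg, abs_mul]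
      exact mul_le_mul hl40 (hγm x hx) (abs_nonneg _) (by linarith)
    rw [abs_mul]
    calc |m| * |Real.sin (γ x) - Real.sin (lam * γ x)| ≤ 1001 / 1000 * (40 * z * Real.pi) :=
          mul_le_mul (abs_le.2 ⟨by linarith, by linarith⟩) e1 (abs_nonneg _) (by norm_num)
      _ ≤ 130 * z := by
        have := mul_le_mul_of_nonneg_left hpi'.le hz0
        linarith
  rw [hBeq]
  have := (abs_add_three _ _ _).trans (add_le_add (add_le_add t1 t2) t3)
  linarith

/-! ### Normalisation, frequency and defect along the flow -/

namespace NearCos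

variable {f : ℝ → ℝ} {σ x₀ η : ℝ} {I X : Set ℝ}

theorem one_sub_eq (f : ℝ → ℝ) (x₀ η x : ℝ) :
    1 - η * f x = (1 - η * f x₀) + η * (f x₀ - f x) := by ring

theorem gap_pos (h : NearCos f σ x₀) (hA : Admissible f I X) (hη : η ∈ I) : 0 < 1 - η * f x₀ :=
  hA.pos η hη x₀ (hA.Icc_subset h.mem)

theorem weightMean_zero_eq (f : ℝ → ℝ) (η : ℝ) : weightMean f 0 η
    = (∫ x in (-Real.pi)..Real.pi, 1 / (1 - η * f x)) / (2 * Real.pi) := by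
  simp [weightMean, weightPrim, weight]

/-- Lower bound for the normalisation by comparison with the explicit integral. -/
theorem one_le_weightMean_sq (h : NearCos f σ x₀) (hA : Admissible f I X) (hη : η ∈ I)
    (hη0 : 0 ≤ η) : 1 ≤ weightMean f 0 η ^ 2 *
      ((1 - η * f x₀) * (1 - η * f x₀ + 2 * η * (1 + 18 * σ))) := by
  have hσ := h.nonneg
  have he := h.gap_pos hA hη
  have hK := hA.weightMean_pos hη
  set e := 1 - η * f x₀ with hedef
  have hk : 0 ≤ η * (1 + 18 * σ) := by positivity
  have hpi := Real.pi_pos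
  have h1 := integral_one_div_add_mul_one_sub_cos he hk x₀
  have hcpos : ∀ x, 0 < e + η * (1 + 18 * σ) * (1 - Real.cos (x - x₀)) := fun x => by
    have := Real.cos_le_one (x - x₀)
    have : 0 ≤ η * (1 + 18 * σ) * (1 - Real.cos (x - x₀)) := mul_nonneg hk (by linarith)
    linarith
  have h2 : 2 * Real.pi / √(e * (e + 2 * (η * (1 + 18 * σ))))
      ≤ ∫ x in (-Real.pi)..Real.pi, 1 / (1 - η * f x) := by
    rw [← h1]
    refine integral_mono_Icc (Continuous.continuousOn (continuous_const.div (by fun_prop)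
      fun x => (hcpos x).ne')) (continuousOn_const.div (continuousOn_const.sub
      (continuousOn_const.mul h.contDiff.continuous.continuousOn)) fun x hx =>
        (hA.pos η hη x (hA.Icc_subset hx)).ne') fun x hx => ?_
    refine one_div_le_one_div_of_le (hA.pos η hη x (hA.Icc_subset hx)) ?_
    rw [one_sub_eq f x₀, mul_assoc η]
    have := (h.gap_mem hx).2
    gcongr
  have hD : 0 < e * (e + 2 * (η * (1 + 18 * σ))) := by positivity
  have h3 : 1 ≤ weightMean f 0 η * √(e * (e + 2 * (η * (1 + 18 * σ)))) := by
    have hs := Real.sqrt_pos.2 hD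
    rw [weightMean_zero_eq, div_mul_eq_mul_div, le_div_iff₀ (by positivity), one_mul]
    rwa [div_le_iff₀ hs] at h2
  have h4 := pow_le_pow_left₀ zero_le_one h3 2
  rw [one_pow, mul_pow, Real.sq_sqrt hD.le] at h4
  rwa [show 2 * η * (1 + 18 * σ) = 2 * (η * (1 + 18 * σ)) by ring]

/-- Upper bound for the normalisation by comparison with the explicit integral. -/
theorem weightMean_sq_le_one (h : NearCos f σ x₀) (hA : Admissible f I X) (hη : η ∈ I)
    (hη0 : 0 ≤ η) : weightMean f 0 η ^ 2 *
      ((1 - η * f x₀) * (1 - η * f x₀ + 2 * η * (1 - 18 * σ))) ≤ 1 := by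
  have hσ := h.nonneg
  have hσ' := h.small
  have he := h.gap_pos hA hη
  have hK := hA.weightMean_pos hη
  set e := 1 - η * f x₀ with hedef
  have hk : 0 ≤ η * (1 - 18 * σ) := mul_nonneg hη0 (by linarith)
  have hpi := Real.pi_pos
  have h1 := integral_one_div_add_mul_one_sub_cos he hk x₀
  have hcpos : ∀ x, 0 < e + η * (1 - 18 * σ) * (1 - Real.cos (x - x₀)) := fun x => by
    have := Real.cos_le_one (x - x₀)
    have : 0 ≤ η * (1 - 18 * σ) * (1 - Real.cos (x - x₀)) := mul_nonneg hk (by linarith)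
    linarith
  have h2 : ∫ x in (-Real.pi)..Real.pi, 1 / (1 - η * f x)
      ≤ 2 * Real.pi / √(e * (e + 2 * (η * (1 - 18 * σ)))) := by
    rw [← h1]
    refine integral_mono_Icc (continuousOn_const.div (continuousOn_const.sub
      (continuousOn_const.mul h.contDiff.continuous.continuousOn)) fun x hx =>
        (hA.pos η hη x (hA.Icc_subset hx)).ne')
      (Continuous.continuousOn (continuous_const.div (by fun_prop)
      fun x => (hcpos x).ne')) fun x hx => ?_
    refine one_div_le_one_div_of_le (hcpos x) ?_
    rw [one_sub_eq f x₀, mul_assoc η]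
    have := (h.gap_mem hx).1
    gcongr
  have hD : 0 < e * (e + 2 * (η * (1 - 18 * σ))) := by positivity
  have h3 : weightMean f 0 η * √(e * (e + 2 * (η * (1 - 18 * σ)))) ≤ 1 := by
    have hs := Real.sqrt_pos.2 hD
    rw [weightMean_zero_eq, div_mul_eq_mul_div, div_le_iff₀ (by positivity), one_mul]
    rwa [le_div_iff₀ hs] at h2
  have h4 := pow_le_pow_left₀ (by positivity) h3 2
  rw [one_pow, mul_pow, Real.sq_sqrt hD.le] at h4
  rwa [show 2 * η * (1 - 18 * σ) = 2 * (η * (1 - 18 * σ)) by ring]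

/-- The oscillator frequency is close to one. -/
theorem abs_freq_sq_sub_one_le (h : NearCos f σ x₀) (hA : Admissible f I X) (hη : η ∈ I)
    (hη0 : 0 ≤ η) : |weightMean f 0 η ^ 2 * ((1 - η * f x₀) *
      (1 - η * f x₀ + 2 * η * (-deriv (deriv f) x₀))) - 1| ≤ 21 * σ := by
  have hσ := h.nonneg
  have hσ' := h.small
  have he := h.gap_pos hA hη
  have h1 := h.one_le_weightMean_sq hA hη hη0
  have h2 := h.weightMean_sq_le_one hA hη hη0
  have h3 := abs_le.1 h.abs_curvature_sub_one_le
  set e := 1 - η * f x₀ with hedef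
  set m := -deriv (deriv f) x₀ with hm
  set L := weightMean f 0 η ^ 2 * e with hL
  have hL0 : 0 ≤ L := by positivity
  rw [← mul_assoc] at h1 h2 ⊢
  rw [← hL] at h1 h2 ⊢
  -- Replacing `1 ± 18 * σ` by `m` costs at most `2 * (L * η) * 20 * σ`, and `2 * 0.51 * 20 < 21`.
  have hLη : L * η ≤ 51 / 100 := by
    have a1 : 0 ≤ L * e := by positivity
    have a2 : 0 ≤ L * η := by positivity
    nlinarith
  have hLη0 : 0 ≤ L * η := by positivity
  rw [abs_le]
  constructor
  · have : L * (e + 2 * η * m) - 1 ≥ 2 * (L * η) * (m - (1 + 18 * σ)) := by nlinarith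
    nlinarith
  · have : L * (e + 2 * η * m) - 1 ≤ 2 * (L * η) * (m - (1 - 18 * σ)) := by nlinarith
    nlinarith

/-- The first bound gives decay as the gap closes; the second is the uniform one, good for all `η`.
-/
theorem inv_weightMean_sq_le (h : NearCos f σ x₀) (hA : Admissible f I X) (hη : η ∈ I)
    (hη0 : 0 ≤ η) : (1 / weightMean f 0 η) ^ 2 ≤ 3 * (1 - η * f x₀) ∧
      (1 / weightMean f 0 η) ^ 2 ≤ (11 / 10) ^ 2 := by
  have hσ := h.nonneg
  have hσ' := h.small
  have he := h.gap_pos hA hη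
  have hK := hA.weightMean_pos hη
  have h1 := h.one_le_weightMean_sq hA hη hη0
  have h3 := abs_le.1 h.abs_max_sub_one_le
  have hηM : 999 / 1000 * η ≤ η * f x₀ := by nlinarith
  set e := 1 - η * f x₀ with hedef
  have hηe : η ≤ (1001 / 999) * (1 - e) := by nlinarith
  have he1 : e ≤ 1 := by nlinarith
  have hb : (1 / weightMean f 0 η) ^ 2 ≤ e * (e + 2 * η * (1 + 18 * σ)) := by
    rw [div_pow, one_pow, div_le_iff₀ (by positivity)]
    linarith
  have hc : e + 2 * η * (1 + 18 * σ) ≤ 21 / 10 - 11 / 10 * e := by nlinarith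
  have hd := mul_le_mul_of_nonneg_left hc he.le
  constructor <;> nlinarith

/-- The weighted first moment controlling the defects. -/
noncomputable def moment (f : ℝ → ℝ) (x₀ η : ℝ) : ℝ :=
  ∫ x in (-Real.pi)..Real.pi, |x - x₀| * (1 / (1 - η * f x) / weightMean f 0 η)

theorem continuousOn_density (h : NearCos f σ x₀) (hA : Admissible f I X) (hη : η ∈ I) :
    ContinuousOn (fun x => 1 / (1 - η * f x) / weightMean f 0 η) (Icc (-Real.pi) Real.pi) :=
  (continuousOn_const.div (continuousOn_const.sub (continuousOn_const.mul
    h.contDiff.continuous.continuousOn)) fun x hx =>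
    (hA.pos η hη x (hA.Icc_subset hx)).ne').div_const _

theorem integral_density (hA : Admissible f I X) (hη : η ∈ I) :
    ∫ x in (-Real.pi)..Real.pi, 1 / (1 - η * f x) / weightMean f 0 η = 2 * Real.pi := by
  have hK := hA.weightMean_pos hη
  rw [intervalIntegral.integral_div, div_eq_iff hK.ne', weightMean_zero_eq]
  have := Real.pi_pos
  field_simp

theorem density_nonneg (hA : Admissible f I X) (hη : η ∈ I) {x : ℝ}
    (hx : x ∈ Icc (-Real.pi) Real.pi) : 0 ≤ 1 / (1 - η * f x) / weightMean f 0 η := by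
  have := hA.weightMean_pos hη
  have := hA.pos η hη x (hA.Icc_subset hx)
  positivity

theorem moment_nonneg (hA : Admissible f I X) (hη : η ∈ I) : 0 ≤ moment f x₀ η :=
  intervalIntegral.integral_nonneg neg_pi_lt_pi.le fun _ hx =>
    mul_nonneg (abs_nonneg _) (density_nonneg hA hη hx)

/-- A crude uniform bound, which keeps the smallness parameter of the oscillator below `3 / 10000`
before any decay is known. -/
theorem moment_le_twenty (h : NearCos f σ x₀) (hA : Admissible f I X) (hη : η ∈ I) :
    moment f x₀ η ≤ 20 := by
  have hpi' := Real.pi_lt_d2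
  have hpi := Real.pi_pos
  have hc := h.continuousOn_density hA hη
  calc moment f x₀ η
      ≤ ∫ x in (-Real.pi)..Real.pi, (Real.pi + 1 / 50) *
          (1 / (1 - η * f x) / weightMean f 0 η) := by
        refine integral_mono_Icc (ContinuousOn.mul (by fun_prop) hc)
          (continuousOn_const.mul hc) fun x hx => ?_
        exact mul_le_mul_of_nonneg_right (h.abs_sub_max_le hx) (density_nonneg hA hη hx)
    _ = (Real.pi + 1 / 50) * (2 * Real.pi) := by
        rw [intervalIntegral.integral_const_mul, integral_density hA hη]
    _ ≤ 20 := by nlinarith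

/-- The defect of the oscillator equation along the flow. -/
noncomputable def defect (f : ℝ → ℝ) (x₀ η x : ℝ) : ℝ :=
  (deriv (deriv f) x - deriv (deriv f) x₀ - (f x₀ - f x))
    + η * (1 / (1 - η * f x)) *
      (deriv f x ^ 2 + 2 * deriv (deriv f) x₀ * (f x₀ - f x) + (f x₀ - f x) ^ 2)

/-- The quadratic relation fails only to third order at `x₀`. Since `1 - η f` is at least `η |x -
x₀| ^ 2 / 7`, dividing costs two of these powers, uniformly as the gap closes. -/
theorem abs_defect_le (h : NearCos f σ x₀) (hA : Admissible f I X) (hη : η ∈ I) (hη0 : 0 ≤ η)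
    {x : ℝ} (hx : x ∈ Icc (-Real.pi) Real.pi) : |defect f x₀ η x| ≤ 58 * σ * |x - x₀| := by
  have hq := hA.pos η hη x (hA.Icc_subset hx)
  have he := h.gap_pos hA hη
  have h1 := h.abs_linear_defect_le hx
  have h2 := h.abs_quadratic_defect_le hx
  have h3 := h.sq_le_gap hx
  have hσ := h.nonneg
  have h4 : η * (1 / (1 - η * f x)) * |x - x₀| ^ 2 ≤ 7 := by
    rw [mul_one_div, div_mul_eq_mul_div, div_le_iff₀ hq, one_sub_eq f x₀, sq_abs]
    nlinarith
  have h5 : 0 ≤ η * (1 / (1 - η * f x)) := by positivity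
  refine (abs_add_le _ _).trans ?_
  rw [abs_mul, abs_of_nonneg h5]
  calc _ ≤ 2 * σ * |x - x₀| + η * (1 / (1 - η * f x)) * (8 * σ * |x - x₀| ^ 3) := by gcongr
    _ = 2 * σ * |x - x₀| + (η * (1 / (1 - η * f x)) * |x - x₀| ^ 2) * (8 * σ * |x - x₀|) := by ring
    _ ≤ 2 * σ * |x - x₀| + 7 * (8 * σ * |x - x₀|) := by gcongr
    _ = _ := by ring

theorem neg_of_endpoint (h : NearCos f σ x₀) {x : ℝ} (hx : x ∈ Icc (-Real.pi) Real.pi)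
    (hc : Real.cos x = -1) : f x ≤ -1 / 2 := by
  have h1 := abs_le.1 (h.bound₀ x hx)
  have := h.small
  rw [hc] at h1
  linarith

/-- Pointwise `f ≤ f / (1 - η f) ^ 2` when `η ≥ 0`, and `f` has mean zero. This provides the sign of
the solution at `-π` needed to fix the sign of the amplitude. -/
theorem weightMean_one_nonneg (h : NearCos f σ x₀) (hA : Admissible f I X) (hη : η ∈ I)
    (hη0 : 0 ≤ η) : 0 ≤ weightMean f 1 η := by
  refine div_nonneg ?_ (by have := Real.pi_pos; positivity)
  rw [← h.mean]
  refine integral_mono_Icc h.contDiff.continuous.continuousOn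
    ((hA.continuousOn_weight 1 hη).mono hA.Icc_subset) fun x hx => ?_
  have hq := hA.pos η hη x (hA.Icc_subset hx)
  simp only [weight, pow_one]
  rw [le_div_iff₀ (by positivity)]
  have h1 : f x * (1 - η * f x) ^ (1 + 1)
      = f x - η * (f x ^ 2 * (1 + (1 - η * f x))) := by ring
  have h2 : 0 ≤ η * (f x ^ 2 * (1 + (1 - η * f x))) := by positivity
  linarith

end NearCos

namespace NearCos

variable {f : ℝ → ℝ} {σ x₀ η : ℝ} {I X : Set ℝ}

theorem inv_weightMean_le (h : NearCos f σ x₀) (hA : Admissible f I X) (hη : η ∈ I)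
    (hη0 : 0 ≤ η) : 1 / weightMean f 0 η ≤ 11 / 10 := by
  have hK := hA.weightMean_pos hη
  exact (pow_le_pow_iff_left₀ (by positivity) (by norm_num) two_ne_zero).1
    (h.inv_weightMean_sq_le hA hη hη0).2

/-- The slope of the solution along the flow is close to that of a cosine. -/
theorem abs_slope_add_le (h : NearCos f σ x₀) (hA : Admissible f I X) (hη : η ∈ I)
    (hη0 : 0 ≤ η) {x : ℝ} (hx : x ∈ Icc (-Real.pi) Real.pi) :
    |deriv f x / (1 - η * f x) / weightMean f 0 η
      + -deriv (deriv f) x₀ * Real.sin (flow f η x)|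
      ≤ 600 * (σ * (1 / weightMean f 0 η + moment f x₀ η)) := by
  have hσ := h.nonneg
  have hσ' := h.small
  have he := h.gap_pos hA hη
  have hK := hA.weightMean_pos hη
  have hpil : -Real.pi ∈ Icc (-Real.pi) Real.pi := ⟨le_rfl, neg_pi_lt_pi.le⟩
  have hpir : Real.pi ∈ Icc (-Real.pi) Real.pi := ⟨neg_pi_lt_pi.le, le_rfl⟩
  have hinv := h.inv_weightMean_le hA hη hη0
  have hmom0 : 0 ≤ moment f x₀ η := moment_nonneg hA hη
  have hmom := h.moment_le_twenty hA hη
  have hfr := h.abs_freq_sq_sub_one_le hA hη hη0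
  have hms := h.abs_curvature_sub_one_le
  have hms' := abs_le.1 hms
  have hwc := h.continuousOn_density hA hη
  have hpos : ∀ y ∈ Icc (-Real.pi) Real.pi, 0 < 1 - η * f y := fun y hy =>
    hA.pos η hη y (hA.Icc_subset hy)
  set K := weightMean f 0 η with hKdef
  set K₁ := weightMean f 1 η with hK₁def
  set m := -deriv (deriv f) x₀ with hm
  set ε := 1 - η * f x₀ with hε
  have hfreq0 : 0 ≤ ε * (ε + 2 * η * m) := by
    have : 0 ≤ m := by linarith
    positivity
  set lam := K * √(ε * (ε + 2 * η * m)) with hlam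
  have hlam0 : 0 ≤ lam := by positivity
  have hlam2 : lam ^ 2 = K ^ 2 * (ε * (ε + 2 * η * m)) := by
    rw [hlam, mul_pow, Real.sq_sqrt hfreq0]
  rw [← hlam2] at hfr
  have hlam1 : |lam - 1| ≤ 1 / 1000 := by
    have h1 : |lam - 1| ≤ |lam ^ 2 - 1| := by
      rw [show lam ^ 2 - 1 = (lam - 1) * (lam + 1) by ring, abs_mul,
        abs_of_nonneg (by linarith : 0 ≤ lam + 1)]
      exact le_mul_of_one_le_right (abs_nonneg _) (by linarith)
    linarith
  -- At `±π` the sine vanishes, so `|f'| ≤ σ`; there `f` is negative, so the factor `1 / (1 - η f)`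
  -- does not amplify.
  have hend : ∀ y ∈ Icc (-Real.pi) Real.pi, Real.cos y = -1 → Real.sin y = 0 →
      0 ≤ 1 / (1 - η * f y) ∧ 1 / (1 - η * f y) ≤ 1 ∧
        |deriv f y / (1 - η * f y) / K| ≤ σ * (1 / K + moment f x₀ η) := by
    intro y hy hcy hsy
    have hfy := h.neg_of_endpoint hy hcy
    have hq := hpos y hy
    have hq1 : 1 / (1 - η * f y) ≤ 1 := by
      rw [div_le_one hq]; nlinarith
    have hd := h.bound₁ y hy
    rw [hsy, add_zero] at hd
    refine ⟨by positivity, hq1, ?_⟩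
    rw [show deriv f y / (1 - η * f y) / K = deriv f y * (1 / (1 - η * f y)) * (1 / K) by
      field_simp, abs_mul, abs_mul, abs_of_pos (by positivity : 0 < 1 / (1 - η * f y)),
      abs_of_pos (by positivity : 0 < 1 / K)]
    calc |deriv f y| * (1 / (1 - η * f y)) * (1 / K) ≤ σ * 1 * (1 / K) := by gcongr
      _ ≤ σ * (1 / K + moment f x₀ η) := by
        rw [mul_one]; gcongr; linarith
  obtain ⟨hl0, hl1, hl2⟩ := hend _ hpil (by simp) (by simp)
  obtain ⟨hr0, hr1, hr2⟩ := hend _ hpir (by simp) (by simp)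
  -- With `g = f x₀ - f`, the idealised second derivative is `-m + (ε + 2 * η * m) * g / (1 - η f)`.
  -- As `g / (1 - η f)` is affine in `f / (1 - η f)`, it is affine in `lagr`; `α` and `lam ^ 2` are
  -- the resulting coefficients.
  refine oscillator_stability (γ := flow f η) (A := lagr f η)
    (B := fun x => deriv f x / (1 - η * f x) / K) (w := fun x => 1 / (1 - η * f x) / K)
    (E := defect f x₀ η) (e := fun x => 58 * σ * |x - x₀|)
    (α := m - 2 * m * ε + ε * f x₀ - ε * (ε + 2 * η * m) * (K₁ / K)) (lam := lam) (m := m)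
    (z := σ * (1 / K + moment f x₀ η)) (x₀ := x₀)
    (fun x hx => hA.hasDerivAt_flow_right hη (hA.Icc_subset hx)) (fun x hx => ?_)
    (fun x hx => ?_) hwc ?_ (by fun_prop) (fun x hx => density_nonneg hA hη hx)
    (integral_density hA hη) (fun x hx => h.abs_defect_le hA hη hη0 hx) ?_ ?_
    (Admissible.flow_neg_pi f η) (hA.flow_pi hη) (fun x hx => abs_le.2 (hA.flow_mem hη hx))
    hl2 hr2 ?_ ?_ h.mem ?_ ?_ (by linarith) hlam1 ?_ hx
  · refine (hA.hasDerivAt_lagr_right hη (hA.Icc_subset hx)).congr_deriv ?_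
    have := (hpos x hx).ne'
    rw [← hKdef]
    field_simp
  · have hq := (hpos x hx).ne'
    have h1 := (((h.hasDerivAt₁ x).fun_div (((h.hasDerivAt₀ x).const_mul η).const_sub 1)
      hq).div_const K)
    refine h1.congr_deriv ?_
    rw [hlam2, lagr, defect, ← hKdef, ← hK₁def]
    have e1 : deriv (deriv f) x₀ = -m := by rw [hm]; ring
    have e2 : f x₀ * η = 1 - ε := by rw [hε]; ring
    rw [e1]
    have hK' := hK.ne'
    field_simp
    -- For `η ≠ 0` the value `f x₀` is eliminated through `ε`, which is impossible at `η = 0`.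
    rcases eq_or_ne η 0 with h0 | h0
    · have e3 : ε = 1 := by rw [hε, h0]; ring
      rw [h0, e3]
      ring
    · have e3 : f x₀ = (1 - ε) / η := by rw [← e2]; field_simp
      rw [e3]
      field_simp
      ring
  · have hf := h.contDiff.continuous.continuousOn (s := Icc (-Real.pi) Real.pi)
    have hf1 := h.contDiff_deriv.continuous.continuousOn (s := Icc (-Real.pi) Real.pi)
    have hf2 := h.contDiff_deriv₂.continuous.continuousOn (s := Icc (-Real.pi) Real.pi)
    have hq : ContinuousOn (fun x => 1 / (1 - η * f x)) (Icc (-Real.pi) Real.pi) :=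
      continuousOn_const.div (by fun_prop) fun y hy => (hpos y hy).ne'
    unfold defect
    fun_prop
  · have : ∫ x in (-Real.pi)..Real.pi, 58 * σ * |x - x₀| * (1 / (1 - η * f x) / K)
        = 58 * σ * moment f x₀ η := by
      rw [moment, ← intervalIntegral.integral_const_mul]
      congr 1; ext x; ring
    rw [this]
    have : 0 ≤ σ * (1 / K) := by positivity
    nlinarith
  · have h1 := hA.integral_sol hη hpir
    have h2 := hA.integral_comp_sol hη hpir (G := id) continuous_id
    simp only [id] at h2
    rw [← h2, h1, ← hKdef, ← hK₁def]
    have e0 : weightPrim f 0 η Real.pi = 2 * Real.pi * K := by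
      rw [hKdef, weightMean]; field_simp
    have e1 : weightPrim f 1 η Real.pi = 2 * Real.pi * K₁ := by
      rw [hK₁def, weightMean]; field_simp
    rw [e0, e1]
    field_simp
    ring
  · have h1 := abs_le.1 (h.bound₀ _ hpil)
    have h2 := abs_le.1 (h.bound₀ _ hpir)
    simp only [Real.cos_neg, Real.cos_pi] at h1 h2
    have ql := (hpos _ hpil).ne'
    have qr := (hpos _ hpir).ne'
    have e : lagr f η Real.pi - lagr f η (-Real.pi) = (f Real.pi - f (-Real.pi))
        * ((1 / (1 - η * f Real.pi)) * (1 / (1 - η * f (-Real.pi)))) * (1 / K) * (1 / K) := by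
      simp only [lagr, ← hKdef]
      generalize hDl : 1 - η * f (-Real.pi) = Dl at *
      generalize hDr : 1 - η * f Real.pi = Dr at *
      field_simp
      rw [← hDl, ← hDr]
      ring
    rw [e, abs_mul, abs_mul, abs_mul, abs_of_pos (by positivity : 0 < 1 / K),
      abs_of_nonneg (mul_nonneg hr0 hl0)]
    have e1 : |f Real.pi - f (-Real.pi)| ≤ 2 * σ := by
      rw [abs_le]; constructor <;> linarith
    have e2 := mul_le_one₀ hr1 hl0 hl1
    calc |f Real.pi - f (-Real.pi)| * ((1 / (1 - η * f Real.pi)) * (1 / (1 - η * f (-Real.pi))))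
          * (1 / K) * (1 / K) ≤ 2 * σ * 1 * (1 / K) * (11 / 10) := by gcongr
      _ ≤ 3 * (σ * (1 / K + moment f x₀ η)) := by
        have a1 : 0 ≤ σ * (1 / K) := by positivity
        have a2 : 0 ≤ σ * moment f x₀ η := by positivity
        nlinarith
  · have hfl := h.neg_of_endpoint hpil (by simp)
    have ql := hpos _ hpil
    have hK₁ := h.weightMean_one_nonneg hA hη hη0
    have e1 : f (-Real.pi) / (1 - η * f (-Real.pi)) / K ^ 2 ≤ 0 :=
      div_nonpos_of_nonpos_of_nonneg (div_nonpos_of_nonpos_of_nonneg (by linarith) ql.le)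
        (by positivity)
    have e2 : 0 ≤ K₁ / K ^ 3 := by positivity
    simp only [lagr, ← hKdef, ← hK₁def]
    linarith
  · simp [h.deriv_max]
  · rw [hlam2, lagr, ← hKdef, ← hK₁def, ← hε]
    have hK' := hK.ne'
    have he' := he.ne'
    have e2 : η * f x₀ = 1 - ε := by rw [hε]; ring
    field_simp
    linear_combination (2 * m * K) * e2
  · nlinarith

end NearCos

/-! ### Decay of the defect and range of the clock -/

namespace NearCos

variable {f : ℝ → ℝ} {σ x₀ η : ℝ} {I X : Set ℝ}

theorem gap_le_one (h : NearCos f σ x₀) (hη0 : 0 ≤ η) : 1 - η * f x₀ ≤ 1 := by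
  have h1 := abs_le.1 h.abs_max_sub_one_le
  have := h.small
  nlinarith

theorem sq_dist_le (h : NearCos f σ x₀) {x : ℝ} (hx : x ∈ Icc (-Real.pi) Real.pi) :
    (x - x₀) ^ 2 ≤ 11 := by
  have h1 := h.abs_sub_max_le hx
  have hpi := Real.pi_lt_d2
  rw [← sq_abs]
  nlinarith [abs_nonneg (x - x₀)]

/-- Write `r = (x - x₀) ^ 2` as `ε r + (1 - ε) r`: the first piece is at most `11 ε`, and in the
second `1 - ε` is at most about `η`, so the gap estimate applies. Hence the bound holds uniformly,
down to `η = 0`. -/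
theorem one_div_le (h : NearCos f σ x₀) (hA : Admissible f I X) (hη : η ∈ I) (hη0 : 0 ≤ η)
    {x : ℝ} (hx : x ∈ Icc (-Real.pi) Real.pi) :
    1 / (1 - η * f x) ≤ 22 / (1 - η * f x₀ + (x - x₀) ^ 2) := by
  have he := h.gap_pos hA hη
  have he1 := h.gap_le_one hη0
  have hq := hA.pos η hη x (hA.Icc_subset hx)
  have h1 := h.sq_le_gap hx
  have h2 := h.sq_dist_le hx
  have h3 := abs_le.1 h.abs_max_sub_one_le
  have h4 := h.small
  have h5 : 1 - (1 - η * f x₀) ≤ η * (1001 / 1000) := by nlinarith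
  have h6 := mul_le_mul_of_nonneg_left h1 hη0
  rw [div_le_div_iff₀ hq (by positivity), one_mul]
  rw [one_sub_eq f x₀ η x]
  set e := 1 - η * f x₀
  set r := (x - x₀) ^ 2
  have hr : 0 ≤ r := sq_nonneg _
  have h7 := mul_le_mul_of_nonneg_right h5 hr
  have h8 := mul_le_mul_of_nonneg_left h2 he.le
  nlinarith

theorem integral_dist_div {e : ℝ} (he : 0 < e) (a b x₀ : ℝ) :
    ∫ x in a..b, 22 * ((x - x₀) / (e + (x - x₀) ^ 2))
      = 11 * (Real.log (e + (b - x₀) ^ 2) - Real.log (e + (a - x₀) ^ 2)) := by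
  have hpos : ∀ x, 0 < e + (x - x₀) ^ 2 := fun x => by positivity
  have hder : ∀ x, HasDerivAt (fun x => 11 * Real.log (e + (x - x₀) ^ 2))
      (22 * ((x - x₀) / (e + (x - x₀) ^ 2))) x := by
    intro x
    have h1 : HasDerivAt (fun x => e + (x - x₀) ^ 2) (2 * (x - x₀)) x := by
      simpa using (((hasDerivAt_id x).sub_const x₀).fun_pow 2).const_add e
    refine ((h1.log (hpos x).ne').const_mul 11).congr_deriv ?_
    ring
  have hc : Continuous fun x => 22 * ((x - x₀) / (e + (x - x₀) ^ 2)) :=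
    continuous_const.mul (Continuous.div (by fun_prop) (by fun_prop) fun x => (hpos x).ne')
  rw [intervalIntegral.integral_eq_sub_of_hasDerivAt (fun x _ => hder x)
    (hc.intervalIntegrable _ _)]
  ring

/-- The density is dominated by a Cauchy kernel of width `√ε`. Its first absolute moment is an
explicit logarithm on each side of `x₀`. -/
theorem moment_le_log (h : NearCos f σ x₀) (hA : Admissible f I X) (hη : η ∈ I)
    (hη0 : 0 ≤ η) :
    moment f x₀ η ≤ 1 / weightMean f 0 η * (22 * Real.log (12 / (1 - η * f x₀))) := by
  have he := h.gap_pos hA hη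
  have he1 := h.gap_le_one hη0
  have hK := hA.weightMean_pos hη
  set e := 1 - η * f x₀ with hedef
  have hpil : -Real.pi ∈ Icc (-Real.pi) Real.pi := ⟨le_rfl, neg_pi_lt_pi.le⟩
  have hpir : Real.pi ∈ Icc (-Real.pi) Real.pi := ⟨neg_pi_lt_pi.le, le_rfl⟩
  have hpos : ∀ x, 0 < e + (x - x₀) ^ 2 := fun x => by positivity
  have hc : Continuous fun x => |x - x₀| * (22 / (e + (x - x₀) ^ 2)) :=
    Continuous.mul (by fun_prop) (continuous_const.div (by fun_prop) fun x => (hpos x).ne')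
  have hlog : ∀ x ∈ Icc (-Real.pi) Real.pi,
      Real.log (e + (x - x₀) ^ 2) - Real.log e ≤ Real.log (12 / e) := by
    intro x hx
    rw [Real.log_div (by norm_num) he.ne']
    have := Real.log_le_log (hpos x) (by linarith [h.sq_dist_le hx] : e + (x - x₀) ^ 2 ≤ 12)
    linarith
  have hint : ∫ x in (-Real.pi)..Real.pi, |x - x₀| * (22 / (e + (x - x₀) ^ 2))
      ≤ 22 * Real.log (12 / e) := by
    rw [← intervalIntegral.integral_add_adjacent_intervals (b := x₀)
      (hc.intervalIntegrable _ _) (hc.intervalIntegrable _ _)]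
    have e1 : ∫ x in (-Real.pi)..x₀, |x - x₀| * (22 / (e + (x - x₀) ^ 2))
        = -∫ x in (-Real.pi)..x₀, 22 * ((x - x₀) / (e + (x - x₀) ^ 2)) := by
      rw [← intervalIntegral.integral_neg]
      refine intervalIntegral.integral_congr fun x hx => ?_
      rw [uIcc_of_le h.mem.1] at hx
      simp only [abs_of_nonpos (by linarith [hx.2] : x - x₀ ≤ 0)]
      ring
    have e2 : ∫ x in x₀..Real.pi, |x - x₀| * (22 / (e + (x - x₀) ^ 2))
        = ∫ x in x₀..Real.pi, 22 * ((x - x₀) / (e + (x - x₀) ^ 2)) := by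
      refine intervalIntegral.integral_congr fun x hx => ?_
      rw [uIcc_of_le h.mem.2] at hx
      simp only [abs_of_nonneg (by linarith [hx.1] : 0 ≤ x - x₀)]
      ring
    rw [e1, e2, integral_dist_div he, integral_dist_div he]
    have a1 := hlog _ hpil
    have a2 := hlog _ hpir
    simp only [sub_self, ne_eq, OfNat.ofNat_ne_zero, not_false_eq_true, zero_pow, add_zero]
    linarith
  have hd := h.continuousOn_density hA hη
  calc moment f x₀ η
      ≤ ∫ x in (-Real.pi)..Real.pi, (1 / weightMean f 0 η) *
          (|x - x₀| * (22 / (e + (x - x₀) ^ 2))) := by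
        refine integral_mono_Icc (ContinuousOn.mul (by fun_prop) hd)
          (continuous_const.mul hc).continuousOn fun x hx => ?_
        have := h.one_div_le hA hη hη0 hx
        calc |x - x₀| * (1 / (1 - η * f x) / weightMean f 0 η)
            ≤ |x - x₀| * (22 / (e + (x - x₀) ^ 2) / weightMean f 0 η) := by gcongr
          _ = _ := by ring
    _ ≤ _ := by
        rw [intervalIntegral.integral_const_mul]
        gcongr

/-- Exponential bound for the total size of the defects, given the decay of the gap. -/
theorem inv_add_moment_le (h : NearCos f σ x₀) (hA : Admissible f I X) (hη : η ∈ I)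
    (hη0 : 0 ≤ η) {T : ℝ} (hT : 1 - η * f x₀ ≤ 2 * Real.exp (-(3 / 2 * T))) :
    1 / weightMean f 0 η + moment f x₀ η ≤ 1056 * Real.exp (-T / 2) := by
  have he := h.gap_pos hA hη
  have he1 := h.gap_le_one hη0
  have hK := hA.weightMean_pos hη
  have h1 := h.moment_le_log hA hη hη0
  have h2 := (h.inv_weightMean_sq_le hA hη hη0).1
  set e := 1 - η * f x₀ with hedef
  -- In this variable `1 / K` decays like `exp (-3y)`, the logarithm costs one factor `exp y`, and
  -- `T ≤ 4 * y`; so `exp (-2y)` is what the claim needs.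
  obtain ⟨y, hy⟩ : ∃ y, Real.log (12 / e) = 6 * y := ⟨Real.log (12 / e) / 6, by ring⟩
  have hexp : 12 / e = Real.exp (6 * y) := by rw [← hy, Real.exp_log (by positivity)]
  have he6 : e = 12 * Real.exp (-(6 * y)) := by
    rw [Real.exp_neg, ← hexp]; field_simp
  have hyT : T / 4 ≤ y := by
    have : Real.exp (3 / 2 * T) ≤ Real.exp (6 * y) := by
      rw [← hexp, le_div_iff₀ he]
      calc Real.exp (3 / 2 * T) * e ≤ Real.exp (3 / 2 * T) * (2 * Real.exp (-(3 / 2 * T))) := by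
            gcongr
        _ = 2 := by rw [Real.exp_neg]; field_simp
        _ ≤ 12 := by norm_num
    linarith [Real.exp_le_exp.1 this]
  have hinv : 1 / weightMean f 0 η ≤ 6 * Real.exp (-(3 * y)) := by
    refine (pow_le_pow_iff_left₀ (by positivity) (by positivity) two_ne_zero).1 (h2.trans ?_)
    rw [he6, mul_pow, ← Real.exp_nat_mul]
    have : Real.exp (-(6 * y)) = Real.exp ((2 : ℕ) * -(3 * y)) := by congr 1; push_cast; ring
    rw [this]
    have := Real.exp_pos ((2 : ℕ) * -(3 * y))
    linarith
  have hone : 1 + 22 * (6 * y) ≤ 132 * Real.exp y := by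
    have := Real.add_one_le_exp y
    linarith
  rw [hy] at h1
  calc 1 / weightMean f 0 η + moment f x₀ η
      ≤ 1 / weightMean f 0 η * (1 + 22 * (6 * y)) := by linarith
    _ ≤ 1 / weightMean f 0 η * (132 * Real.exp y) := by gcongr
    _ ≤ 6 * Real.exp (-(3 * y)) * (132 * Real.exp y) := by gcongr
    _ = 792 * Real.exp (-(2 * y)) := by
        rw [show -(2 * y) = -(3 * y) + y by ring, Real.exp_add]; ring
    _ ≤ 1056 * Real.exp (-T / 2) := by
        have : Real.exp (-(2 * y)) ≤ Real.exp (-T / 2) := Real.exp_le_exp.2 (by linarith)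
        have := Real.exp_pos (-(2 * y))
        linarith

theorem Icc_subset_left (hA : Admissible f I X) (hη : η ∈ I) : Icc 0 η ⊆ I :=
  hA.ordConnected_left.out hA.zero_mem hη

/-- The gap decays exponentially in the physical time. -/
theorem gap_le_exp (h : NearCos f σ x₀) (hA : Admissible f I X) (hη : η ∈ I) (hη0 : 0 ≤ η) :
    1 - η * f x₀ ≤ 2 * Real.exp (-(3 / 2 * clock f η)) := by
  have hM := abs_le.1 h.abs_max_sub_one_le
  have hσ := h.nonneg
  have hσ' := h.small
  have hsub := Icc_subset_left hA hη
  -- For `f = cos` the clock is `1/2 * log ((1 + s) / (1 - s))`. The factor `2 / 3` in its place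
  -- leaves room for the perturbation, at the price of the rate `3 / 2` instead of `2`.
  have hder : ∀ s ∈ Icc 0 η, HasDerivAt
      (fun s => 2 / 3 * (Real.log (1 + s * f x₀) - Real.log (1 - s * f x₀)) - clock f s)
      (2 / 3 * (f x₀ / (1 + s * f x₀) - -f x₀ / (1 - s * f x₀)) - weightMean f 0 s ^ 2) s := by
    intro s hs
    have e1 : HasDerivAt (fun s => 1 + s * f x₀) (f x₀) s := by
      simpa using ((hasDerivAt_id s).mul_const (f x₀)).const_add 1
    have e2 : HasDerivAt (fun s => 1 - s * f x₀) (-f x₀) s := by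
      simpa using ((hasDerivAt_id s).mul_const (f x₀)).const_sub 1
    have p1 : 0 < 1 + s * f x₀ := by nlinarith [hs.1]
    exact (((e1.log p1.ne').fun_sub (e2.log (h.gap_pos hA (hsub hs)).ne')).const_mul
      (2 / 3)).fun_sub (hA.hasDerivAt_clock (hsub hs))
  have hmono : MonotoneOn (fun s => 2 / 3 * (Real.log (1 + s * f x₀) - Real.log (1 - s * f x₀))
      - clock f s) (Icc 0 η) := by
    refine monotoneOn_of_deriv_nonneg (convex_Icc 0 η)
      (fun s hs => (hder s hs).continuousAt.continuousWithinAt)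
      (fun s hs => (hder s (interior_subset hs)).differentiableAt.differentiableWithinAt)
      fun s hs => ?_
    have hs' := interior_subset hs
    rw [(hder s hs').deriv, sub_nonneg]
    have hg := h.gap_pos hA (hsub hs')
    have hs0 := hs'.1
    have p1 : 0 < 1 + s * f x₀ := by nlinarith
    have hup := h.weightMean_sq_le_one hA (hsub hs') hs0
    have hden : 0 < 1 - s * f x₀ + 2 * s * (1 - 18 * σ) := by
      have : 0 ≤ 2 * s * (1 - 18 * σ) := mul_nonneg (by linarith) (by linarith)
      linarith
    have h1 : weightMean f 0 s ^ 2 ≤ 1 / ((1 - s * f x₀) * (1 - s * f x₀ + 2 * s * (1 - 18 * σ))) := by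
      rwa [le_div_iff₀ (by positivity)]
    refine h1.trans ?_
    have h2 : 2 / 3 * (f x₀ / (1 + s * f x₀) - -f x₀ / (1 - s * f x₀))
        = (4 / 3 * f x₀) / ((1 - s * f x₀) * (1 + s * f x₀)) := by
      generalize hD : 1 - s * f x₀ = D at *
      generalize hE : 1 + s * f x₀ = E at *
      field_simp
      rw [← hD, ← hE]
      ring
    rw [h2, div_le_div_iff₀ (by positivity) (by positivity)]
    have h3 : 1 + s * f x₀ ≤ 4 / 3 * f x₀ * (1 - s * f x₀ + 2 * s * (1 - 18 * σ)) := by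
      have a1 : s * (9 / 10) ≤ 1 - s * f x₀ + 2 * s * (1 - 18 * σ) - 1 := by nlinarith
      nlinarith
    nlinarith
  have h0 := hmono (left_mem_Icc.2 hη0) (right_mem_Icc.2 hη0) hη0
  have hc0 : clock f 0 = 0 := intervalIntegral.integral_same
  simp only [zero_mul, add_zero, sub_zero, Real.log_one, hc0, mul_zero] at h0
  have hg := h.gap_pos hA hη
  have hg1 := h.gap_le_one hη0
  have hl : Real.log (1 + η * f x₀) ≤ Real.log 2 :=
    Real.log_le_log (by nlinarith) (by linarith)
  have : Real.log (1 - η * f x₀) ≤ Real.log (2 * Real.exp (-(3 / 2 * clock f η))) := by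
    rw [Real.log_mul (by norm_num) (Real.exp_pos _).ne', Real.log_exp]
    linarith
  exact (Real.log_le_log_iff hg (by positivity)).1 this

/-- The physical time grows at least logarithmically in the gap. -/
theorem neg_log_gap_le_clock (h : NearCos f σ x₀) (hA : Admissible f I X) (hη : η ∈ I)
    (hη0 : 0 ≤ η) : -(1 / 4 * Real.log (1 - η * f x₀)) ≤ clock f η := by
  have hM := abs_le.1 h.abs_max_sub_one_le
  have hσ := h.nonneg
  have hσ' := h.small
  have hsub := Icc_subset_left hA hη
  have hder : ∀ s ∈ Icc 0 η, HasDerivAt (fun s => clock f s + 1 / 4 * Real.log (1 - s * f x₀))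
      (weightMean f 0 s ^ 2 + 1 / 4 * (-f x₀ / (1 - s * f x₀))) s := by
    intro s hs
    have e2 : HasDerivAt (fun s => 1 - s * f x₀) (-f x₀) s := by
      simpa using ((hasDerivAt_id s).mul_const (f x₀)).const_sub 1
    exact (hA.hasDerivAt_clock (hsub hs)).fun_add
      ((e2.log (h.gap_pos hA (hsub hs)).ne').const_mul (1 / 4))
  -- Here `K² ε ≥ 10 / 32`, which exceeds `f x₀ / 4`.
  have hmono : MonotoneOn (fun s => clock f s + 1 / 4 * Real.log (1 - s * f x₀)) (Icc 0 η) := by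
    refine monotoneOn_of_deriv_nonneg (convex_Icc 0 η)
      (fun s hs => (hder s hs).continuousAt.continuousWithinAt)
      (fun s hs => (hder s (interior_subset hs)).differentiableAt.differentiableWithinAt)
      fun s hs => ?_
    have hs' := interior_subset hs
    rw [(hder s hs').deriv]
    have hg := h.gap_pos hA (hsub hs')
    have hg1 := h.gap_le_one hs'.1
    have hs0 := hs'.1
    have hlow := h.one_le_weightMean_sq hA (hsub hs') hs0
    have hs2 : s ≤ 101 / 100 := by nlinarith
    set e := 1 - s * f x₀ with he
    have hb : e + 2 * s * (1 + 18 * σ) ≤ 32 / 10 := by nlinarith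
    have hK2 : 0 ≤ weightMean f 0 s ^ 2 * e := by positivity
    have h1 : 1 ≤ weightMean f 0 s ^ 2 * e * (32 / 10) := by
      have := mul_le_mul_of_nonneg_left hb hK2
      linarith
    have h2 : weightMean f 0 s ^ 2 + 1 / 4 * (-f x₀ / e)
        = (weightMean f 0 s ^ 2 * e - f x₀ / 4) / e := by
      field_simp
      ring
    rw [h2]
    exact div_nonneg (by linarith) hg.le
  have h0 := hmono (left_mem_Icc.2 hη0) (right_mem_Icc.2 hη0) hη0
  have hc0 : clock f 0 = 0 := intervalIntegral.integral_same
  simp only [zero_mul, sub_zero, Real.log_one, hc0, mul_zero, add_zero] at h0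
  linarith

theorem max_pos (h : NearCos f σ x₀) : 0 < f x₀ := by
  have hM := abs_le.1 h.abs_max_sub_one_le
  have := h.small
  linarith

theorem exists_clock_eq (h : NearCos f σ x₀) (hA : Admissible f I X)
    (hI : Ico 0 (1 / f x₀) ⊆ I) {t : ℝ} (ht : 0 ≤ t) : ∃ η ∈ I, 0 ≤ η ∧ clock f η = t := by
  have hM := h.max_pos
  -- At this `b` the gap is `exp (-4t)`, so the logarithmic lower bound gives `clock f b ≥ t`.
  set b := (1 - Real.exp (-(4 * t))) / f x₀ with hb
  have hexp1 : Real.exp (-(4 * t)) ≤ 1 := Real.exp_le_one_iff.2 (by linarith)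
  have hb0 : 0 ≤ b := div_nonneg (by linarith) hM.le
  have hbI : b ∈ I := hI ⟨hb0, by
    rw [hb]; gcongr; linarith [Real.exp_pos (-(4 * t))]⟩
  have hlow := h.neg_log_gap_le_clock hA hbI hb0
  have hgap : 1 - b * f x₀ = Real.exp (-(4 * t)) := by rw [hb]; field_simp; ring
  rw [hgap, Real.log_exp] at hlow
  have hsub := Icc_subset_left hA hbI
  have hc0 : clock f 0 = 0 := intervalIntegral.integral_same
  obtain ⟨η, hη, he⟩ := intermediate_value_Icc hb0
    (hA.contDiffOn_clock.continuousOn.mono hsub) (⟨by rw [hc0]; exact ht, by linarith⟩ :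
      t ∈ Icc (clock f 0) (clock f b))
  exact ⟨η, hsub hη, hη.1, he⟩

theorem exists_admissible (h : NearCos f σ x₀) :
    ∃ I X : Set ℝ, Admissible f I X ∧ Ico 0 (1 / f x₀) ⊆ I := by
  have hM := h.max_pos
  have hM' := abs_le.1 h.abs_max_sub_one_le
  have hσ' := h.small
  have hpi := Real.pi_pos
  have hpil : -Real.pi ∈ Icc (-Real.pi) Real.pi := ⟨le_rfl, neg_pi_lt_pi.le⟩
  have hpir : Real.pi ∈ Icc (-Real.pi) Real.pi := ⟨neg_pi_lt_pi.le, le_rfl⟩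
  have hopen : IsOpen {x | -(3 / 2) < f x ∧ f x < 0} :=
    (isOpen_lt continuous_const h.contDiff.continuous).inter
      (isOpen_lt h.contDiff.continuous continuous_const)
  have hl : -Real.pi ∈ {x | -(3 / 2) < f x ∧ f x < 0} := by
    have := abs_le.1 (h.bound₀ _ hpil)
    simp only [Real.cos_neg, Real.cos_pi] at this
    constructor <;> linarith
  have hr : Real.pi ∈ {x | -(3 / 2) < f x ∧ f x < 0} := by
    have := abs_le.1 (h.bound₀ _ hpir)
    simp only [Real.cos_pi] at this
    constructor <;> linarith
  obtain ⟨r₁, hr₁, hb₁⟩ := Metric.isOpen_iff.1 hopen _ hl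
  obtain ⟨r₂, hr₂, hb₂⟩ := Metric.isOpen_iff.1 hopen _ hr
  have hfX : ∀ x ∈ Ioo (-Real.pi - r₁) (Real.pi + r₂), -(3 / 2) < f x ∧ f x ≤ f x₀ := by
    intro x hx
    rcases lt_or_ge x (-Real.pi) with h1 | h1
    · have := hb₁ (by rw [Metric.mem_ball, Real.dist_eq, abs_lt]; constructor <;> linarith [hx.1] :
        x ∈ Metric.ball (-Real.pi) r₁)
      exact ⟨this.1, by linarith [this.2]⟩
    rcases lt_or_ge Real.pi x with h2 | h2
    · have := hb₂ (by rw [Metric.mem_ball, Real.dist_eq, abs_lt]; constructor <;> linarith [hx.2] :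
        x ∈ Metric.ball Real.pi r₂)
      exact ⟨this.1, by linarith [this.2]⟩
    · have h3 := abs_le.1 (h.bound₀ x ⟨h1, h2⟩)
      exact ⟨by linarith [Real.neg_one_le_cos x], h.le_max x ⟨h1, h2⟩⟩
  -- Open collars make `t = 0` and `x = ±π` interior. For `η ≥ 0` positivity uses `f ≤ f x₀`; for
  -- `η` above `-1/2` it uses `f > -3/2`.
  refine ⟨Ioo (-(1 / 2)) (1 / f x₀), Ioo (-Real.pi - r₁) (Real.pi + r₂),
    ⟨h.contDiff, isOpen_Ioo, isOpen_Ioo, ordConnected_Ioo, ordConnected_Ioo,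
      ⟨by norm_num, by positivity⟩, ⟨by linarith, by linarith⟩, ⟨by linarith, by linarith⟩, ?_⟩,
    fun x hx => ⟨by linarith [hx.1], hx.2⟩⟩
  intro η hη x hx
  obtain ⟨h1, h2⟩ := hfX x hx
  rcases le_total 0 η with h0 | h0
  · have h3 : η * f x₀ < 1 := by
      have := hη.2
      rwa [lt_div_iff₀ hM] at this
    nlinarith
  · have := hη.1
    nlinarith

/-- Global existence and convergence of the slope, for data near `cos`. -/
theorem exists_solution (h : NearCos f σ x₀) :
    ∃ a : ℝ → ℝ → ℝ, IsGlobalC3Solution f a ∧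
      ∀ t, 0 ≤ t → ∀ y ∈ Icc (-Real.pi) Real.pi, ∃ a' : ℝ, HasDerivAt (a t) a' y ∧
        |a' + -deriv (deriv f) x₀ * Real.sin y| ≤ 633600 * σ * Real.exp (-t / 2) := by
  obtain ⟨I, X, hA, hI⟩ := h.exists_admissible
  refine ⟨sol f I X, hA.isGlobalC3Solution_sol h.mean fun t ht => ?_, fun t ht y hy => ?_⟩
  · obtain ⟨η, hη, -, he⟩ := h.exists_clock_eq hA hI ht
    exact ⟨η, hη, he⟩
  · obtain ⟨η, hη, hη0, rfl⟩ := h.exists_clock_eq hA hI ht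
    obtain ⟨x, hx, rfl⟩ := hA.exists_flow_eq hη hy
    refine ⟨_, hA.hasDerivAt_sol_right hη (hA.Icc_subset hx), ?_⟩
    refine (h.abs_slope_add_le hA hη hη0 hx).trans ?_
    have := h.inv_add_moment_le hA hη hη0 (h.gap_le_exp hA hη hη0)
    have := mul_le_mul_of_nonneg_left this h.nonneg
    linarith

end NearCos

/-! ### Norms, scaling and conclusion -/

theorem bddAbove_iteratedDerivWithin {k j : ℕ} {f : ℝ → ℝ}
    (hf : ContDiffOn ℝ k f (Icc (-Real.pi) Real.pi)) (hj : j ≤ k) :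
    BddAbove (range fun x : Icc (-Real.pi) Real.pi =>
      |iteratedDerivWithin j f (Icc (-Real.pi) Real.pi) x|) := by
  have hc : ContinuousOn (iteratedDerivWithin j f (Icc (-Real.pi) Real.pi))
      (Icc (-Real.pi) Real.pi) :=
    hf.continuousOn_iteratedDerivWithin (by exact_mod_cast hj) (uniqueDiffOn_Icc neg_pi_lt_pi)
  obtain ⟨B, hB⟩ := isCompact_Icc.exists_bound_of_continuousOn hc
  exact ⟨B, by rintro _ ⟨x, rfl⟩; exact hB x x.2⟩

theorem abs_iteratedDerivWithin_le_cNorm {k j : ℕ} {f : ℝ → ℝ}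
    (hf : ContDiffOn ℝ k f (Icc (-Real.pi) Real.pi)) (hj : j ≤ k) {x : ℝ}
    (hx : x ∈ Icc (-Real.pi) Real.pi) :
    |iteratedDerivWithin j f (Icc (-Real.pi) Real.pi) x| ≤ cNorm k f := by
  refine (le_ciSup (bddAbove_iteratedDerivWithin hf hj) ⟨x, hx⟩).trans ?_
  exact Finset.single_le_sum (f := fun j => ⨆ x : Icc (-Real.pi) Real.pi,
    |iteratedDerivWithin j f (Icc (-Real.pi) Real.pi) x|)
    (fun i _ => Real.iSup_nonneg fun x => abs_nonneg _) (Finset.mem_range.2 (by omega))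

theorem cNorm_one_le {f : ℝ → ℝ} {A B : ℝ} (hA : ∀ x ∈ Icc (-Real.pi) Real.pi, |f x| ≤ A)
    (hB : ∀ x ∈ Icc (-Real.pi) Real.pi, |derivWithin f (Icc (-Real.pi) Real.pi) x| ≤ B) :
    cNorm 1 f ≤ A + B := by
  have : Nonempty (Icc (-Real.pi) Real.pi) := ⟨⟨Real.pi, neg_pi_lt_pi.le, le_rfl⟩⟩
  simp only [cNorm, Finset.sum_range_succ, Finset.sum_range_zero, zero_add,
    iteratedDerivWithin_zero, iteratedDerivWithin_one]
  exact add_le_add (ciSup_le fun x => hA x x.2) (ciSup_le fun x => hB x x.2)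

/-- A mean-free function is bounded by the period times a bound for its derivative. -/
theorem abs_le_of_integral_eq_zero {w w' : ℝ → ℝ} {B : ℝ}
    (hd : ∀ x ∈ Icc (-Real.pi) Real.pi, HasDerivAt w (w' x) x)
    (hB : ∀ x ∈ Icc (-Real.pi) Real.pi, |w' x| ≤ B)
    (h0 : ∫ x in (-Real.pi)..Real.pi, w x = 0) {x : ℝ} (hx : x ∈ Icc (-Real.pi) Real.pi) :
    |w x| ≤ 7 * B := by
  have hc : ContinuousOn w (Icc (-Real.pi) Real.pi) := fun x hx =>
    (hd x hx).continuousAt.continuousWithinAt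
  have hpi := Real.pi_pos
  have hpi' := Real.pi_lt_d2
  have hB0 : 0 ≤ B := (abs_nonneg _).trans (hB x hx)
  have hosc : ∀ y ∈ Icc (-Real.pi) Real.pi, |w x - w y| ≤ 7 * B := by
    intro y hy
    have := (convex_Icc (-Real.pi) Real.pi).norm_image_sub_le_of_norm_hasDerivWithin_le
      (fun z hz => (hd z hz).hasDerivWithinAt) hB hy hx
    rw [Real.norm_eq_abs, Real.norm_eq_abs] at this
    have h2 : |x - y| ≤ 7 := by
      rw [abs_le]; constructor <;> linarith [hx.1, hx.2, hy.1, hy.2]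
    have := mul_le_mul_of_nonneg_left h2 hB0
    linarith
  have h1 : ∫ y in (-Real.pi)..Real.pi, (w x - w y) = 2 * Real.pi * w x := by
    rw [intervalIntegral.integral_sub (by simp) (intervalIntegrable_of_Icc hc), h0,
      intervalIntegral.integral_const, smul_eq_mul]
    ring
  have h2 := abs_integral_le_Icc (f := fun y => w x - w y) (g := fun _ => 7 * B)
    (by fun_prop) (by fun_prop) hosc
  rw [h1, intervalIntegral.integral_const, smul_eq_mul, abs_mul,
    abs_of_pos (by linarith : 0 < 2 * Real.pi), show Real.pi - -Real.pi = 2 * Real.pi by ring] at h2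
  exact le_of_mul_le_mul_left h2 (by linarith)

/-- Amplitude scaling of solutions. -/
theorem IsGlobalC3Solution.rescale {f a₀ : ℝ → ℝ} {a : ℝ → ℝ → ℝ} {μ : ℝ} (hμ : 0 < μ)
    (h : IsGlobalC3Solution f a) (h0 : ∀ x ∈ Icc (-Real.pi) Real.pi, a₀ x = μ * f x) :
    IsGlobalC3Solution a₀ fun t x => μ * a (μ * t) x where
  contDiffOn := by
    refine contDiffOn_const.mul (h.contDiffOn.comp (f := fun p : ℝ × ℝ => (μ * p.1, p.2))
      (by fun_prop) fun p hp => ⟨mul_nonneg hμ.le hp.1, hp.2⟩)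
  initial := fun x hx => by
    simp only [mul_zero, h.initial x hx, h0 x hx]
  equation := by
    intro t ht x hx
    obtain ⟨at', ax, -, -, hdt, hdx, heq⟩ := h.exists_partials
    have hμt : 0 ≤ μ * t := mul_nonneg hμ.le ht
    have e1 : HasDerivWithinAt (fun s => μ * a (μ * s) x) (μ * (at' (μ * t) x * μ)) (Ici 0) t := by
      have h1 : HasDerivWithinAt (fun s : ℝ => μ * s) μ (Ici 0) t := by
        simpa using ((hasDerivAt_id t).const_mul μ).hasDerivWithinAt
      exact (HasDerivWithinAt.comp (h₂ := fun s => a s x) (h := fun s : ℝ => μ * s) t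
        (hdt (μ * t) hμt x hx) h1 (fun s hs => mul_nonneg hμ.le hs)).const_mul μ
    have e2 : HasDerivWithinAt (fun x => μ * a (μ * t) x) (μ * ax (μ * t) x)
        (Icc (-Real.pi) Real.pi) x := (hdx (μ * t) hμt x hx).const_mul μ
    rw [e1.derivWithin (uniqueDiffOn_Ici 0 t ht),
      e2.derivWithin (uniqueDiffOn_Icc neg_pi_lt_pi x hx), heq _ hμt x hx]
    simp only [mul_pow, intervalIntegral.integral_const_mul]
    ring

/-- The derivatives of a multiple of `f - cos`. -/
theorem iteratedDeriv_mul_sub_cos {f : ℝ → ℝ} (hf : ContDiff ℝ 3 f) (μ x : ℝ) :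
    iteratedDeriv 1 (fun x => μ * (f x - Real.cos x)) x = μ * (deriv f x + Real.sin x) ∧
    iteratedDeriv 2 (fun x => μ * (f x - Real.cos x)) x = μ * (deriv (deriv f) x + Real.cos x) ∧
    iteratedDeriv 3 (fun x => μ * (f x - Real.cos x)) x
      = μ * (deriv (deriv (deriv f)) x - Real.sin x) := by
  have hf1 : ContDiff ℝ 2 (deriv f) :=
    (contDiff_succ_iff_deriv.1 (hf.of_le (by norm_num) : ContDiff ℝ (2 + 1) f)).2.2
  have hf2 : ContDiff ℝ 1 (deriv (deriv f)) :=
    (contDiff_succ_iff_deriv.1 (hf1.of_le (by norm_num) : ContDiff ℝ (1 + 1) (deriv f))).2.2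
  have d1 : deriv (fun x => μ * (f x - Real.cos x)) = fun x => μ * (deriv f x + Real.sin x) :=
    funext fun x => by
      simpa using (((hf.differentiable (by norm_num) x).hasDerivAt.fun_sub
        (Real.hasDerivAt_cos x)).const_mul μ).deriv
  have d2 : deriv (fun x => μ * (deriv f x + Real.sin x))
      = fun x => μ * (deriv (deriv f) x + Real.cos x) :=
    funext fun x => (((hf1.differentiable (by norm_num) x).hasDerivAt.fun_add
        (Real.hasDerivAt_sin x)).const_mul μ).deriv
  have d3 : deriv (fun x => μ * (deriv (deriv f) x + Real.cos x))
      = fun x => μ * (deriv (deriv (deriv f)) x - Real.sin x) :=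
    funext fun x => by
      simpa [sub_eq_add_neg] using (((hf2.differentiable (by norm_num) x).hasDerivAt.fun_add
        (Real.hasDerivAt_cos x)).const_mul μ).deriv
  have i1 : iteratedDeriv 1 (fun x => μ * (f x - Real.cos x))
      = fun x => μ * (deriv f x + Real.sin x) := by rw [iteratedDeriv_one, d1]
  have i2 : iteratedDeriv 2 (fun x => μ * (f x - Real.cos x))
      = fun x => μ * (deriv (deriv f) x + Real.cos x) := by rw [iteratedDeriv_succ, i1, d2]
  refine ⟨by rw [i1], by rw [i2], ?_⟩
  rw [iteratedDeriv_succ, i2, d3]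

/-- Reduction of the hypotheses of the theorem to unit amplitude and to a function on the line. -/
theorem exists_nearCos {a₀ : ℝ → ℝ} {μ σ : ℝ} (hμ : 0 < μ)
    (ha₀ : ContDiffOn ℝ 3 a₀ (Icc (-Real.pi) Real.pi))
    (hmean : ∫ x in (-Real.pi)..Real.pi, a₀ x = 0)
    (hσ : cNorm 3 (fun x => a₀ x - μ * Real.cos x) = σ) (hle : σ ≤ 1 / 100000 * μ) :
    ∃ (f : ℝ → ℝ) (x₀ : ℝ), NearCos f (σ / μ) x₀ ∧
      ∀ x ∈ Icc (-Real.pi) Real.pi, a₀ x = μ * f x := by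
  -- On the extension the one-sided derivatives entering `cNorm` become ordinary ones.
  obtain ⟨g, hg, hag⟩ := exists_contDiff_extension neg_pi_lt_pi 3 a₀ (by exact_mod_cast ha₀)
  set f : ℝ → ℝ := fun x => μ⁻¹ * g x with hf
  have hfc : ContDiff ℝ 3 f := contDiff_const.mul (by exact_mod_cast hg)
  have haf : ∀ x ∈ Icc (-Real.pi) Real.pi, a₀ x = μ * f x := fun x hx => by
    rw [hag hx, hf]; field_simp
  have hne : (Icc (-Real.pi) Real.pi).Nonempty := nonempty_Icc.2 neg_pi_lt_pi.le
  obtain ⟨x₀, hx₀, hmax⟩ := isCompact_Icc.exists_isMaxOn hne hfc.continuous.continuousOn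
  have hφ : ContDiff ℝ 3 fun x => μ * (f x - Real.cos x) :=
    contDiff_const.mul (hfc.sub Real.contDiff_cos)
  have heq : EqOn (fun x => a₀ x - μ * Real.cos x) (fun x => μ * (f x - Real.cos x))
      (Icc (-Real.pi) Real.pi) := fun x hx => by simp only [haf x hx]; ring
  have hcd : ContDiffOn ℝ (3 : ℕ) (fun x => a₀ x - μ * Real.cos x) (Icc (-Real.pi) Real.pi) := by
    refine ContDiffOn.congr ?_ heq
    exact_mod_cast hφ.contDiffOn
  have hbd : ∀ j ≤ 3, ∀ x ∈ Icc (-Real.pi) Real.pi,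
      |iteratedDeriv j (fun x => μ * (f x - Real.cos x)) x| ≤ σ := by
    intro j hj x hx
    have h1 := abs_iteratedDerivWithin_le_cNorm hcd hj hx
    rw [hσ, iteratedDerivWithin_congr heq hx, iteratedDerivWithin_eq_iteratedDeriv
      (uniqueDiffOn_Icc neg_pi_lt_pi) (hφ.contDiffAt.of_le (by exact_mod_cast hj)) hx] at h1
    exact h1
  have hscale : ∀ u : ℝ, |μ * u| ≤ σ → |u| ≤ σ / μ := fun u hu => by
    rw [abs_mul, abs_of_pos hμ] at hu
    rw [le_div_iff₀ hμ]; linarith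
  refine ⟨f, x₀, ⟨hfc, ?_, by rw [div_le_iff₀ hμ]; exact hle, fun x hx => hscale _ ?_,
    fun x hx => hscale _ ?_, fun x hx => hscale _ ?_, fun x hx => hscale _ ?_, hx₀, hmax⟩, haf⟩
  · have : ∫ x in (-Real.pi)..Real.pi, a₀ x = μ * ∫ x in (-Real.pi)..Real.pi, f x := by
      rw [← intervalIntegral.integral_const_mul]
      refine intervalIntegral.integral_congr fun x hx => ?_
      rw [uIcc_of_le neg_pi_lt_pi.le] at hx
      exact haf x hx
    rw [hmean] at this
    exact (mul_eq_zero.1 this.symm).resolve_left hμ.ne'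
  · simpa using hbd 0 (by norm_num) x hx
  · rw [← (iteratedDeriv_mul_sub_cos hfc μ x).1]; exact hbd 1 (by norm_num) x hx
  · rw [← (iteratedDeriv_mul_sub_cos hfc μ x).2.1]; exact hbd 2 (by norm_num) x hx
  · rw [← (iteratedDeriv_mul_sub_cos hfc μ x).2.2]; exact hbd 3 le_rfl x hx

theorem theorem1p3 :
    ∃ δ : ℝ, 0 < δ ∧ ∃ C : ℝ, 0 < C ∧
      ∀ μ : ℝ, 0 < μ → ∀ a₀ : ℝ → ℝ,
        ContDiffOn ℝ 3 a₀ (Set.Icc (-Real.pi) Real.pi) →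
        (∫ x in (-Real.pi)..Real.pi, a₀ x) = 0 →
        ∀ σ : ℝ, cNorm 3 (fun x => a₀ x - μ * Real.cos x) = σ → σ ≤ δ * μ →
          -- there is a global `C³` solution, it stays mean-free, and it is the only one
          ∃ a : ℝ → ℝ → ℝ, IsGlobalC3Solution a₀ a ∧
            (∀ t : ℝ, 0 ≤ t → (∫ x in (-Real.pi)..Real.pi, a t x) = 0) ∧
            (∀ b : ℝ → ℝ → ℝ, IsGlobalC3Solution a₀ b →
              ∀ t : ℝ, 0 ≤ t → ∀ x ∈ Set.Icc (-Real.pi) Real.pi, b t x = a t x) ∧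
            -- there is exactly one point `x₀` at which `a₀` attains its maximum,
            -- and `μs = -a₀''(x₀)` is the limit amplitude
            ∃ x₀ ∈ Set.Icc (-Real.pi) Real.pi,
              IsMaxOn a₀ (Set.Icc (-Real.pi) Real.pi) x₀ ∧
              (∀ y ∈ Set.Icc (-Real.pi) Real.pi,
                IsMaxOn a₀ (Set.Icc (-Real.pi) Real.pi) y → y = x₀) ∧
              ∃ μs : ℝ,
                μs = -iteratedDerivWithin 2 a₀ (Set.Icc (-Real.pi) Real.pi) x₀ ∧
                |μs - μ| ≤ C * σ ∧
                ∀ t : ℝ, 0 ≤ t →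
                  cNorm 1 (fun x => a t x - μs * Real.cos x) ≤ C * σ * Real.exp (-μ * t / 2) := by
  -- `633600 = 600 * 1056` bounds the slope error; recovering values from slopes costs a factor `7`,
  -- so the `C¹` norm has `8 * 633600 = 5068800`.
  refine ⟨1 / 100000, by norm_num, 5068800, by norm_num, ?_⟩
  intro μ hμ a₀ ha₀ hmean σ hσ hle
  obtain ⟨f, x₀, h, haf⟩ := exists_nearCos hμ ha₀ hmean hσ hle
  obtain ⟨a, ha, hslope⟩ := h.exists_solution
  have hsol := ha.rescale hμ haf
  have hσ0 : 0 ≤ σ / μ := h.nonneg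
  have hσμ : μ * (σ / μ) = σ := by field_simp
  have hσ1 : 0 ≤ σ := hσμ ▸ mul_nonneg hμ.le hσ0
  refine ⟨fun t x => μ * a (μ * t) x, hsol, fun t ht => hsol.integral_eq_zero hmean ht,
    fun b hb t ht x hx => hsol.unique hb hmean ht hx, x₀, h.mem, fun y hy => ?_,
    fun y hy hmax => h.max_unique hy ?_, μ * -deriv (deriv f) x₀, ?_, ?_, fun t ht => ?_⟩
  · rw [mem_ofPred_eq, haf y hy, haf x₀ h.mem]
    exact mul_le_mul_of_nonneg_left (h.le_max y hy) hμ.le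
  · have := hmax h.mem
    rw [mem_ofPred_eq, haf y hy, haf x₀ h.mem] at this
    exact le_of_mul_le_mul_left this hμ
  · have hc : ContDiff ℝ 3 fun x => μ * f x := contDiff_const.mul h.contDiff
    rw [iteratedDerivWithin_congr (g := fun x => μ * f x) haf h.mem,
      iteratedDerivWithin_eq_iteratedDeriv (uniqueDiffOn_Icc neg_pi_lt_pi)
        (hc.contDiffAt.of_le (by norm_num)) h.mem]
    have d1 : deriv (fun x => μ * f x) = fun x => μ * deriv f x :=
      funext fun x => ((h.hasDerivAt₀ x).const_mul μ).deriv
    rw [iteratedDeriv_succ, iteratedDeriv_one, d1, ((h.hasDerivAt₁ x₀).const_mul μ).deriv]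
    ring
  · have := h.abs_curvature_sub_one_le
    rw [show μ * -deriv (deriv f) x₀ - μ = μ * (-deriv (deriv f) x₀ - 1) by ring, abs_mul,
      abs_of_pos hμ]
    calc μ * |-deriv (deriv f) x₀ - 1| ≤ μ * (2 * (σ / μ)) := by gcongr
      _ = 2 * σ := by linear_combination 2 * hσμ
      _ ≤ 5068800 * σ := by linarith
  · have hμt : 0 ≤ μ * t := mul_nonneg hμ.le ht
    set m := -deriv (deriv f) x₀ with hm
    set B := 633600 * σ * Real.exp (-μ * t / 2) with hB
    choose! a' ha' hle' using hslope (μ * t) hμt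
    have hd : ∀ x ∈ Icc (-Real.pi) Real.pi,
        HasDerivAt (fun x => μ * a (μ * t) x - μ * m * Real.cos x)
          (μ * (a' x + m * Real.sin x)) x := fun x hx => by
      refine (((ha' x hx).const_mul μ).fun_sub
        ((Real.hasDerivAt_cos x).const_mul (μ * m))).congr_deriv ?_
      ring
    have hbd : ∀ x ∈ Icc (-Real.pi) Real.pi, |μ * (a' x + m * Real.sin x)| ≤ B := fun x hx => by
      rw [abs_mul, abs_of_pos hμ, hB]
      calc μ * |a' x + m * Real.sin x|
          ≤ μ * (633600 * (σ / μ) * Real.exp (-(μ * t) / 2)) := by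
            gcongr; exact hle' x hx
        _ = 633600 * (μ * (σ / μ)) * Real.exp (-μ * t / 2) := by
            rw [show -μ * t / 2 = -(μ * t) / 2 by ring]; ring
        _ = _ := by rw [hσμ]
    -- Solution and cosine both have zero mean, so the slope bound controls the difference itself.
    have hint : ∫ x in (-Real.pi)..Real.pi, (μ * a (μ * t) x - μ * m * Real.cos x) = 0 := by
      have hc : ContinuousOn (fun x => μ * a (μ * t) x) (Icc (-Real.pi) Real.pi) := fun x hx =>
        ((ha' x hx).const_mul μ).continuousAt.continuousWithinAt
      rw [intervalIntegral.integral_sub (intervalIntegrable_of_Icc hc)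
        (intervalIntegrable_of_Icc (by fun_prop)), hsol.integral_eq_zero hmean ht,
        intervalIntegral.integral_const_mul, integral_cos]
      simp
    refine (cNorm_one_le (fun x hx => abs_le_of_integral_eq_zero hd hbd hint hx)
      (B := B) fun x hx => ?_).trans (le_of_eq (by rw [hB]; ring))
    rw [(hd x hx).hasDerivWithinAt.derivWithin (uniqueDiffOn_Icc neg_pi_lt_pi x hx)]
    exact hbd x hx
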